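/- Let $\mathcal{F}^\omega[\mathbb{P}]$ be the following classical system over the finite types generated from $0$ (natural numbers), $\Omega$ (sample points) and $S$ (events). It contains weakly extensional Peano arithmetic $\mathsf{WE}\text{-}\mathsf{PA}^\omega$ in these types (combinators, simultaneous recursors, full induction, equality of type $0$ as the only primitive predicate, and the quantifier-free rule of extensionality: from $\varphi_0\to s=_\rho t$ infer $\varphi_0\to r[s/x]=_\tau r[t/x]$ for quantifier-free $\varphi_0$), quantifier-free choice $\mathsf{QF}\text{-}\mathsf{AC}$ and dependent choice $\mathsf{DC}$, and constants with axioms stating that equality on $\Omega$ is an equivalence relation, that $S$ is an algebra of subsets of $\Omega$ under $\cup$, complement and $\emptyset$, and that $\mathbb{P}$ is a (finitely additive) probability content on $S$, with values represented as fast converging Cauchy sequences of rationals. For $V\in\{\Omega,S\}$ let $\mathsf{UB}^V_0$ be the schema $$\forall y^{\alpha(0)}\bigl(\forall k^0,x^\alpha,\underline z^{\underline\beta}\,\exists w^0\,\varphi_\exists(y,k,\min\nolimits_\alpha(x,yk),\underline z,w)\to\exists\chi^{0(0)}\,\forall k^0,x^\alpha,\underline z^{\underline\beta}\,\exists w\le_0\chi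 k\;\varphi_\exists(y,k,\min\nolimits_\alpha(x,yk),\underline z,w)\bigr),$$ where $\alpha$ is a type of the form $0(\sigma_k)\cdots(\sigma_1)$, the types in $\underline\beta$ are of the form $V(\tau_m)\cdots(\tau_1)$, and $\varphi_\exists$ is an existential formula (possibly with parameters) all of whose quantifiers have admissible types, that is, types $\tau_0(\tau_k)\cdots(\tau_1)$ with $\tau_0\in\{0,\Omega,S\}$ and each $\tau_i$ of the form $\rho_0(0)\cdots(0)$ with $\rho_0\in\{0,\Omega,S\}$. For a formula $\varphi(\varpi^\Omega)$ and a real $\lambda$, write $$\mathbb{P}[\varphi]\ge\lambda\;:\equiv\;\forall A^S\bigl(\mathbb{P}(A)<_{\mathbb R}\lambda\to\exists\varpi^\Omega\in A^c\,\varphi(\varpi)\bigr).$$ Let $\mathcal{T}:=\mathcal{F}^\omega[\mathbb{P}]+\mathsf{UB}^\Omega_0+\mathsf{UB}^S_0$. Let $\varphi_0(x^0,n^0,k^0,\varpi^\Omega)$ be a quantifier-free formula, possibly with parameters, and let $P$ be a term of type $S(0)(0)(0)$, possibly with parameters, such that $\mathcal{T}$ proves - (measurability) $\forall x,n,k\,\forall\varpi\,(\varpi\in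 P_{x,n,k}\leftrightarrow\varphi_0(x,n,k,\varpi))$, - (monotonicity in $n$) $\forall x,\varpi,k,n,n'\,(n'\ge n\wedge\varphi_0(x,n,k,\varpi)\to\varphi_0(x,n',k,\varpi))$, - (anti-monotonicity in $k$) $\forall x,\varpi,n,k,k'\,(k'\ge k\wedge\varphi_0(x,n,k',\varpi)\to\varphi_0(x,n,k,\varpi))$. Then $\mathcal{T}$ proves the equivalence of 1. $\forall x^0\,(\mathbb{P}[\exists n^0\forall k^0\varphi_0(x,n,k)]\ge 1)$, 2. $\forall m^0\forall x^0\exists n^0\,(\mathbb{P}[\forall k^0\varphi_0(x,n,k)]\ge 1-2^{-m})$. The same holds relative to any finite list $\Delta$ of additional assumptions, used as ordinary (not rule-admissible) hypotheses: if the three conditions are derivable in $\mathcal{T}$ from $\Delta$, then so is the equivalence of (1) and (2). -/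

import Mathlib

namespace ProbLogic

/-! ## Finite types, terms and formulas -/

/-- The finite types over the base types `0` (`nat`), `Ω` (`omega`) and `S` (`event`);
`ρ ⇾ τ` is the type `τ(ρ)` of functionals from `ρ` to `τ`. -/
inductive Ty : Type
  | nat : Ty
  | omega : Ty
  | event : Ty
  | fn : Ty → Ty → Ty

infixr:60 " ⇾ " => Ty.fn

open Ty

/-- `arrs [σ₁, …, σₖ] τ` is the type `τ(σₖ)…(σ₁)` of functionals of `k` arguments. -/
def arrs : List Ty → Ty → Ty
  | [], τ => τ
  | σ :: l, τ => σ ⇾ arrs l τ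

/-- Contexts: lists of types of the variables in scope, the innermost variable first. -/
abbrev Ctx : Type := List Ty

/-- Variables of type `τ` in a context (de Bruijn indices). The same family is used for the
positions of type `τ` in a list of types. -/
inductive Var : Ctx → Ty → Type
  | z {Γ : Ctx} {σ : Ty} : Var (σ :: Γ) σ
  | s {Γ : Ctx} {σ τ : Ty} : Var Γ τ → Var (σ :: Γ) τ

/-- The type of the step functional for the component of type `σ` in a simultaneous recursion
on the tuple of types `l`: it takes the `l`-tuple of previous values and the index. -/
def stepTy (l : List Ty) (σ : Ty) : Ty := arrs l (nat ⇾ σ)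

/-- The constants of the language. -/
inductive Const : Ty → Type
  | zero : Const nat
  | succ : Const (nat ⇾ nat)
  /-- the projector `Π` -/
  | proj (ρ τ : Ty) : Const (ρ ⇾ τ ⇾ ρ)
  /-- the distributor `Σ` -/
  | dist (δ ρ τ : Ty) : Const ((δ ⇾ ρ ⇾ τ) ⇾ (δ ⇾ ρ) ⇾ δ ⇾ τ)
  /-- the `i`-th component of the simultaneous recursor for the tuple of types `l` -/
  | recur (l : List Ty) {ρ : Ty} (i : Var l ρ) :
      Const (nat ⇾ arrs l (arrs (l.map (stepTy l)) ρ))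
  /-- the characteristic function of equality on `Ω` (value `0` means equal) -/
  | eqOmega : Const (omega ⇾ omega ⇾ nat)
  /-- the characteristic function of membership (value `0` means member) -/
  | mem : Const (omega ⇾ event ⇾ nat)
  | union : Const (event ⇾ event ⇾ event)
  | compl : Const (event ⇾ event)
  | empty : Const event
  /-- the probability content, with values in (representatives of) the reals -/
  | prob : Const (event ⇾ nat ⇾ nat)
  /-- an element of `Ω` -/
  | point : Const omega

inductive Term (Γ : Ctx) : Ty → Type
  | var {τ : Ty} : Var Γ τ → Term Γ τ
  | cst {τ : Ty} : Const τ → Term Γ τ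
  | app {ρ τ : Ty} : Term Γ (ρ ⇾ τ) → Term Γ ρ → Term Γ τ

infixl:100 " ⬝ " => Term.app

/-- Formulas. The only predicate symbol is equality of type `0`. -/
inductive Formula : Ctx → Type
  | eq0 {Γ : Ctx} : Term Γ nat → Term Γ nat → Formula Γ
  | bot {Γ : Ctx} : Formula Γ
  | and {Γ : Ctx} : Formula Γ → Formula Γ → Formula Γ
  | or {Γ : Ctx} : Formula Γ → Formula Γ → Formula Γ
  | imp {Γ : Ctx} : Formula Γ → Formula Γ → Formula Γ
  | all {Γ : Ctx} (σ : Ty) : Formula (σ :: Γ) → Formula Γ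
  | ex {Γ : Ctx} (σ : Ty) : Formula (σ :: Γ) → Formula Γ

open Formula

infixr:35 " ⟹ " => Formula.imp
infixr:45 " ⋏ " => Formula.and
infixr:40 " ⋎ " => Formula.or

def Formula.neg {Γ : Ctx} (φ : Formula Γ) : Formula Γ := φ ⟹ bot
def Formula.iff {Γ : Ctx} (φ ψ : Formula Γ) : Formula Γ := (φ ⟹ ψ) ⋏ (ψ ⟹ φ)

infix:30 " ⟺ " => Formula.iff

/-- Quantifier-free formulas. -/
def Formula.QF : {Γ : Ctx} → Formula Γ → Prop
  | _, eq0 _ _ => True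
  | _, bot => True
  | _, and φ ψ => φ.QF ∧ ψ.QF
  | _, or φ ψ => φ.QF ∧ ψ.QF
  | _, imp φ ψ => φ.QF ∧ ψ.QF
  | _, all _ _ => False
  | _, ex _ _ => False

/-- `∀` over a tuple of variables. -/
def alls {Γ : Ctx} : (l : List Ty) → Formula (l ++ Γ) → Formula Γ
  | [], φ => φ
  | σ :: l, φ => alls l (all σ φ)

/-- `∃` over a tuple of variables. -/
def exs {Γ : Ctx} : (l : List Ty) → Formula (l ++ Γ) → Formula Γ
  | [], φ => φ
  | σ :: l, φ => exs l (ex σ φ)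

/-! ## Renaming and substitution -/

/-- Renamings of variables. -/
abbrev Ren (Γ Δ : Ctx) : Type := ∀ ⦃τ : Ty⦄, Var Γ τ → Var Δ τ

/-- Substitutions of terms for variables; a `Sub l Γ` also serves as an `l`-tuple of terms. -/
abbrev Sub (Γ Δ : Ctx) : Type := ∀ ⦃τ : Ty⦄, Var Γ τ → Term Δ τ

def Ren.lift {Γ Δ : Ctx} (r : Ren Γ Δ) (σ : Ty) : Ren (σ :: Γ) (σ :: Δ)
  | _, .z => .z
  | _, .s v => .s (r v)

def Ren.lifts {Γ Δ : Ctx} (r : Ren Γ Δ) : (l : List Ty) → Ren (l ++ Γ) (l ++ Δ)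
  | [] => r
  | σ :: l => Ren.lift (Ren.lifts r l) σ

/-- The renaming that passes to a context with one more variable. -/
def Ren.wk (Γ : Ctx) (σ : Ty) : Ren Γ (σ :: Γ) := fun _ v => .s v

def Term.rename {Γ Δ : Ctx} (r : Ren Γ Δ) : {τ : Ty} → Term Γ τ → Term Δ τ
  | _, .var v => .var (r v)
  | _, .cst c => .cst c
  | _, .app f a => (f.rename r) ⬝ (a.rename r)

def Term.wk {Γ : Ctx} {σ τ : Ty} (t : Term Γ τ) : Term (σ :: Γ) τ := t.rename (Ren.wk Γ σ)

def Formula.rename : {Γ Δ : Ctx} → Ren Γ Δ → Formula Γ → Formula Δ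
  | _, _, r, eq0 s t => eq0 (s.rename r) (t.rename r)
  | _, _, _, bot => bot
  | _, _, r, and φ ψ => (φ.rename r) ⋏ (ψ.rename r)
  | _, _, r, or φ ψ => (φ.rename r) ⋎ (ψ.rename r)
  | _, _, r, imp φ ψ => (φ.rename r) ⟹ (ψ.rename r)
  | _, _, r, all σ φ => all σ (φ.rename (r.lift σ))
  | _, _, r, ex σ φ => ex σ (φ.rename (r.lift σ))

def Formula.wk {Γ : Ctx} {σ : Ty} (φ : Formula Γ) : Formula (σ :: Γ) := φ.rename (Ren.wk Γ σ)

/-- The identity substitution. -/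
def Sub.id (Γ : Ctx) : Sub Γ Γ := fun _ v => .var v

/-- The substitution with value `t` on the innermost variable and `s` elsewhere. -/
def Sub.cons {Γ Δ : Ctx} {σ : Ty} (t : Term Δ σ) (s : Sub Γ Δ) : Sub (σ :: Γ) Δ
  | _, .z => t
  | _, .s v => s v

/-- The substitution with the tuple `a` on the innermost variables `l` and `s` elsewhere. -/
def Sub.append {Γ Δ : Ctx} : {l : List Ty} → (a : Sub l Δ) → (s : Sub Γ Δ) → Sub (l ++ Γ) Δ
  | [], _, s => s
  | _ :: _, a, s => Sub.cons (a .z) (Sub.append (fun _ v => a (.s v)) s)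

def Sub.lift {Γ Δ : Ctx} (s : Sub Γ Δ) (σ : Ty) : Sub (σ :: Γ) (σ :: Δ) :=
  Sub.cons (.var .z) (fun _ v => (s v).wk)

def Sub.lifts {Γ Δ : Ctx} (s : Sub Γ Δ) : (l : List Ty) → Sub (l ++ Γ) (l ++ Δ)
  | [] => s
  | σ :: l => Sub.lift (Sub.lifts s l) σ

def Term.subst {Γ Δ : Ctx} (s : Sub Γ Δ) : {τ : Ty} → Term Γ τ → Term Δ τ
  | _, .var v => s v
  | _, .cst c => .cst c
  | _, .app f a => (f.subst s) ⬝ (a.subst s)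

def Formula.subst : {Γ Δ : Ctx} → Sub Γ Δ → Formula Γ → Formula Δ
  | _, _, r, eq0 s t => eq0 (s.subst r) (t.subst r)
  | _, _, _, bot => bot
  | _, _, r, and φ ψ => (φ.subst r) ⋏ (ψ.subst r)
  | _, _, r, or φ ψ => (φ.subst r) ⋎ (ψ.subst r)
  | _, _, r, imp φ ψ => (φ.subst r) ⟹ (ψ.subst r)
  | _, _, r, all σ φ => all σ (φ.subst (r.lift σ))
  | _, _, r, ex σ φ => ex σ (φ.subst (r.lift σ))

/-- `r[t/x]` for the innermost variable `x`. -/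
def Term.inst {Γ : Ctx} {σ τ : Ty} (r : Term (σ :: Γ) τ) (t : Term Γ σ) : Term Γ τ :=
  r.subst (Sub.cons t (Sub.id Γ))

/-- `φ[t/x]` for the innermost variable `x`. -/
def Formula.inst {Γ : Ctx} {σ : Ty} (φ : Formula (σ :: Γ)) (t : Term Γ σ) : Formula Γ :=
  φ.subst (Sub.cons t (Sub.id Γ))

/-- The variables of an initial block `l` of a context. -/
def Var.inl {Γ : Ctx} {τ : Ty} : {l : List Ty} → Var l τ → Var (l ++ Γ) τ
  | _ :: _, .z => .z
  | _ :: _, .s v => .s (Var.inl v)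

/-- The variables behind an initial block `l` of a context. -/
def Var.inr {Γ : Ctx} {τ : Ty} : (l : List Ty) → Var Γ τ → Var (l ++ Γ) τ
  | [], v => v
  | _ :: l, v => .s (Var.inr l v)

/-- The position in `l.map f` that corresponds to a position in `l`. -/
def Var.map (f : Ty → Ty) {τ : Ty} : {l : List Ty} → Var l τ → Var (l.map f) (f τ)
  | _ :: _, .z => .z
  | _ :: _, .s v => .s (Var.map f v)

/-- Application of a functional to a tuple of arguments. -/
def Term.apps {Γ : Ctx} {τ : Ty} : {l : List Ty} → Term Γ (arrs l τ) → Sub l Γ → Term Γ τ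
  | [], t, _ => t
  | _ :: l, t, a => Term.apps (l := l) (t ⬝ a .z) (fun _ v => a (.s v))

/-- Lambda abstraction of the innermost variable, defined through the combinators. -/
def Term.lam {Γ : Ctx} {σ : Ty} : {τ : Ty} → Term (σ :: Γ) τ → Term Γ (σ ⇾ τ)
  | _, .var .z => .cst (.dist σ (σ ⇾ σ) σ) ⬝ .cst (.proj σ (σ ⇾ σ)) ⬝ .cst (.proj σ σ)
  | _, .var (.s v) => .cst (.proj _ σ) ⬝ .var v
  | _, .cst c => .cst (.proj _ σ) ⬝ .cst c
  | _, .app f a => .cst (.dist σ _ _) ⬝ f.lam ⬝ a.lam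

abbrev v0 {Γ : Ctx} {a : Ty} : Term (a :: Γ) a := .var .z
abbrev v1 {Γ : Ctx} {a b : Ty} : Term (a :: b :: Γ) b := .var (.s .z)
abbrev v2 {Γ : Ctx} {a b c : Ty} : Term (a :: b :: c :: Γ) c := .var (.s (.s .z))
abbrev v3 {Γ : Ctx} {a b c d : Ty} : Term (a :: b :: c :: d :: Γ) d := .var (.s (.s (.s .z)))
abbrev v4 {Γ : Ctx} {a b c d e : Ty} : Term (a :: b :: c :: d :: e :: Γ) e :=
  .var (.s (.s (.s (.s .z))))

/-! ## Arithmetic of type `0`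

Truth values of characteristic terms are `0` for true and `1` for false. -/

section Arithmetic

variable {Γ : Ctx}

def zeroT : Term Γ nat := .cst .zero
def succT (t : Term Γ nat) : Term Γ nat := .cst .succ ⬝ t
def oneT : Term Γ nat := succT zeroT

/-- The `i`-th component of the simultaneous recursion with start values `y` and step
functionals `f`, at the argument `n`. -/
def recT {l : List Ty} {ρ : Ty} (i : Var l ρ) (n : Term Γ nat) (y : Sub l Γ)
    (f : Sub (l.map (stepTy l)) Γ) : Term Γ ρ :=
  Term.apps (Term.apps (.cst (.recur l i) ⬝ n) y) f

/-- Recursion of type `0`: value `a` at `0`, and value `step` at `x + 1`, where in `step` the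
innermost variable is `x` and the next one is the value at `x`. -/
def natRec (n a : Term Γ nat) (step : Term (nat :: nat :: Γ) nat) : Term Γ nat :=
  .cst (.recur [nat] .z) ⬝ n ⬝ a ⬝ step.lam.lam

def predT (t : Term Γ nat) : Term Γ nat := natRec t zeroT v0
def addT (s t : Term Γ nat) : Term Γ nat := natRec t s (succT v1)
def mulT (s t : Term Γ nat) : Term Γ nat := natRec t zeroT (addT v1 s.wk.wk)
/-- Cut-off subtraction. -/
def monusT (s t : Term Γ nat) : Term Γ nat := natRec t s (predT v1)
def pow2T (t : Term Γ nat) : Term Γ nat := natRec t oneT (addT v1 v1)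
/-- `a` if `c = 0`, and `b` otherwise. -/
def condT (c a b : Term Γ nat) : Term Γ nat := natRec c a b.wk.wk
def minT (s t : Term Γ nat) : Term Γ nat := monusT s (monusT s t)
/-- The characteristic term of `s < t`. -/
def ltT (s t : Term Γ nat) : Term Γ nat := monusT oneT (monusT t s)

/-- `s ≤₀ t`. -/
def le0 (s t : Term Γ nat) : Formula Γ := eq0 (monusT s t) zeroT

/-- The Cantor pairing `(a + b)(a + b + 1)/2 + a`. -/
def pairT (a b : Term Γ nat) : Term Γ nat :=
  addT (natRec (addT a b) zeroT (addT v1 (succT v0))) a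

/-- The step functionals of the recursion that enumerates all pairs along the Cantor pairing:
`(a, 0)` is followed by `(0, a + 1)`, and `(a, b + 1)` by `(a + 1, b)`. -/
def unpairSteps : Sub ([nat, nat].map (stepTy [nat, nat])) Γ
  | _, .z => Term.lam (Term.lam (Term.lam (condT v1 zeroT (succT v2))))
  | _, .s .z => Term.lam (Term.lam (Term.lam (condT v1 (succT v2) (predT v1))))

def unpairStart : Sub [nat, nat] Γ
  | _, .z => zeroT
  | _, .s .z => zeroT

def fstT (t : Term Γ nat) : Term Γ nat :=
  recT (l := [nat, nat]) .z t unpairStart unpairSteps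
def sndT (t : Term Γ nat) : Term Γ nat :=
  recT (l := [nat, nat]) (.s .z) t unpairStart unpairSteps

/-! ## Rational numbers and real numbers

A natural number `q` codes the rational `(a - b) / (d + 1)`, where `q` is the pair of the pair of
`a` and `b`, and `d`. -/

def qCode (a b d : Term Γ nat) : Term Γ nat := pairT (pairT a b) d
def qPos (q : Term Γ nat) : Term Γ nat := fstT (fstT q)
def qNegPart (q : Term Γ nat) : Term Γ nat := sndT (fstT q)
def qDen (q : Term Γ nat) : Term Γ nat := succT (sndT q)

def qOne : Term Γ nat := qCode oneT zeroT zeroT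
def qZero : Term Γ nat := qCode zeroT zeroT zeroT
def qAdd (p q : Term Γ nat) : Term Γ nat :=
  qCode (addT (mulT (qPos p) (qDen q)) (mulT (qPos q) (qDen p)))
    (addT (mulT (qNegPart p) (qDen q)) (mulT (qNegPart q) (qDen p)))
    (predT (mulT (qDen p) (qDen q)))
def qNeg (q : Term Γ nat) : Term Γ nat := qCode (qNegPart q) (qPos q) (sndT q)
def qSub (p q : Term Γ nat) : Term Γ nat := qAdd p (qNeg q)
def qAbs (q : Term Γ nat) : Term Γ nat :=
  qCode (addT (monusT (qPos q) (qNegPart q)) (monusT (qNegPart q) (qPos q))) zeroT (sndT q)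
/-- The rational `2⁻ⁿ`. -/
def qPow (n : Term Γ nat) : Term Γ nat := qCode oneT zeroT (predT (pow2T n))

/-- The characteristic term of `p < q` for rationals. -/
def qLtT (p q : Term Γ nat) : Term Γ nat :=
  ltT (addT (mulT (qPos p) (qDen q)) (mulT (qNegPart q) (qDen p)))
    (addT (mulT (qPos q) (qDen p)) (mulT (qNegPart p) (qDen q)))
def qLt (p q : Term Γ nat) : Formula Γ := eq0 (qLtT p q) zeroT
def qLe (p q : Term Γ nat) : Formula Γ := (qLt q p).neg

/-- Nonzero if and only if `|f k - f (k + 1)| ≥ 2⁻ᵏ⁻¹` for some `k < n`. -/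
def badT (f : Term Γ (nat ⇾ nat)) (n : Term Γ nat) : Term Γ nat :=
  natRec n zeroT (addT v1
    (qLtT (qAbs (qSub (f.wk.wk ⬝ v0) (f.wk.wk ⬝ succT v0))) (qPow (succT v0))))

/-- The `n`-th member of the fast Cauchy sequence attached to `f`: it agrees with `f` as long as
`|f k - f (k + 1)| < 2⁻ᵏ⁻¹`, and is constant from the first violation on. In this way every object
of type `1` represents a real number. -/
def hat (f : Term Γ (nat ⇾ nat)) (n : Term Γ nat) : Term Γ nat :=
  natRec n (f ⬝ zeroT) (condT (badT f.wk.wk (succT v0)) (f.wk.wk ⬝ succT v0) v1)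

/-- The real number given by a rational. -/
def ratR (q : Term Γ nat) : Term Γ (nat ⇾ nat) := Term.lam q.wk

def addR (x y : Term Γ (nat ⇾ nat)) : Term Γ (nat ⇾ nat) :=
  Term.lam (qAdd (hat x.wk (succT v0)) (hat y.wk (succT v0)))

def eqR (x y : Term Γ (nat ⇾ nat)) : Formula Γ :=
  all nat (qLt (qAbs (qSub (hat x.wk (succT v0)) (hat y.wk (succT v0)))) (qPow v0))
def ltR (x y : Term Γ (nat ⇾ nat)) : Formula Γ :=
  ex nat (qLe (qPow v0) (qSub (hat y.wk (succT v0)) (hat x.wk (succT v0))))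
def leR (x y : Term Γ (nat ⇾ nat)) : Formula Γ := (ltR y x).neg

end Arithmetic

/-! ## Events and higher-type equality -/

section Events

variable {Γ : Ctx}

def memF (w : Term Γ omega) (A : Term Γ event) : Formula Γ := eq0 (.cst .mem ⬝ w ⬝ A) zeroT
def unionT (A B : Term Γ event) : Term Γ event := .cst .union ⬝ A ⬝ B
def complT (A : Term Γ event) : Term Γ event := .cst .compl ⬝ A
def emptyT : Term Γ event := .cst .empty
def fullT : Term Γ event := complT emptyT
def interT (A B : Term Γ event) : Term Γ event := complT (unionT (complT A) (complT B))
def probT (A : Term Γ event) : Term Γ (nat ⇾ nat) := .cst .prob ⬝ A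

def eqOmegaF (x y : Term Γ omega) : Formula Γ := eq0 (.cst .eqOmega ⬝ x ⬝ y) zeroT
def subsetF (A B : Term Γ event) : Formula Γ :=
  all omega (memF v0 A.wk ⟹ memF v0 B.wk)

/-- Equality of arbitrary type. -/
def eqTy : (τ : Ty) → {Γ : Ctx} → Term Γ τ → Term Γ τ → Formula Γ
  | nat, _, s, t => eq0 s t
  | omega, _, s, t => eqOmegaF s t
  | event, _, s, t => all omega (memF v0 s.wk ⟺ memF v0 t.wk)
  | fn ρ τ, _, s, t => all ρ (eqTy τ (s.wk ⬝ v0) (t.wk ⬝ v0))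

/-- The pointwise minimum of two functionals of type `0(σₖ)…(σ₁)`. -/
def minTy : (l : List Ty) → {Γ : Ctx} → Term Γ (arrs l nat) → Term Γ (arrs l nat) →
    Term Γ (arrs l nat)
  | [], _, s, t => minT s t
  | _ :: l, _, s, t => Term.lam (minTy l (s.wk ⬝ v0) (t.wk ⬝ v0))

end Events

/-! ## The axioms -/

/-- A theory: a set of formulas in each context (open formulas are read universally). -/
abbrev Theory : Type := ∀ ⦃Γ : Ctx⦄, Formula Γ → Prop

/-- The matrix `A₀(x, Y x)` of the conclusion of the axiom of choice: `A₀(x, y)` with a tuple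
`y` of types `ts` and a tuple `x` of types `ss`. -/
def choiceMatrix {Γ : Ctx} (ss ts : List Ty) (A : Formula (ts ++ (ss ++ Γ))) :
    Formula (ss ++ (ts.map (arrs ss) ++ Γ)) :=
  A.subst (Sub.append
    (fun _ i => Term.apps (.var (Var.inr ss (Var.inl (Var.map (arrs ss) i))))
      (fun _ j => .var (Var.inl j)))
    (Sub.append (fun _ j => .var (Var.inl j))
      (fun _ v => .var (Var.inr ss (Var.inr (ts.map (arrs ss)) v)))))

/-- The matrix `A(n, f n, f (n + 1))` of the conclusion of dependent choice, from `A(n, y, z)`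
with tuples `y` and `z` of types `l`. -/
def dcMatrix {Γ : Ctx} (l : List Ty) (A : Formula (l ++ (l ++ (nat :: Γ)))) :
    Formula (nat :: (l.map (fun ρ => nat ⇾ ρ) ++ Γ)) :=
  A.subst (Sub.append
    (fun _ i => .var (.s (Var.inl (Var.map (fun ρ => nat ⇾ ρ) i))) ⬝ succT v0)
    (Sub.append (fun _ i => .var (.s (Var.inl (Var.map (fun ρ => nat ⇾ ρ) i))) ⬝ v0)
      (Sub.cons v0 (fun _ v => .var (.s (Var.inr (l.map (fun ρ => nat ⇾ ρ)) v))))))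

/-- The axioms of the system `𝓕^ω[ℙ]` (besides classical logic and the quantifier-free rule of
extensionality, which are part of the notion of derivation): arithmetic in all finite types,
quantifier-free choice, dependent choice, the algebra of events, and the probability content.
That membership respects equality on `Ω` follows by the rule of extensionality. -/
inductive FAxioms : Theory
  -- equality of type 0 and arithmetic
  | eq_refl {Γ : Ctx} (t : Term Γ nat) : FAxioms (eq0 t t)
  | eq_symm {Γ : Ctx} (s t : Term Γ nat) : FAxioms (eq0 s t ⟹ eq0 t s)
  | eq_trans {Γ : Ctx} (r s t : Term Γ nat) : FAxioms (eq0 r s ⟹ eq0 s t ⟹ eq0 r t)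
  | succ_ne_zero {Γ : Ctx} (t : Term Γ nat) : FAxioms (eq0 (succT t) zeroT).neg
  | succ_inj {Γ : Ctx} (s t : Term Γ nat) : FAxioms (eq0 (succT s) (succT t) ⟹ eq0 s t)
  | induction {Γ : Ctx} (φ : Formula (nat :: Γ)) :
      FAxioms (φ.inst zeroT ⟹
        all nat (φ ⟹ φ.subst (Sub.cons (succT v0) (fun _ v => .var (.s v)))) ⟹ all nat φ)
  -- combinators and recursors
  | proj {Γ : Ctx} {ρ τ : Ty} (x : Term Γ ρ) (y : Term Γ τ) :
      FAxioms (eqTy ρ (.cst (.proj ρ τ) ⬝ x ⬝ y) x)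
  | dist {Γ : Ctx} {δ ρ τ : Ty} (x : Term Γ (δ ⇾ ρ ⇾ τ)) (y : Term Γ (δ ⇾ ρ)) (u : Term Γ δ) :
      FAxioms (eqTy τ (.cst (.dist δ ρ τ) ⬝ x ⬝ y ⬝ u) (x ⬝ u ⬝ (y ⬝ u)))
  | recur_zero {Γ : Ctx} {l : List Ty} {ρ : Ty} (i : Var l ρ) (y : Sub l Γ)
      (f : Sub (l.map (stepTy l)) Γ) : FAxioms (eqTy ρ (recT i zeroT y f) (y i))
  | recur_succ {Γ : Ctx} {l : List Ty} {ρ : Ty} (i : Var l ρ) (n : Term Γ nat) (y : Sub l Γ)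
      (f : Sub (l.map (stepTy l)) Γ) :
      FAxioms (eqTy ρ (recT i (succT n) y f)
        (Term.apps (l := l) (f (Var.map (stepTy l) i)) (fun _ j => recT j n y f) ⬝ n))
  -- choice
  | qf_ac {Γ : Ctx} (ss ts : List Ty) (A : Formula (ts ++ (ss ++ Γ))) (hA : A.QF) :
      FAxioms (alls ss (exs ts A) ⟹
        exs (ts.map (arrs ss)) (alls ss (choiceMatrix ss ts A)))
  | dc {Γ : Ctx} (l : List Ty) (A : Formula (l ++ (l ++ (nat :: Γ)))) :
      FAxioms (all nat (alls l (exs l A)) ⟹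
        exs (l.map (fun ρ => nat ⇾ ρ)) (all nat (dcMatrix l A)))
  -- equality on the sample space and the algebra of events
  | omega_refl {Γ : Ctx} (x : Term Γ omega) : FAxioms (eqOmegaF x x)
  | omega_symm {Γ : Ctx} (x y : Term Γ omega) : FAxioms (eqOmegaF x y ⟹ eqOmegaF y x)
  | omega_trans {Γ : Ctx} (x y u : Term Γ omega) :
      FAxioms (eqOmegaF x y ⟹ eqOmegaF y u ⟹ eqOmegaF x u)
  | mem_union {Γ : Ctx} (w : Term Γ omega) (A B : Term Γ event) :
      FAxioms (memF w (unionT A B) ⟺ (memF w A ⋎ memF w B))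
  | mem_compl {Γ : Ctx} (w : Term Γ omega) (A : Term Γ event) :
      FAxioms (memF w (complT A) ⟺ (memF w A).neg)
  | mem_empty {Γ : Ctx} (w : Term Γ omega) : FAxioms (memF w emptyT).neg
  -- the probability content
  | prob_nonneg {Γ : Ctx} (A : Term Γ event) : FAxioms (leR (ratR qZero) (probT A))
  | prob_empty {Γ : Ctx} : FAxioms (Γ := Γ) (eqR (probT emptyT) (ratR qZero))
  | prob_full {Γ : Ctx} : FAxioms (Γ := Γ) (eqR (probT fullT) (ratR qOne))
  | prob_union_inter {Γ : Ctx} (A B : Term Γ event) :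
      FAxioms (eqR (addR (probT (unionT A B)) (probT (interT A B)))
        (addR (probT A) (probT B)))
  | prob_mono {Γ : Ctx} (A B : Term Γ event) :
      FAxioms (subsetF A B ⟹ leR (probT A) (probT B))

/-- Base types. -/
def IsBase (τ : Ty) : Prop := τ = nat ∨ τ = omega ∨ τ = event

/-- Small types: `τ₀(0)…(0)` with `τ₀` a base type. -/
def IsSmall (τ : Ty) : Prop := ∃ (n : ℕ) (τ₀ : Ty), IsBase τ₀ ∧ τ = arrs (List.replicate n nat) τ₀

/-- Admissible types: `τ₀(τₖ)…(τ₁)` with `τ₀` a base type and `τ₁, …, τₖ` small. -/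
def IsAdmissible (τ : Ty) : Prop :=
  ∃ (l : List Ty) (τ₀ : Ty), IsBase τ₀ ∧ (∀ σ ∈ l, IsSmall σ) ∧ τ = arrs l τ₀

/-- Existential formulas, with all quantifiers of admissible type. -/
inductive IsExistential : {Γ : Ctx} → Formula Γ → Prop
  | qf {Γ : Ctx} {φ : Formula Γ} : φ.QF → IsExistential φ
  | ex {Γ : Ctx} {σ : Ty} {φ : Formula (σ :: Γ)} :
      IsAdmissible σ → IsExistential φ → IsExistential (Formula.ex σ φ)

/-- The types `V(τₘ)…(τ₁)` of the tuple `z` in the uniform boundedness principle. -/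
abbrev ubTypes (V : Ty) (b : List (List Ty)) : List Ty := b.map (fun l => arrs l V)

/-- The formula `φ(y, k, min(x, y k), z, w)`. In `φ` the variables are, from the outside,
`y` of type `α(0)` with `α = 0(σₖ)…(σ₁)`, `k` of type `0`, `x` of type `α`, the tuple `z`, and
`w` of type `0`. -/
def ubMatrix {Γ : Ctx} (V : Ty) (a : List Ty) (b : List (List Ty))
    (φ : Formula (nat :: (ubTypes V b ++ (arrs a nat :: nat :: (nat ⇾ arrs a nat) :: Γ)))) :
    Formula (nat :: (ubTypes V b ++ (arrs a nat :: nat :: (nat ⇾ arrs a nat) :: Γ))) :=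
  φ.subst (((Sub.cons (minTy a v0 (v2 ⬝ v1)) (fun _ v => .var (.s v))).lifts (ubTypes V b)).lift
    nat)

/-- The principle of uniform boundedness (with bounded variable of type `0`) for the abstract
type `V`:
`∀ y (∀ k, x, z ∃ w φ(y, k, min(x, y k), z, w) →
      ∃ χ ∀ k, x, z ∃ w ≤ χ k φ(y, k, min(x, y k), z, w))`
for existential `φ`, possibly with further parameters. -/
inductive UBAxioms (V : Ty) : Theory
  | ub {Γ : Ctx} (a : List Ty) (b : List (List Ty))
      (φ : Formula (nat :: (ubTypes V b ++ (arrs a nat :: nat :: (nat ⇾ arrs a nat) :: Γ))))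
      (hφ : IsExistential φ) :
      UBAxioms V (all (nat ⇾ arrs a nat)
        (all nat (all (arrs a nat) (alls (ubTypes V b) (ex nat (ubMatrix V a b φ)))) ⟹
          ex (nat ⇾ nat) (all nat (all (arrs a nat) (alls (ubTypes V b) (ex nat
            (le0 v0 (.var (.s (Var.inr (ubTypes V b) (.s (.s .z)))) ⬝
                .var (.s (Var.inr (ubTypes V b) (.s .z)))) ⋏
              (ubMatrix V a b φ).rename
                (((((Ren.wk _ (nat ⇾ nat)).lift nat).lift (arrs a nat)).lifts
                  (ubTypes V b)).lift nat))))))))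

/-- The system `𝓕^ω[ℙ] + UB^Ω_0 + UB^S_0`. -/
def FPUB : Theory := fun _ φ => FAxioms φ ∨ UBAxioms omega φ ∨ UBAxioms event φ

/-! ## Derivations -/

/-- `Deriv T Δ φ`: the formula `φ` is derivable from the axioms `T` and the assumptions `Δ` in
classical many-sorted predicate logic (natural deduction) with the quantifier-free rule of
extensionality; the premise of the latter has to be derived without assumptions. -/
inductive Deriv (T : Theory) : {Γ : Ctx} → List (Formula Γ) → Formula Γ → Prop
  | ax {Γ : Ctx} {Δ : List (Formula Γ)} {φ : Formula Γ} : T φ → Deriv T Δ φ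
  | hyp {Γ : Ctx} {Δ : List (Formula Γ)} {φ : Formula Γ} : φ ∈ Δ → Deriv T Δ φ
  | and_intro {Γ : Ctx} {Δ : List (Formula Γ)} {φ ψ : Formula Γ} :
      Deriv T Δ φ → Deriv T Δ ψ → Deriv T Δ (φ ⋏ ψ)
  | and_left {Γ : Ctx} {Δ : List (Formula Γ)} {φ ψ : Formula Γ} :
      Deriv T Δ (φ ⋏ ψ) → Deriv T Δ φ
  | and_right {Γ : Ctx} {Δ : List (Formula Γ)} {φ ψ : Formula Γ} :
      Deriv T Δ (φ ⋏ ψ) → Deriv T Δ ψ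
  | or_left {Γ : Ctx} {Δ : List (Formula Γ)} {φ ψ : Formula Γ} :
      Deriv T Δ φ → Deriv T Δ (φ ⋎ ψ)
  | or_right {Γ : Ctx} {Δ : List (Formula Γ)} {φ ψ : Formula Γ} :
      Deriv T Δ ψ → Deriv T Δ (φ ⋎ ψ)
  | or_elim {Γ : Ctx} {Δ : List (Formula Γ)} {φ ψ χ : Formula Γ} :
      Deriv T Δ (φ ⋎ ψ) → Deriv T (φ :: Δ) χ → Deriv T (ψ :: Δ) χ → Deriv T Δ χ
  | imp_intro {Γ : Ctx} {Δ : List (Formula Γ)} {φ ψ : Formula Γ} :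
      Deriv T (φ :: Δ) ψ → Deriv T Δ (φ ⟹ ψ)
  | imp_elim {Γ : Ctx} {Δ : List (Formula Γ)} {φ ψ : Formula Γ} :
      Deriv T Δ (φ ⟹ ψ) → Deriv T Δ φ → Deriv T Δ ψ
  | by_contra {Γ : Ctx} {Δ : List (Formula Γ)} {φ : Formula Γ} :
      Deriv T (φ.neg :: Δ) bot → Deriv T Δ φ
  | all_intro {Γ : Ctx} {Δ : List (Formula Γ)} {σ : Ty} {φ : Formula (σ :: Γ)} :
      Deriv T (Δ.map Formula.wk) φ → Deriv T Δ (all σ φ)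
  | all_elim {Γ : Ctx} {Δ : List (Formula Γ)} {σ : Ty} {φ : Formula (σ :: Γ)} (t : Term Γ σ) :
      Deriv T Δ (all σ φ) → Deriv T Δ (φ.inst t)
  | ex_intro {Γ : Ctx} {Δ : List (Formula Γ)} {σ : Ty} {φ : Formula (σ :: Γ)} (t : Term Γ σ) :
      Deriv T Δ (φ.inst t) → Deriv T Δ (ex σ φ)
  | ex_elim {Γ : Ctx} {Δ : List (Formula Γ)} {σ : Ty} {φ : Formula (σ :: Γ)} {χ : Formula Γ} :
      Deriv T Δ (ex σ φ) → Deriv T (φ :: Δ.map Formula.wk) χ.wk → Deriv T Δ χ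
  | qf_er {Γ : Ctx} {Δ : List (Formula Γ)} {ρ τ : Ty} {φ : Formula Γ} {s t : Term Γ ρ}
      (r : Term (ρ :: Γ) τ) : φ.QF →
      Deriv T [] (φ ⟹ eqTy ρ s t) → Deriv T Δ (φ ⟹ eqTy τ (r.inst s) (r.inst t))

/-! ## Probabilistic statements -/

section Statements

variable {Γ : Ctx}

/-- `ℙ[φ] ≥ x`, that is, `∀ A (ℙ(A) < x → ∃ ω ∈ Aᶜ φ(ω))`; the sample point `ω` is the innermost
variable of `φ`. -/
def probGe (φ : Formula (omega :: Γ)) (x : Term Γ (nat ⇾ nat)) : Formula Γ :=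
  all event (ltR (probT v0) x.wk ⟹
    ex omega (memF v0 (complT v1) ⋏ φ.rename ((Ren.wk Γ event).lift omega)))

/-- The context of a formula `φ(x, n, k, ω)` with parameters from `Γ`. -/
abbrev MatrixCtx (Γ : Ctx) : Ctx := omega :: nat :: nat :: nat :: Γ

/-- The instance `φ(x, n, k, w)`, in a context `Δ` into which the parameters are embedded by
`e`. -/
def matrixAt {Δ : Ctx} (φ : Formula (MatrixCtx Γ)) (e : Ren Γ Δ) (x n k : Term Δ nat)
    (w : Term Δ omega) : Formula Δ :=
  φ.subst (Sub.cons w (Sub.cons k (Sub.cons n (Sub.cons x (fun _ v => .var (e v))))))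

/-- `∀ x, n, k, ω (ω ∈ P x n k ↔ φ(x, n, k, ω))`. -/
def measurableF (φ : Formula (MatrixCtx Γ)) (P : Term Γ (nat ⇾ nat ⇾ nat ⇾ event)) : Formula Γ :=
  all nat (all nat (all nat (all omega
    (memF v0 (P.wk.wk.wk.wk ⬝ v3 ⬝ v2 ⬝ v1) ⟺
      matrixAt φ (fun _ v => .s (.s (.s (.s v)))) v3 v2 v1 v0))))

/-- `∀ x, ω, k, n, n' (n' ≥ n ∧ φ(x, n, k, ω) → φ(x, n', k, ω))`. -/
def monotoneF (φ : Formula (MatrixCtx Γ)) : Formula Γ :=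
  all nat (all omega (all nat (all nat (all nat
    (le0 v1 v0 ⋏ matrixAt φ (fun _ v => .s (.s (.s (.s (.s v))))) v4 v1 v2 v3 ⟹
      matrixAt φ (fun _ v => .s (.s (.s (.s (.s v))))) v4 v0 v2 v3)))))

/-- `∀ x, ω, n, k, k' (k' ≥ k ∧ φ(x, n, k', ω) → φ(x, n, k, ω))`. -/
def antitoneF (φ : Formula (MatrixCtx Γ)) : Formula Γ :=
  all nat (all omega (all nat (all nat (all nat
    (le0 v1 v0 ⋏ matrixAt φ (fun _ v => .s (.s (.s (.s (.s v))))) v4 v2 v0 v3 ⟹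
      matrixAt φ (fun _ v => .s (.s (.s (.s (.s v))))) v4 v2 v1 v3)))))

/-- `∀ x (ℙ[∃ n ∀ k φ(x, n, k)] ≥ 1)`. -/
def pointwiseF (φ : Formula (MatrixCtx Γ)) : Formula Γ :=
  all nat (probGe
    (ex nat (all nat (matrixAt φ (fun _ v => .s (.s (.s (.s v)))) v3 v1 v0 v2)))
    (ratR qOne))

/-- `∀ m ∀ x ∃ n (ℙ[∀ k φ(x, n, k)] ≥ 1 - 2⁻ᵐ)`. -/
def uniformF (φ : Formula (MatrixCtx Γ)) : Formula Γ :=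
  all nat (all nat (ex nat (probGe
    (all nat (matrixAt φ (fun _ v => .s (.s (.s (.s (.s v))))) v3 v2 v0 v1))
    (ratR (qSub qOne (qPow v2))))))

end Statements

end ProbLogic

namespace ProbLogic

open Ty Formula

/-! ## Substitution calculus -/

/-! The proof is semantic. By `completeness`, a formula is derivable from a finite list of
assumptions once it holds, under these assumptions, in every structure satisfying `Struct.IsModel`.
Inside a model the argument is ordinary mathematics, provided that induction, dependent choice and
uniform boundedness are applied only to formulas of the language.

In a model fix `x` and write `E n k` for the event given by `φ(x, n, k)`. Suppose (2) fails at `m`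
and `x`: every `⋂ₖ E n k` lies in an event of probability below `1 - 2⁻ᵐ`. Uniform boundedness on
`Ω` acts as compactness: since `E n k` decreases in `k`, a single `E n k` already lies in that event
(`exists_prb_le_of_cover`). Choose `jₙ` such that the probability of `E n jₙ` is minimal up to a
small error, and let `Cₙ` be the union of the `E i jᵢ` for `i ≤ n` (`exists_event_sequence`, by
dependent choice). The probability of `Cₙ` exceeds that of any `E n k` by at most about `2⁻ᵐ⁻¹`: the
event `E n (jₙ + jₙ₊₁)` lies in both `Cₙ` and `E (n + 1) jₙ₊₁`, so inclusion-exclusion bounds the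
growth from `Cₙ` to `Cₙ₊₁` by the growth from `E n` to `E (n + 1)`, up to summable errors
(`prb_union_step`). Hence all `Cₙ` have probability below 1 by a fixed margin.

Countable additivity is not available, and uniform boundedness on `S` replaces it. If every event
within that margin missed a point of some `Cₙ`, then it would do so for some `n ≤ N` with `N`
independent of the event, and `C_N` itself would be a counterexample. So a single event of
probability below 1 contains all `Cₙ`, hence `⋃ₙ ⋂ₖ E n k` (`exists_cover`), contradicting (1). The
converse only needs `m` with `ℙ(A) < 1 - 2⁻ᵐ`.

Completeness is a Henkin construction: finite consistent sets in growing contexts, an ideal that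
decides all formulas, and terms modulo Leibniz equality tested at type `0`. The natural numbers of a
model, possibly nonstandard, form an ordered semiring. Rational codes are evaluated in its field of
fractions `K`, where the estimates become linear inequalities. -/

theorem Sub.hext {Γ Δ : Ctx} {s t : Sub Γ Δ} (h : ∀ τ (v : Var Γ τ), s v = t v) : s = t := by
  funext τ v; exact h τ v

theorem Term.subst_congr {Γ Δ : Ctx} {s t : Sub Γ Δ} (h : ∀ τ (v : Var Γ τ), s v = t v) {τ : Ty}
    (a : Term Γ τ) : a.subst s = a.subst t := by rw [Sub.hext h]

theorem Term.rename_eq_subst {Γ Δ : Ctx} (r : Ren Γ Δ) {τ : Ty} (t : Term Γ τ) :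
    t.rename r = t.subst (fun _ v => .var (r v)) := by
  induction t with
  | var v => rfl
  | cst c => rfl
  | app f a hf ha => simp only [Term.rename, Term.subst, hf, ha]

theorem Term.subst_subst {Γ Δ Θ : Ctx} (s : Sub Γ Δ) (s' : Sub Δ Θ) {τ : Ty} (t : Term Γ τ) :
    (t.subst s).subst s' = t.subst (fun _ v => (s v).subst s') := by
  induction t with
  | var v => rfl
  | cst c => rfl
  | app f a hf ha => simp only [Term.subst, hf, ha]

theorem Term.subst_id {Γ : Ctx} {τ : Ty} (t : Term Γ τ) : t.subst (Sub.id Γ) = t := by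
  induction t with
  | var v => rfl
  | cst c => rfl
  | app f a hf ha => simp only [Term.subst, hf, ha]

theorem Term.subst_wk {Γ Δ : Ctx} {σ τ : Ty} (s : Sub (σ :: Γ) Δ) (t : Term Γ τ) :
    (Term.wk t : Term (σ :: Γ) τ).subst s = t.subst (fun _ v => s (.s v)) := by
  rw [Term.wk, Term.rename_eq_subst, Term.subst_subst]; rfl

theorem Term.wk_subst {Γ Δ : Ctx} {σ τ : Ty} (s : Sub Γ Δ) (t : Term Γ τ) :
    (t.subst s).wk (σ := σ) = t.subst (fun _ v => (s v).wk) := by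
  rw [Term.wk, Term.rename_eq_subst, Term.subst_subst]
  refine Term.subst_congr (fun τ v => ?_) t
  rw [Term.wk, Term.rename_eq_subst]

theorem Term.wk_subst_lift {Γ Δ : Ctx} {σ τ : Ty} (s : Sub Γ Δ) (t : Term Γ τ) :
    t.wk.subst (s.lift σ) = (t.subst s).wk := by
  rw [Term.subst_wk, Term.wk_subst]; rfl

/-- Composition of substitutions. -/
def Sub.comp {Γ Δ Θ : Ctx} (s : Sub Γ Δ) (s' : Sub Δ Θ) : Sub Γ Θ := fun _ v => (s v).subst s'

theorem Sub.lift_comp {Γ Δ Θ : Ctx} (s : Sub Γ Δ) (s' : Sub Δ Θ) (σ : Ty) :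
    (s.lift σ).comp (s'.lift σ) = (s.comp s').lift σ := by
  refine Sub.hext fun τ v => ?_
  cases v with
  | z => rfl
  | s v => exact Term.wk_subst_lift s' (s v)

theorem Formula.subst_subst {Γ Δ Θ : Ctx} (s : Sub Γ Δ) (s' : Sub Δ Θ) (φ : Formula Γ) :
    (φ.subst s).subst s' = φ.subst (s.comp s') := by
  induction φ generalizing Δ Θ with
  | eq0 a b => simp only [Formula.subst, Term.subst_subst]; rfl
  | bot => rfl
  | and φ ψ h₁ h₂ => simp only [Formula.subst, h₁, h₂]
  | or φ ψ h₁ h₂ => simp only [Formula.subst, h₁, h₂]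
  | imp φ ψ h₁ h₂ => simp only [Formula.subst, h₁, h₂]
  | all σ φ h => simp only [Formula.subst, h, Sub.lift_comp]
  | ex σ φ h => simp only [Formula.subst, h, Sub.lift_comp]

theorem Sub.lift_var {Γ Δ : Ctx} (r : Ren Γ Δ) (σ : Ty) :
    Sub.lift (fun _ v => .var (r v)) σ = (fun _ v => .var (r.lift σ v) : Sub (σ :: Γ) (σ :: Δ)) := by
  refine Sub.hext fun τ v => ?_
  cases v <;> rfl

theorem Formula.rename_eq_subst {Γ Δ : Ctx} (r : Ren Γ Δ) (φ : Formula Γ) :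
    φ.rename r = φ.subst (fun _ v => .var (r v)) := by
  induction φ generalizing Δ with
  | eq0 a b => simp only [Formula.rename, Formula.subst, Term.rename_eq_subst]
  | bot => rfl
  | and φ ψ h₁ h₂ => simp only [Formula.rename, Formula.subst, h₁, h₂]
  | or φ ψ h₁ h₂ => simp only [Formula.rename, Formula.subst, h₁, h₂]
  | imp φ ψ h₁ h₂ => simp only [Formula.rename, Formula.subst, h₁, h₂]
  | all σ φ h => simp only [Formula.rename, Formula.subst, h, Sub.lift_var]
  | ex σ φ h => simp only [Formula.rename, Formula.subst, h, Sub.lift_var]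

theorem Sub.lift_id (Γ : Ctx) (σ : Ty) : (Sub.id Γ).lift σ = Sub.id (σ :: Γ) := by
  refine Sub.hext fun τ v => ?_
  cases v <;> rfl

theorem Formula.subst_id {Γ : Ctx} (φ : Formula Γ) : φ.subst (Sub.id Γ) = φ := by
  induction φ with
  | eq0 a b => simp only [Formula.subst, Term.subst_id]
  | bot => rfl
  | and φ ψ h₁ h₂ => simp only [Formula.subst, h₁, h₂]
  | or φ ψ h₁ h₂ => simp only [Formula.subst, h₁, h₂]
  | imp φ ψ h₁ h₂ => simp only [Formula.subst, h₁, h₂]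
  | all σ φ h => simp only [Formula.subst, h, Sub.lift_id]
  | ex σ φ h => simp only [Formula.subst, h, Sub.lift_id]

theorem Formula.inst_lift {Γ Δ : Ctx} {σ : Ty} (φ : Formula (σ :: Γ)) (s : Sub Γ Δ)
    (t : Term Δ σ) : (φ.subst (s.lift σ)).inst t = φ.subst (Sub.cons t s) := by
  rw [Formula.inst, Formula.subst_subst]
  congr 1
  refine Sub.hext fun τ v => ?_
  cases v with
  | z => rfl
  | s v => exact (Term.subst_wk _ _).trans (Term.subst_id _)

theorem Formula.inst_subst {Γ Δ : Ctx} {σ : Ty} (φ : Formula (σ :: Γ)) (s : Sub Γ Δ)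
    (t : Term Γ σ) : (φ.inst t).subst s = (φ.subst (s.lift σ)).inst (t.subst s) := by
  rw [Formula.inst_lift, Formula.inst, Formula.subst_subst]
  congr 1
  refine Sub.hext fun τ v => ?_
  cases v <;> rfl

theorem Formula.QF.subst {Γ Δ : Ctx} (s : Sub Γ Δ) {φ : Formula Γ} (h : φ.QF) :
    (φ.subst s).QF := by
  induction φ generalizing Δ with
  | eq0 a b => trivial
  | bot => trivial
  | and φ ψ h₁ h₂ => exact ⟨h₁ s h.1, h₂ s h.2⟩
  | or φ ψ h₁ h₂ => exact ⟨h₁ s h.1, h₂ s h.2⟩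
  | imp φ ψ h₁ h₂ => exact ⟨h₁ s h.1, h₂ s h.2⟩
  | all σ φ _ => exact h.elim
  | ex σ φ _ => exact h.elim

theorem IsExistential.subst {Γ Δ : Ctx} (s : Sub Γ Δ) {φ : Formula Γ} (h : IsExistential φ) :
    IsExistential (φ.subst s) := by
  induction h generalizing Δ with
  | qf h => exact .qf (h.subst s)
  | ex hσ _ ih => exact .ex hσ (ih _)

/-! ## Structures -/

/-- Structures for the language, with equality of type `0` interpreted as identity. -/
structure Struct where
  D : Ty → Type
  app : ∀ {ρ τ : Ty}, D (ρ ⇾ τ) → D ρ → D τ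
  cst : ∀ {τ : Ty}, Const τ → D τ

/-- Assignments of values to the variables of a context. -/
abbrev Struct.Env (M : Struct) (Γ : Ctx) : Type := ∀ ⦃τ : Ty⦄, Var Γ τ → M.D τ

namespace Struct

variable {M : Struct}

def Env.cons {Γ : Ctx} {σ : Ty} (a : M.D σ) (e : M.Env Γ) : M.Env (σ :: Γ)
  | _, .z => a
  | _, .s v => e v

def Env.nil : M.Env [] := fun _ v => nomatch v

def eval {Γ : Ctx} (e : M.Env Γ) : {τ : Ty} → Term Γ τ → M.D τ
  | _, .var v => e v
  | _, .cst c => M.cst c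
  | _, .app f a => M.app (eval e f) (eval e a)

def Sat : {Γ : Ctx} → M.Env Γ → Formula Γ → Prop
  | _, e, .eq0 s t => eval e s = eval e t
  | _, _, .bot => False
  | _, e, .and φ ψ => Sat e φ ∧ Sat e ψ
  | _, e, .or φ ψ => Sat e φ ∨ Sat e ψ
  | _, e, .imp φ ψ => Sat e φ → Sat e ψ
  | _, e, .all σ φ => ∀ a : M.D σ, Sat (Env.cons a e) φ
  | _, e, .ex σ φ => ∃ a : M.D σ, Sat (Env.cons a e) φ

theorem eval_subst {Γ Δ : Ctx} (s : Sub Γ Δ) (e : M.Env Δ) {τ : Ty} (t : Term Γ τ) :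
    eval e (t.subst s) = eval (fun _ v => eval e (s v)) t := by
  induction t with
  | var v => rfl
  | cst c => rfl
  | app f a hf ha => simp only [Term.subst, eval, hf, ha]

theorem eval_rename {Γ Δ : Ctx} (r : Ren Γ Δ) (e : M.Env Δ) {τ : Ty} (t : Term Γ τ) :
    eval e (t.rename r) = eval (fun _ v => e (r v)) t := by
  rw [Term.rename_eq_subst, eval_subst]; rfl

@[simp] theorem eval_wk {Γ : Ctx} {σ τ : Ty} (e : M.Env Γ) (a : M.D σ) (t : Term Γ τ) :
    eval (Env.cons a e) t.wk = eval e t := eval_rename _ _ _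

theorem eval_lift {Γ Δ : Ctx} (s : Sub Γ Δ) (e : M.Env Δ) {σ : Ty} (a : M.D σ) :
    (fun _ v => eval (Env.cons a e) (s.lift σ v) : M.Env (σ :: Γ)) =
      Env.cons a (fun _ v => eval e (s v)) := by
  funext τ v
  cases v with
  | z => rfl
  | s v => exact eval_wk e a (s v)

theorem sat_subst {Γ Δ : Ctx} (s : Sub Γ Δ) (e : M.Env Δ) (φ : Formula Γ) :
    Sat e (φ.subst s) ↔ Sat (fun _ v => eval e (s v)) φ := by
  induction φ generalizing Δ with
  | eq0 a b => simp only [Formula.subst, Sat, eval_subst]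
  | bot => rfl
  | and φ ψ h₁ h₂ => simp only [Formula.subst, Sat, h₁, h₂]
  | or φ ψ h₁ h₂ => simp only [Formula.subst, Sat, h₁, h₂]
  | imp φ ψ h₁ h₂ => simp only [Formula.subst, Sat, h₁, h₂]
  | all σ φ h => simp only [Formula.subst, Sat, h, eval_lift]
  | ex σ φ h => simp only [Formula.subst, Sat, h, eval_lift]

theorem sat_rename {Γ Δ : Ctx} (r : Ren Γ Δ) (e : M.Env Δ) (φ : Formula Γ) :
    Sat e (φ.rename r) ↔ Sat (fun _ v => e (r v)) φ := by
  rw [Formula.rename_eq_subst, sat_subst]; rfl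

theorem sat_inst {Γ : Ctx} {σ : Ty} (e : M.Env Γ) (φ : Formula (σ :: Γ)) (t : Term Γ σ) :
    Sat e (φ.inst t) ↔ Sat (Env.cons (eval e t) e) φ := by
  rw [Formula.inst, sat_subst]
  have : (fun _ v => eval e (Sub.cons t (Sub.id Γ) v) : M.Env (σ :: Γ)) =
      Env.cons (eval e t) e := by
    funext τ v; cases v <;> rfl
  rw [this]

end Struct
end ProbLogic

namespace ProbLogic

open Ty Formula

/-! ## Countability of the language -/

def Ty.code : Ty → ℕ
  | nat => 0
  | omega => 1
  | event => 2
  | fn ρ τ => Nat.pair ρ.code τ.code + 3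

theorem Ty.code_injective : Function.Injective Ty.code := by
  intro ρ
  induction ρ with
  | nat => intro τ h; cases τ <;> simp [Ty.code] at h ⊢
  | omega => intro τ h; cases τ <;> simp [Ty.code] at h ⊢
  | event => intro τ h; cases τ <;> simp [Ty.code] at h ⊢
  | fn a b ha hb =>
    intro τ h
    cases τ with
    | fn c d =>
      simp only [Ty.code, Nat.add_right_cancel_iff, Nat.pair_eq_pair] at h
      rw [ha h.1, hb h.2]
    | _ => simp [Ty.code] at h

instance : Countable Ty := Ty.code_injective.countable

def Var.index {Γ : Ctx} {τ : Ty} : Var Γ τ → ℕ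
  | .z => 0
  | .s v => v.index + 1

instance (Γ : Ctx) (τ : Ty) : Countable (Var Γ τ) := by
  refine Function.Injective.countable (f := Var.index) fun v => ?_
  induction v with
  | z => intro w h; cases w with
    | z => rfl
    | s w => simp [Var.index] at h
  | s v ih => intro w h; cases w with
    | z => simp [Var.index] at h
    | s w => rw [ih (Nat.succ.inj h)]

theorem countable_sigma_const : Countable (Σ τ, Const τ) := by
  let A : Type := Fin 9 ⊕ (Ty × Ty) ⊕ (Ty × Ty × Ty) ⊕ (Σ (l : List Ty) (ρ : Ty), Var l ρ)
  let f : A → Σ τ, Const τ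
    | .inl 0 => ⟨_, .zero⟩
    | .inl 1 => ⟨_, .succ⟩
    | .inl 2 => ⟨_, .eqOmega⟩
    | .inl 3 => ⟨_, .mem⟩
    | .inl 4 => ⟨_, .union⟩
    | .inl 5 => ⟨_, .compl⟩
    | .inl 6 => ⟨_, .empty⟩
    | .inl 7 => ⟨_, .prob⟩
    | .inl 8 => ⟨_, .point⟩
    | .inr (.inl (a, b)) => ⟨_, .proj a b⟩
    | .inr (.inr (.inl (a, b, c))) => ⟨_, .dist a b c⟩
    | .inr (.inr (.inr ⟨l, _, i⟩)) => ⟨_, .recur l i⟩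
  refine Function.Surjective.countable (f := f) ?_
  rintro ⟨_, c⟩
  cases c with
  | zero => exact ⟨.inl 0, rfl⟩
  | succ => exact ⟨.inl 1, rfl⟩
  | eqOmega => exact ⟨.inl 2, rfl⟩
  | mem => exact ⟨.inl 3, rfl⟩
  | union => exact ⟨.inl 4, rfl⟩
  | compl => exact ⟨.inl 5, rfl⟩
  | empty => exact ⟨.inl 6, rfl⟩
  | prob => exact ⟨.inl 7, rfl⟩
  | point => exact ⟨.inl 8, rfl⟩
  | proj a b => exact ⟨.inr (.inl (a, b)), rfl⟩
  | dist a b c => exact ⟨.inr (.inr (.inl (a, b, c))), rfl⟩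
  | recur l i => exact ⟨.inr (.inr (.inr ⟨l, _, i⟩)), rfl⟩

/-- An inductive family is countable if its members have finite ranks and there are countably
many members of each rank. -/
theorem countable_of_rank {α : Type} (r : α → ℕ) (h : ∀ n, {a | r a < n}.Countable) :
    Countable α := by
  rw [← Set.countable_univ_iff]
  refine (Set.countable_iUnion h).mono fun a _ => ?_
  exact Set.mem_iUnion.2 ⟨r a + 1, Nat.lt_succ_self _⟩

def Term.rank {Γ : Ctx} : {τ : Ty} → Term Γ τ → ℕ
  | _, .var _ => 0
  | _, .cst _ => 0
  | _, .app f a => max f.rank a.rank + 1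

/-- All types are treated at once, because an application of type `τ` involves an argument of
arbitrary type `ρ`. -/
instance (Γ : Ctx) : Countable (Σ τ, Term Γ τ) := by
  refine countable_of_rank (fun t => t.2.rank) fun n => ?_
  have := countable_sigma_const
  induction n with
  | zero => simp
  | succ n ih =>
    have hτ : ∀ τ, {t : Term Γ τ | t.rank < n}.Countable := fun τ =>
      ih.preimage (f := fun t => (⟨τ, t⟩ : Σ τ, Term Γ τ)) sigma_mk_injective
    refine (((Set.countable_range fun v : (Σ τ, Var Γ τ) => (⟨v.1, .var v.2⟩ : Σ τ, Term Γ τ)).union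
      (Set.countable_range fun c : (Σ τ, Const τ) => (⟨c.1, .cst c.2⟩ : Σ τ, Term Γ τ))).union
      (Set.countable_iUnion fun ρ => Set.countable_iUnion fun τ =>
        Set.Countable.image2 (hτ (ρ ⇾ τ)) (hτ ρ)
          (fun f a => (⟨τ, f ⬝ a⟩ : Σ τ, Term Γ τ)))).mono ?_
    rintro ⟨τ, t⟩ h
    cases t with
    | var v => exact .inl (.inl ⟨⟨τ, v⟩, rfl⟩)
    | cst c => exact .inl (.inr ⟨⟨τ, c⟩, rfl⟩)
    | app f a =>
      have h : max f.rank a.rank + 1 < n + 1 := h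
      have h' := max_lt_iff.1 (Nat.lt_of_succ_lt_succ h)
      exact .inr (Set.mem_iUnion.2 ⟨_, Set.mem_iUnion.2 ⟨_, f, h'.1, a, h'.2, rfl⟩⟩)

instance (Γ : Ctx) (τ : Ty) : Countable (Term Γ τ) :=
  Function.Injective.countable (f := fun t => (⟨τ, t⟩ : Σ τ, Term Γ τ)) sigma_mk_injective

def Formula.rank : {Γ : Ctx} → Formula Γ → ℕ
  | _, eq0 _ _ => 0
  | _, bot => 0
  | _, and φ ψ => max φ.rank ψ.rank + 1
  | _, or φ ψ => max φ.rank ψ.rank + 1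
  | _, imp φ ψ => max φ.rank ψ.rank + 1
  | _, all _ φ => φ.rank + 1
  | _, ex _ φ => φ.rank + 1

/-- The induction on the rank runs over all contexts, since quantifiers extend the context by any of
countably many types. -/
instance countable_formula (Γ : Ctx) : Countable (Formula Γ) := by
  refine countable_of_rank Formula.rank fun n => ?_
  induction n generalizing Γ with
  | zero => simp
  | succ n ih =>
    refine ((((((Set.countable_range fun p : Term Γ nat × Term Γ nat => eq0 p.1 p.2).union
      (Set.countable_singleton bot)).union
      (Set.Countable.image2 (ih Γ) (ih Γ) and)).union
      (Set.Countable.image2 (ih Γ) (ih Γ) or)).union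
      (Set.Countable.image2 (ih Γ) (ih Γ) imp)).union
      (Set.countable_iUnion fun σ => ((ih (σ :: Γ)).image (all σ)).union
        ((ih (σ :: Γ)).image (ex σ)))).mono ?_
    intro φ h
    cases φ with
    | eq0 s t => exact .inl (.inl (.inl (.inl (.inl ⟨(s, t), rfl⟩))))
    | bot => exact .inl (.inl (.inl (.inl (.inr rfl))))
    | and φ ψ =>
      have h' := max_lt_iff.1 (Nat.lt_of_succ_lt_succ h)
      exact .inl (.inl (.inl (.inr ⟨φ, h'.1, ψ, h'.2, rfl⟩)))
    | or φ ψ =>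
      have h' := max_lt_iff.1 (Nat.lt_of_succ_lt_succ h)
      exact .inl (.inl (.inr ⟨φ, h'.1, ψ, h'.2, rfl⟩))
    | imp φ ψ =>
      have h' := max_lt_iff.1 (Nat.lt_of_succ_lt_succ h)
      exact .inl (.inr ⟨φ, h'.1, ψ, h'.2, rfl⟩)
    | all σ φ =>
      exact .inr (Set.mem_iUnion.2 ⟨σ, .inl ⟨φ, Nat.lt_of_succ_lt_succ h, rfl⟩⟩)
    | ex σ φ =>
      exact .inr (Set.mem_iUnion.2 ⟨σ, .inr ⟨φ, Nat.lt_of_succ_lt_succ h, rfl⟩⟩)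

end ProbLogic

namespace ProbLogic

open Ty Formula Filter

/-! ## Derivations -/

theorem Deriv.mono {T : Theory} {Γ : Ctx} {Δ Δ' : List (Formula Γ)} {φ : Formula Γ}
    (h : Deriv T Δ φ) (hs : Δ ⊆ Δ') : Deriv T Δ' φ := by
  induction h with
  | ax h => exact .ax h
  | hyp h => exact .hyp (hs h)
  | and_intro _ _ h₁ h₂ => exact .and_intro (h₁ hs) (h₂ hs)
  | and_left _ h => exact .and_left (h hs)
  | and_right _ h => exact .and_right (h hs)
  | or_left _ h => exact .or_left (h hs)
  | or_right _ h => exact .or_right (h hs)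
  | or_elim _ _ _ h h₁ h₂ =>
    exact .or_elim (h hs) (h₁ (List.cons_subset_cons _ hs)) (h₂ (List.cons_subset_cons _ hs))
  | imp_intro _ h => exact .imp_intro (h (List.cons_subset_cons _ hs))
  | imp_elim _ _ h₁ h₂ => exact .imp_elim (h₁ hs) (h₂ hs)
  | by_contra _ h => exact .by_contra (h (List.cons_subset_cons _ hs))
  | all_intro _ h => exact .all_intro (h (List.map_subset _ hs))
  | all_elim t _ h => exact .all_elim t (h hs)
  | ex_intro t _ h => exact .ex_intro t (h hs)
  | ex_elim _ _ h₁ h₂ =>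
    exact .ex_elim (h₁ hs) (h₂ (List.cons_subset_cons _ (List.map_subset _ hs)))
  -- The premise of the extensionality rule is derived without assumptions, so it is unaffected.
  | qf_er r hφ h _ => exact .qf_er r hφ h

theorem Deriv.weaken {T : Theory} {Γ : Ctx} {Δ : List (Formula Γ)} {φ : Formula Γ}
    (h : Deriv T [] φ) : Deriv T Δ φ := h.mono (List.nil_subset _)

theorem Formula.inst_wk_lift {Γ : Ctx} {σ : Ty} (φ : Formula (σ :: Γ)) :
    (φ.rename ((Ren.wk Γ σ).lift σ)).inst (.var .z) = φ := by
  rw [Formula.inst, Formula.rename_eq_subst, Formula.subst_subst]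
  conv_rhs => rw [← Formula.subst_id φ]
  congr 1
  refine Sub.hext fun τ v => ?_
  cases v <;> rfl

theorem Deriv.ex_neg_of_neg_all {T : Theory} {Γ : Ctx} {Δ : List (Formula Γ)} {σ : Ty}
    {φ : Formula (σ :: Γ)} (h : Deriv T Δ (all σ φ).neg) : Deriv T Δ (ex σ φ.neg) := by
  refine .by_contra (.imp_elim (h.mono (List.subset_cons_self _ _)) (.all_intro (.by_contra ?_)))
  refine .imp_elim (φ := (ex σ φ.neg).wk) (.hyp ?_) (.ex_intro (.var .z) (.hyp ?_))
  · exact List.mem_cons_of_mem _ (List.mem_cons_self ..)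
  · exact List.mem_cons.2 (.inl (congrArg Formula.neg (Formula.inst_wk_lift φ)))

/-! ## Extensions of contexts -/

/-- Extensions of a context by finitely many further variables. -/
inductive Ext : Ctx → Ctx → Type
  | refl (Γ : Ctx) : Ext Γ Γ
  | step {Γ Δ : Ctx} (σ : Ty) : Ext Γ Δ → Ext Γ (σ :: Δ)

namespace Ext

theorem length_le {Γ Δ : Ctx} (e : Ext Γ Δ) : Γ.length ≤ Δ.length := by
  induction e with
  | refl => exact le_rfl
  | step σ _ ih => exact ih.trans (Nat.le_succ _)

/-- Lengths rule out two different extensions. Each formula therefore has one canonical translation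
to a larger context, and translations compose without coherence conditions. -/
instance (Γ Δ : Ctx) : Subsingleton (Ext Γ Δ) := by
  refine ⟨fun e e' => ?_⟩
  induction e with
  | refl => cases e' with
    | refl => rfl
    | step σ e' => exact absurd e'.length_le (Nat.not_succ_le_self _)
  | step σ e ih => cases e' with
    | refl => exact absurd e.length_le (Nat.not_succ_le_self _)
    | step _ e' => rw [ih e']

def sub {Γ : Ctx} : {Δ : Ctx} → Ext Γ Δ → Sub Γ Δ
  | _, refl _ => Sub.id Γ
  | _, step _ e => fun _ v => (e.sub v).wk

def trans {Γ Δ : Ctx} (e : Ext Γ Δ) : {Θ : Ctx} → Ext Δ Θ → Ext Γ Θ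
  | _, refl _ => e
  | _, step σ e' => step σ (e.trans e')

theorem sub_trans {Γ Δ Θ : Ctx} (e : Ext Γ Δ) (e' : Ext Δ Θ) :
    (e.trans e').sub = e.sub.comp e'.sub := by
  induction e' with
  | refl => exact Sub.hext fun τ v => (Term.subst_id _).symm
  | step σ e' ih =>
    refine Sub.hext fun τ v => ?_
    simp only [trans, sub, ih, Sub.comp, Term.wk_subst]

theorem subst_trans {Γ Δ Θ : Ctx} (e : Ext Γ Δ) (e' : Ext Δ Θ) (e'' : Ext Γ Θ) (φ : Formula Γ) :
    (φ.subst e.sub).subst e'.sub = φ.subst e''.sub := by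
  rw [Formula.subst_subst, ← sub_trans, Subsingleton.elim (e.trans e') e'']

theorem term_subst_trans {Γ Δ Θ : Ctx} (e : Ext Γ Δ) (e' : Ext Δ Θ) (e'' : Ext Γ Θ) {τ : Ty}
    (t : Term Γ τ) : (t.subst e.sub).subst e'.sub = t.subst e''.sub := by
  rw [Term.subst_subst, Subsingleton.elim e'' (e.trans e'), sub_trans]; rfl

end Ext

/-! ## Completeness -/

/-- Finite consistent sets of formulas. -/
structure Stage where
  ctx : Ctx
  hyps : List (Formula ctx)
  consistent : ¬ Deriv FPUB hyps bot

instance : Preorder Stage where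
  le S S' := ∃ e : Ext S.ctx S'.ctx, ∀ ψ ∈ S.hyps, ψ.subst e.sub ∈ S'.hyps
  le_refl S := ⟨.refl _, fun ψ h => by rwa [Ext.sub, Formula.subst_id]⟩
  le_trans S S' S'' := by
    rintro ⟨e, h⟩ ⟨e', h'⟩
    refine ⟨e.trans e', fun ψ hψ => ?_⟩
    rw [← Ext.subst_trans e e']
    exact h' _ (h _ hψ)

/-- The stage contains the formula, together with an instance if it is an existential
quantification, or the negation of the formula. -/
def Stage.Decides (S : Stage) {Γ : Ctx} (φ : Formula Γ) : Prop :=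
  ∃ e : Ext Γ S.ctx, (φ.subst e.sub ∈ S.hyps ∧ ∀ (σ : Ty) (χ : Formula (σ :: Γ)), φ = ex σ χ →
    ∃ t : Term S.ctx σ, χ.subst (Sub.cons t e.sub) ∈ S.hyps) ∨ φ.neg.subst e.sub ∈ S.hyps

theorem Stage.Decides.mono {S S' : Stage} (h : S ≤ S') {Γ : Ctx} {φ : Formula Γ}
    (hd : S.Decides φ) : S'.Decides φ := by
  obtain ⟨e, he⟩ := h
  obtain ⟨d, hd⟩ := hd
  refine ⟨d.trans e, ?_⟩
  refine hd.imp (fun hd => ⟨?_, ?_⟩) fun hd => ?_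
  · rw [← Ext.subst_trans d e]; exact he _ hd.1
  · intro σ χ hχ
    obtain ⟨t, ht⟩ := hd.2 σ χ hχ
    refine ⟨t.subst e.sub, ?_⟩
    have := he _ ht
    rw [Formula.subst_subst] at this
    convert this using 2
    refine Sub.hext fun τ v => ?_
    cases v with
    | z => rfl
    | s v => rw [Ext.sub_trans]; rfl
  · rw [← Ext.subst_trans d e]; exact he _ hd

theorem Formula.subst_step_refl {Γ : Ctx} (σ : Ty) (φ : Formula Γ) :
    φ.subst (Ext.step σ (Ext.refl Γ)).sub = φ.wk := by
  rw [Formula.wk, Formula.rename_eq_subst]; rfl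

theorem Stage.exists_decides (S : Stage) (φ : Formula S.ctx) : ∃ S', S ≤ S' ∧ S'.Decides φ := by
  -- If `φ` is refutable its negation can be added consistently; otherwise `φ` itself can.
  by_cases h : Deriv FPUB (φ :: S.hyps) bot
  · refine ⟨⟨S.ctx, φ.neg :: S.hyps, fun h' => S.consistent ?_⟩, ⟨.refl _, ?_⟩, .refl _, .inr ?_⟩
    · exact .imp_elim (.imp_intro h') (.imp_intro h)
    · intro ψ hψ
      rw [Ext.sub, Formula.subst_id]
      exact List.mem_cons_of_mem _ hψ
    · rw [Ext.sub, Formula.subst_id]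
      exact List.mem_cons_self ..
  by_cases hex : ∃ (σ : Ty) (χ : Formula (σ :: S.ctx)), φ = ex σ χ
  · obtain ⟨σ, χ, rfl⟩ := hex
    -- The Henkin witness is a new variable; consistency is preserved by `ex_elim`.
    refine ⟨⟨σ :: S.ctx, χ :: (ex σ χ :: S.hyps).map Formula.wk, fun h' => h ?_⟩,
      ⟨.step σ (.refl _), ?_⟩, .step σ (.refl _), .inl ⟨?_, ?_⟩⟩
    · exact .ex_elim (.hyp (List.mem_cons_self ..)) h'
    · intro ψ hψ
      rw [Formula.subst_step_refl]
      exact List.mem_cons_of_mem _ (List.mem_map_of_mem (List.mem_cons_of_mem _ hψ))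
    · rw [Formula.subst_step_refl]
      exact List.mem_cons_of_mem _ (List.mem_map_of_mem (List.mem_cons_self ..))
    · rintro σ' χ' he
      injection he with _ h₁ h₂
      subst h₁
      rw [← eq_of_heq h₂]
      refine ⟨.var .z, ?_⟩
      have : Sub.cons (.var .z) (Ext.step σ (Ext.refl S.ctx)).sub = Sub.id (σ :: S.ctx) :=
        Sub.hext fun τ v => by cases v <;> rfl
      rw [this, Formula.subst_id]
      exact List.mem_cons_self ..
  · refine ⟨⟨S.ctx, φ :: S.hyps, h⟩, ⟨.refl _, ?_⟩, .refl _, .inl ⟨?_, ?_⟩⟩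
    · intro ψ hψ
      rw [Ext.sub, Formula.subst_id]
      exact List.mem_cons_of_mem _ hψ
    · rw [Ext.sub, Formula.subst_id]
      exact List.mem_cons_self ..
    · exact fun σ χ h => absurd ⟨σ, χ, h⟩ hex

/-- The stages that decide a formula, or have no extension whose context contains that of the
formula. -/
def decidingStages (φ : Σ Γ, Formula Γ) : Order.Cofinal Stage where
  carrier := {S | S.Decides φ.2 ∨ ∀ S', S ≤ S' → IsEmpty (Ext φ.1 S'.ctx)}
  isCofinal S := by
    -- The second alternative makes the set cofinal also for formulas whose context never embeds
    -- above `S`.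
    by_cases h : ∀ S', S ≤ S' → IsEmpty (Ext φ.1 S'.ctx)
    · exact ⟨S, .inr h, le_rfl⟩
    · push Not at h
      obtain ⟨S', hS, ⟨e⟩⟩ := h
      obtain ⟨S'', hS', d, hd⟩ := S'.exists_decides (φ.2.subst e.sub)
      refine ⟨S'', .inl ⟨e.trans d, ?_⟩, hS.trans hS'⟩
      refine hd.imp (fun hd => ⟨?_, ?_⟩) fun hd => ?_
      · rw [← Ext.subst_trans e d]; exact hd.1
      · intro σ χ hχ
        obtain ⟨t, ht⟩ := hd.2 σ (χ.subst (e.sub.lift σ)) (by rw [hχ]; rfl)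
        refine ⟨t, ?_⟩
        rw [Formula.subst_subst] at ht
        convert ht using 2
        refine Sub.hext fun τ v => ?_
        cases v with
        | z => rfl
        | s v =>
          rw [Ext.sub_trans]
          exact (Term.subst_wk (Sub.cons t d.sub) (e.sub v)).symm
      · rw [← Ext.subst_trans e d]; exact hd

/-- An ideal of stages is generic if it meets all sets of deciding stages. -/
def Generic (I : Order.Ideal Stage) : Prop := ∀ φ, ∃ S ∈ I, S ∈ decidingStages φ

/-- The Rasiowa–Sikorski argument: there are only countably many formulas over all contexts, hence
countably many cofinal sets to meet. -/
theorem exists_generic (S : Stage) : ∃ I : Order.Ideal Stage, S ∈ I ∧ Generic I := by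
  have := Encodable.ofCountable (Σ Γ, Formula Γ)
  refine ⟨Order.idealOfCofinals S decidingStages, Order.mem_idealOfCofinals _ _, fun φ => ?_⟩
  obtain ⟨S, h₁, h₂⟩ := Order.cofinal_meets_idealOfCofinals S decidingStages φ
  exact ⟨S, h₂, h₁⟩

/-! ### Truth along a generic ideal -/

section TermModel

variable (I : Order.Ideal Stage)

instance : IsDirectedOrder I := ⟨fun a b => by
  obtain ⟨c, hc, h₁, h₂⟩ := I.directed a.1 a.2 b.1 b.2
  exact ⟨⟨c, hc⟩, h₁, h₂⟩⟩

instance : Nonempty I := I.nonempty.to_subtype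

/-- Truth in a generic ideal: eventual derivability. -/
def Tr {Γ : Ctx} (φ : Formula Γ) : Prop :=
  ∀ᶠ S : I in atTop, ∀ e : Ext Γ S.1.ctx, Deriv FPUB S.1.hyps (φ.subst e.sub)

variable {I}

theorem eventually_ext (S : I) : ∀ᶠ S' : I in atTop, Nonempty (Ext S.1.ctx S'.1.ctx) := by
  filter_upwards [eventually_ge_atTop S] with S' h
  exact ⟨h.choose⟩

theorem exists_ext₂ (S S' : I) : ∃ S'' : I, S ≤ S'' ∧
    Nonempty (Ext S.1.ctx S''.1.ctx) ∧ Nonempty (Ext S'.1.ctx S''.1.ctx) := by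
  obtain ⟨T, h, h'⟩ := exists_ge_ge S S'
  exact ⟨T, h, ⟨h.choose⟩, ⟨h'.choose⟩⟩

theorem tr_of_deriv {Γ : Ctx} {φ : Formula Γ}
    (h : ∀ (Δ : Ctx) (s : Sub Γ Δ), Deriv FPUB [] (φ.subst s)) : Tr I φ :=
  .of_forall fun _ _ => (h _ _).weaken

theorem tr_of_mem (S : I) {Γ : Ctx} {φ : Formula Γ} (e : Ext Γ S.1.ctx)
    (h : φ.subst e.sub ∈ S.1.hyps) : Tr I φ := by
  filter_upwards [eventually_ge_atTop S] with S' hS e'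
  obtain ⟨d, hd⟩ := hS
  rw [← Ext.subst_trans e d e']
  exact .hyp (hd _ h)

/-- In a context that embeds in no stage of the ideal, `Tr` is vacuously true. Hence this and the
following truth conditions concern contexts of stages. -/
theorem not_tr_bot (S : I) : ¬ Tr I (bot : Formula S.1.ctx) := fun h => by
  obtain ⟨S', h, ⟨e⟩⟩ := (h.and (eventually_ext S)).exists
  exact S'.1.consistent (h e)

theorem tr_subst_ext {Γ : Ctx} (S : I) (e : Ext Γ S.1.ctx) (φ : Formula Γ) :
    Tr I (φ.subst e.sub) ↔ Tr I φ := by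
  constructor <;> intro h
  · filter_upwards [h, eventually_ext S] with S' h ⟨e'⟩ e''
    rw [← Ext.subst_trans e e' e'']
    exact h e'
  · filter_upwards [h] with S' h e'
    rw [Ext.subst_trans e e' (e.trans e')]
    exact h _

theorem Tr.and {Γ : Ctx} {φ ψ : Formula Γ} (h₁ : Tr I φ) (h₂ : Tr I ψ) : Tr I (φ ⋏ ψ) := by
  filter_upwards [h₁, h₂] with S h₁ h₂ e
  exact .and_intro (h₁ e) (h₂ e)

theorem Tr.mp {Γ : Ctx} {φ ψ : Formula Γ} (h₁ : Tr I (φ ⟹ ψ)) (h₂ : Tr I φ) : Tr I ψ := by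
  filter_upwards [h₁, h₂] with S h₁ h₂ e
  exact .imp_elim (h₁ e) (h₂ e)

theorem exists_decides_of_generic (hI : Generic I) (S : I) (φ : Formula S.1.ctx) :
    ∃ S' : I, S ≤ S' ∧ S'.1.Decides φ := by
  obtain ⟨T, hT, h⟩ := hI ⟨S.1.ctx, φ⟩
  obtain ⟨S', h₁, h₂⟩ := exists_ge_ge S ⟨T, hT⟩
  refine ⟨S', h₁, ?_⟩
  rcases h with h | h
  · exact h.mono h₂
  · exact ((h S'.1 h₂).false h₁.choose).elim

theorem tr_or_tr_neg (hI : Generic I) (S : I) (φ : Formula S.1.ctx) : Tr I φ ∨ Tr I φ.neg := by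
  obtain ⟨S', _, e, h⟩ := exists_decides_of_generic hI S φ
  exact h.imp (fun h => tr_of_mem S' e h.1) (fun h => tr_of_mem S' e h)

theorem tr_neg (hI : Generic I) (S : I) (φ : Formula S.1.ctx) : Tr I φ.neg ↔ ¬ Tr I φ :=
  ⟨fun h h' => not_tr_bot S (h.mp h'), fun h => (tr_or_tr_neg hI S φ).resolve_left h⟩

theorem tr_imp (hI : Generic I) (S : I) (φ ψ : Formula S.1.ctx) : Tr I (φ ⟹ ψ) ↔ (Tr I φ → Tr I ψ) := by
  refine ⟨Tr.mp, fun h => ?_⟩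
  rcases tr_or_tr_neg hI S φ with h' | h'
  · filter_upwards [h h'] with S h e
    exact .imp_intro ((h e).mono (List.subset_cons_self _ _))
  · filter_upwards [h'] with S h e
    refine .imp_intro (.by_contra (.imp_elim ((h e).mono ?_) (.hyp ?_)))
    · exact fun _ h => by simp [h]
    · simp

theorem tr_and (S : I) (φ ψ : Formula S.1.ctx) : Tr I (φ ⋏ ψ) ↔ Tr I φ ∧ Tr I ψ :=
  ⟨fun h => ⟨h.mono fun _ h e => .and_left (h e), h.mono fun _ h e => .and_right (h e)⟩,
    fun h => h.1.and h.2⟩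

theorem tr_or (hI : Generic I) (S : I) (φ ψ : Formula S.1.ctx) : Tr I (φ ⋎ ψ) ↔ Tr I φ ∨ Tr I ψ := by
  constructor
  · intro h
    by_contra! hn
    have h₁ := (tr_neg hI S φ).2 hn.1
    have h₂ := (tr_neg hI S ψ).2 hn.2
    refine not_tr_bot S ?_
    filter_upwards [h, h₁, h₂] with S h h₁ h₂ e
    exact .or_elim (h e) (.imp_elim ((h₁ e).mono (List.subset_cons_self _ _)) (.hyp (by simp)))
      (.imp_elim ((h₂ e).mono (List.subset_cons_self _ _)) (.hyp (by simp)))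
  · rintro (h | h)
    · exact h.mono fun _ h e => .or_left (h e)
    · exact h.mono fun _ h e => .or_right (h e)

/-- The witness comes from a stage that decides the existential formula, and may use variables added
there. -/
theorem exists_of_tr_ex (hI : Generic I) (S : I) {σ : Ty} (φ : Formula (σ :: S.1.ctx)) (h : Tr I (ex σ φ)) :
    ∃ (S' : I) (e : Ext S.1.ctx S'.1.ctx) (t : Term S'.1.ctx σ),
      Tr I (φ.subst (Sub.cons t e.sub)) := by
  obtain ⟨S', _, e, hd⟩ := exists_decides_of_generic hI S (ex σ φ)
  rcases hd with hd | hd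
  · obtain ⟨t, ht⟩ := hd.2 σ φ rfl
    refine ⟨S', e, t, tr_of_mem S' (.refl _) ?_⟩
    rwa [Ext.sub, Formula.subst_id]
  · exact absurd h ((tr_neg hI S _).1 (tr_of_mem S' e hd))

theorem Formula.cons_subst {Γ Δ Θ : Ctx} {σ : Ty} (φ : Formula (σ :: Γ)) (s : Sub Γ Δ)
    (t : Term Δ σ) (s' : Sub Δ Θ) :
    (φ.subst (Sub.cons t s)).subst s' = φ.subst (Sub.cons (t.subst s') (s.comp s')) := by
  rw [Formula.subst_subst]
  congr 1
  exact Sub.hext fun τ v => by cases v <;> rfl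

theorem tr_ex_intro (S : I) {σ : Ty} (φ : Formula (σ :: S.1.ctx)) (S' : I)
    (e : Ext S.1.ctx S'.1.ctx) (t : Term S'.1.ctx σ) (h : Tr I (φ.subst (Sub.cons t e.sub))) :
    Tr I (ex σ φ) := by
  filter_upwards [h, eventually_ext S'] with T h ⟨d⟩ e'
  refine .ex_intro (t.subst d.sub) ?_
  have := h d
  rwa [Formula.cons_subst, ← Ext.sub_trans, Subsingleton.elim (e.trans d) e',
    ← Formula.inst_lift] at this

theorem Tr.all_elim (S : I) {σ : Ty} (φ : Formula (σ :: S.1.ctx)) (h : Tr I (all σ φ)) (S' : I)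
    (e : Ext S.1.ctx S'.1.ctx) (t : Term S'.1.ctx σ) : Tr I (φ.subst (Sub.cons t e.sub)) := by
  filter_upwards [h, eventually_ext S] with T h ⟨d⟩ e'
  have := Deriv.all_elim (t.subst e'.sub) (h d)
  rwa [Formula.inst_lift, Subsingleton.elim d (e.trans e'), Ext.sub_trans,
    ← Formula.cons_subst] at this

theorem exists_of_not_tr_all (hI : Generic I) (S : I) {σ : Ty} (φ : Formula (σ :: S.1.ctx))
    (h : ¬ Tr I (all σ φ)) :
    ∃ (S' : I) (e : Ext S.1.ctx S'.1.ctx) (t : Term S'.1.ctx σ),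
      ¬ Tr I (φ.subst (Sub.cons t e.sub)) := by
  have h : Tr I (ex σ φ.neg) :=
    ((tr_neg hI S _).2 h).mono fun _ h e => Deriv.ex_neg_of_neg_all (h e)
  obtain ⟨S', e, t, ht⟩ := exists_of_tr_ex hI S _ h
  exact ⟨S', e, t, (tr_neg hI S' _).1 ht⟩

end TermModel
end ProbLogic

/-! ### The term model and the completeness theorem -/

namespace ProbLogic

open Ty Formula Filter

section Quotient

variable {I : Order.Ideal Stage}

theorem tr_eq0_refl {Γ : Ctx} (t : Term Γ nat) : Tr I (eq0 t t) :=
  tr_of_deriv fun _ _ => .ax (.inl (.eq_refl _))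

theorem Tr.symm {Γ : Ctx} {s t : Term Γ nat} (h : Tr I (eq0 s t)) : Tr I (eq0 t s) :=
  Tr.mp (φ := eq0 s t) (tr_of_deriv fun _ _ => .ax (.inl (.eq_symm _ _))) h

theorem Tr.trans {Γ : Ctx} {r s t : Term Γ nat} (h : Tr I (eq0 r s)) (h' : Tr I (eq0 s t)) :
    Tr I (eq0 r t) :=
  Tr.mp (φ := eq0 s t) (Tr.mp (φ := eq0 r s)
    (tr_of_deriv fun _ _ => .ax (.inl (.eq_trans _ _ _))) h) h'

theorem Term.inst_subst {Γ Δ : Ctx} {σ τ : Ty} (r : Term (σ :: Γ) τ) (a : Term Γ σ)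
    (s : Sub Γ Δ) : (r.inst a).subst s = (r.subst (s.lift σ)).inst (a.subst s) := by
  rw [Term.inst, Term.inst, Term.subst_subst, Term.subst_subst]
  refine Term.subst_congr (fun τ v => ?_) r
  cases v with
  | z => rfl
  | s v => exact ((Term.subst_wk _ _).trans (Term.subst_id _)).symm

variable (I) in
/-- Leibniz equality of terms, tested at type `0`. -/
def Leib {τ : Ty} (x y : Σ S : I, Term S.1.ctx τ) : Prop :=
  ∀ (S : I) (e : Ext x.1.1.ctx S.1.ctx) (d : Ext y.1.1.ctx S.1.ctx) (r : Term (τ :: S.1.ctx) nat),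
    Tr I (eq0 (r.inst (x.2.subst e.sub)) (r.inst (y.2.subst d.sub)))

variable (I) in
def leibSetoid (τ : Ty) : Setoid (Σ S : I, Term S.1.ctx τ) where
  r := Leib I
  iseqv := by
    refine ⟨fun x S e d r => ?_, fun h S e d r => (h S d e r).symm, ?_⟩
    · rw [Subsingleton.elim e d]
      exact tr_eq0_refl _
    · intro x y z h h' S e d r
      -- The middle term need not live in the context of `S`, so the test `r` is moved to a later
      -- stage that contains it.
      obtain ⟨S', _, ⟨a⟩, ⟨b⟩⟩ := exists_ext₂ S y.1
      rw [← tr_subst_ext S' a]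
      have h₁ := h S' (e.trans a) b (r.subst (a.sub.lift τ))
      have h₂ := h' S' b (d.trans a) (r.subst (a.sub.lift τ))
      have := h₁.trans h₂
      rwa [← Ext.term_subst_trans e a, ← Ext.term_subst_trans d a, ← Term.inst_subst,
        ← Term.inst_subst] at this

variable (I) in
abbrev Carrier (τ : Ty) : Type := Quotient (leibSetoid I τ)

/-- The element of the term model given by a term. -/
def mk (S : I) {τ : Ty} (t : Term S.1.ctx τ) : Carrier I τ := Quotient.mk _ ⟨S, t⟩

theorem mk_subst (S S' : I) (e : Ext S.1.ctx S'.1.ctx) {τ : Ty} (t : Term S.1.ctx τ) :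
    mk S' (t.subst e.sub) = mk S t := by
  refine Quotient.sound fun T d d' r => ?_
  dsimp only
  rw [Ext.term_subst_trans e d d']
  exact tr_eq0_refl _

theorem mk_eq_iff (S : I) {τ : Ty} (a b : Term S.1.ctx τ) : mk S a = mk S b ↔
    ∀ (S' : I) (e : Ext S.1.ctx S'.1.ctx) (r : Term (τ :: S'.1.ctx) nat),
      Tr I (eq0 (r.inst (a.subst e.sub)) (r.inst (b.subst e.sub))) := by
  refine ⟨fun h S' e r => Quotient.exact h S' e e r, fun h => Quotient.sound fun S' e d r => ?_⟩
  rw [Subsingleton.elim d e]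
  exact h S' e r

theorem exists_mk (S : I) {τ : Ty} (x : Carrier I τ) : ∃ (S' : I) (_ : Ext S.1.ctx S'.1.ctx)
    (t : Term S'.1.ctx τ), x = mk S' t := by
  induction x using Quotient.inductionOn with
  | h x =>
    obtain ⟨S', _, ⟨e⟩, ⟨d⟩⟩ := exists_ext₂ S x.1
    exact ⟨S', e, x.2.subst d.sub, (mk_subst x.1 S' d x.2).symm⟩

/-- The function and the argument are replaced one at a time, testing with `r` composed with the
contexts `v0 ⬝ a` and `g ⬝ v0`. -/
theorem mk_app_congr (S : I) {ρ τ : Ty} {f g : Term S.1.ctx (ρ ⇾ τ)} {a b : Term S.1.ctx ρ}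
    (hf : mk S f = mk S g) (ha : mk S a = mk S b) : mk S (f ⬝ a) = mk S (g ⬝ b) := by
  rw [mk_eq_iff] at *
  intro S' e r
  have key : ∀ {σ : Ty} (t : Term (σ :: S'.1.ctx) τ) (u : Term S'.1.ctx σ),
      (r.subst (Sub.cons t (fun _ v => .var (.s v)))).inst u = r.inst (t.inst u) := by
    intro σ t u
    rw [Term.inst, Term.subst_subst]
    refine Term.subst_congr (fun τ v => ?_) r
    cases v <;> rfl
  have h₁ := hf S' e (r.subst (Sub.cons (v0 ⬝ (a.subst e.sub).wk) (fun _ v => .var (.s v))))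
  have h₂ := ha S' e (r.subst (Sub.cons ((g.subst e.sub).wk ⬝ v0) (fun _ v => .var (.s v))))
  have hw : ∀ {σ τ : Ty} (t : Term S'.1.ctx τ) (u : Term S'.1.ctx σ), t.wk.inst u = t :=
    fun t u => (Term.subst_wk _ _).trans (Term.subst_id _)
  rw [key, key] at h₁ h₂
  have e₁ : ∀ u : Term S'.1.ctx (ρ ⇾ τ), (v0 ⬝ (a.subst e.sub).wk : Term (_ :: _) τ).inst u =
      u ⬝ a.subst e.sub := fun u => congrArg (Term.app u) (hw _ _)
  have e₂ : ∀ u : Term S'.1.ctx ρ, ((g.subst e.sub).wk ⬝ v0 : Term (_ :: _) τ).inst u =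
      g.subst e.sub ⬝ u := fun u => congrArg (fun f => Term.app f u) (hw _ _)
  rw [e₁, e₁] at h₁
  rw [e₂, e₂] at h₂
  exact h₁.trans h₂

/-- At type `0` Leibniz equality is true equality. Although the rule of extensionality needs a
premise free of assumptions, it applies here: its quantifier-free antecedent is taken to be `a = b`
itself, so the premise is a tautology. -/
theorem mk_nat_eq_iff (S : I) (a b : Term S.1.ctx nat) : mk S a = mk S b ↔ Tr I (eq0 a b) := by
  rw [mk_eq_iff]
  constructor
  · intro h
    have := h S (.refl _) v0
    rwa [Ext.sub, Term.subst_id, Term.subst_id] at this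
  · intro h S' e r
    refine Tr.mp (φ := eq0 (a.subst e.sub) (b.subst e.sub)) (tr_of_deriv fun Δ s => ?_)
      ((tr_subst_ext S' e _).2 h)
    simp only [Formula.subst, Term.inst_subst]
    exact .qf_er (τ := nat) (ρ := nat) _ trivial (.imp_intro (.hyp (by simp [eqTy])))

/-- Equality of higher type that is merely assumed need not be preserved by contexts; provable
equality is, by the rule of extensionality with a trivial antecedent. -/
theorem mk_eq_of_deriv (S : I) {τ : Ty} {a b : Term S.1.ctx τ}
    (h : ∀ (Δ : Ctx) (s : Sub S.1.ctx Δ), Deriv FPUB [] (eqTy τ (a.subst s) (b.subst s))) :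
    mk S a = mk S b := by
  rw [mk_eq_iff]
  intro S' e r
  refine tr_of_deriv fun Δ s => ?_
  simp only [Formula.subst, Term.inst_subst, Term.subst_subst]
  refine .imp_elim (φ := bot ⟹ bot) (.qf_er (τ := nat) _ ⟨trivial, trivial⟩
    (.imp_intro (h Δ _).weaken)) (.imp_intro (.hyp (by simp)))

variable (I) in
/-- The term model of a generic ideal. -/
noncomputable def termModel : Struct where
  D := Carrier I
  app F X :=
    let h := exists_ext₂ F.out.1 X.out.1
    mk h.choose (F.out.2.subst h.choose_spec.2.1.some.sub ⬝
      X.out.2.subst h.choose_spec.2.2.some.sub)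
  cst c := mk (Classical.arbitrary I) (.cst c)

/-- Application is defined through chosen representatives; passing to a common later stage shows
that the choice does not matter. -/
theorem termModel_app (S : I) {ρ τ : Ty} (f : Term S.1.ctx (ρ ⇾ τ)) (a : Term S.1.ctx ρ) :
    (termModel I).app (mk S f) (mk S a) = mk S (f ⬝ a) := by
  dsimp only [termModel]
  generalize_proofs h h₁ h₂
  have hf : mk (mk S f).out.1 (mk S f).out.2 = mk S f := Quotient.out_eq _
  have ha : mk (mk S a).out.1 (mk S a).out.2 = mk S a := Quotient.out_eq _
  generalize (mk S f).out = F at *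
  generalize (mk S a).out = X at *
  generalize h.choose = T at *
  generalize h₁.some = d at *
  generalize h₂.some = d' at *
  obtain ⟨S', _, ⟨e⟩, ⟨e'⟩⟩ := exists_ext₂ S T
  rw [← mk_subst S S' e (f ⬝ a), ← mk_subst T S' e']
  simp only [Term.subst]
  apply mk_app_congr
  · rw [mk_subst, mk_subst, mk_subst, hf]
  · rw [mk_subst, mk_subst, mk_subst, ha]

theorem termModel_cst (S : I) {τ : Ty} (c : Const τ) :
    (termModel I).cst c = mk S (.cst c) := by
  obtain ⟨S', _, ⟨e⟩, ⟨e'⟩⟩ := exists_ext₂ S (Classical.arbitrary I)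
  rw [← mk_subst S S' e]
  exact (mk_subst _ S' e' (.cst c)).symm

open Struct

theorem termModel_eval (S : I) {Γ : Ctx} (s : Sub Γ S.1.ctx) {τ : Ty} (t : Term Γ τ) :
    eval (M := termModel I) (fun _ v => mk S (s v)) t = mk S (t.subst s) := by
  induction t with
  | var v => rfl
  | cst c => exact termModel_cst S c
  | app f a hf ha => exact (congrArg₂ _ hf ha).trans (termModel_app S _ _)

theorem exists_env (Γ : Ctx) (E : (termModel I).Env Γ) :
    ∃ (S : I) (s : Sub Γ S.1.ctx), E = fun _ v => mk S (s v) := by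
  induction Γ with
  | nil => exact ⟨Classical.arbitrary I, (fun _ v => nomatch v), by
      funext τ v; exact nomatch v⟩
  | cons σ Γ ih =>
    obtain ⟨S, s, hs⟩ := ih (fun _ v => E (.s v))
    obtain ⟨S', e, t, ht⟩ := exists_mk S (E .z)
    refine ⟨S', Sub.cons t (s.comp e.sub), ?_⟩
    funext τ v
    cases v with
    | z => exact ht
    | s v =>
      refine (congrFun (congrFun hs τ) v).trans ?_
      exact (mk_subst S S' e (s v)).symm

theorem env_cons_mk (S S' : I) (e : Ext S.1.ctx S'.1.ctx) {Γ : Ctx} {σ : Ty} (s : Sub Γ S.1.ctx)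
    (t : Term S'.1.ctx σ) : (Env.cons (M := termModel I) (mk S' t) (fun _ v => mk S (s v))) =
      fun _ v => mk S' (Sub.cons t (s.comp e.sub) v) := by
  funext τ v
  cases v with
  | z => rfl
  | s v => exact (mk_subst S S' e (s v)).symm

theorem subst_lift_cons {Γ Δ Θ : Ctx} {σ : Ty} (φ : Formula (σ :: Γ)) (s : Sub Γ Δ)
    (t : Term Θ σ) (s' : Sub Δ Θ) :
    (φ.subst (s.lift σ)).subst (Sub.cons t s') = φ.subst (Sub.cons t (s.comp s')) := by
  rw [Formula.subst_subst]
  congr 1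
  refine Sub.hext fun τ v => ?_
  cases v with
  | z => rfl
  | s v => exact Term.subst_wk (Sub.cons t s') (s v)

/-- The truth lemma. In the quantifier cases an element of the model is represented by a term of a
later stage. -/
theorem termModel_sat (hI : Generic I) {Γ : Ctx} (φ : Formula Γ) (S : I) (s : Sub Γ S.1.ctx) :
    Sat (M := termModel I) (fun _ v => mk S (s v)) φ ↔ Tr I (φ.subst s) := by
  induction φ generalizing S with
  | eq0 a b => simp only [Sat, termModel_eval, Formula.subst]; exact mk_nat_eq_iff S _ _
  | bot => exact ⟨False.elim, not_tr_bot S⟩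
  | and φ ψ h₁ h₂ => simp only [Sat, h₁, h₂, Formula.subst, tr_and]
  | or φ ψ h₁ h₂ => simp only [Sat, h₁, h₂, Formula.subst, tr_or hI]
  | imp φ ψ h₁ h₂ => simp only [Sat, h₁, h₂, Formula.subst, tr_imp hI]
  | all σ φ h =>
    simp only [Sat, Formula.subst]
    constructor
    · intro hs
      by_contra hn
      obtain ⟨S', e, t, ht⟩ := exists_of_not_tr_all hI S _ hn
      have := hs (mk S' t)
      rw [env_cons_mk S S' e, h] at this
      exact ht (by rwa [subst_lift_cons])
    · intro ht x
      obtain ⟨S', e, t, rfl⟩ := exists_mk S x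
      have := ht.all_elim S _ S' e t
      rwa [subst_lift_cons, ← h, ← env_cons_mk S S' e] at this
  | ex σ φ h =>
    simp only [Sat, Formula.subst]
    constructor
    · rintro ⟨x, hx⟩
      obtain ⟨S', e, t, rfl⟩ := exists_mk S x
      rw [env_cons_mk S S' e, h, ← subst_lift_cons] at hx
      exact tr_ex_intro S _ S' e t hx
    · intro ht
      obtain ⟨S', e, t, ht⟩ := exists_of_tr_ex hI S _ ht
      refine ⟨mk S' t, ?_⟩
      rwa [env_cons_mk S S' e, h, ← subst_lift_cons]

end Quotient

open Struct

/-- A structure is a model if it satisfies the formulas that are derivable together with all of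
their substitution instances, and identifies terms that are provably equal in all instances. -/
class Struct.IsModel (M : Struct) : Prop where
  sat : ∀ {Γ : Ctx} (φ : Formula Γ), (∀ (Δ : Ctx) (s : Sub Γ Δ), Deriv FPUB [] (φ.subst s)) →
    ∀ e : M.Env Γ, Sat e φ
  eq : ∀ {Γ : Ctx} {τ : Ty} (a b : Term Γ τ),
    (∀ (Δ : Ctx) (s : Sub Γ Δ), Deriv FPUB [] (eqTy τ (a.subst s) (b.subst s))) →
    ∀ e : M.Env Γ, eval e a = eval e b

/-- Values in the term model are classes of open terms, so truth at an environment is truth of a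
substitution instance. Asking for all instances in `IsModel` avoids proving that derivability is
closed under substitution. -/
theorem termModel_isModel {I : Order.Ideal Stage} (hI : Generic I) : (termModel I).IsModel := by
  constructor
  · intro Γ φ h E
    obtain ⟨S, s, rfl⟩ := exists_env Γ E
    rw [termModel_sat hI]
    refine tr_of_deriv fun Δ s' => ?_
    rw [Formula.subst_subst]
    exact h _ _
  · intro Γ τ a b h E
    obtain ⟨S, s, rfl⟩ := exists_env Γ E
    rw [termModel_eval, termModel_eval]
    refine mk_eq_of_deriv S fun Δ s' => ?_
    rw [Term.subst_subst, Term.subst_subst]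
    exact h _ _

theorem completeness {Γ : Ctx} (Δ : List (Formula Γ)) (φ : Formula Γ)
    (h : ∀ M : Struct, M.IsModel → ∀ e : M.Env Γ, (∀ ψ ∈ Δ, Sat e ψ) → Sat e φ) :
    Deriv FPUB Δ φ := by
  by_contra hn
  let S₀ : Stage := ⟨Γ, φ.neg :: Δ, fun h => hn (.by_contra h)⟩
  obtain ⟨I, hS, hI⟩ := exists_generic S₀
  let S : I := ⟨S₀, hS⟩
  have hsat : ∀ ψ ∈ φ.neg :: Δ, Sat (M := termModel I) (fun _ v => mk S (Sub.id Γ v)) ψ := by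
    intro ψ hψ
    rw [termModel_sat hI, Formula.subst_id]
    refine tr_of_mem S (.refl _) ?_
    rwa [Ext.sub, Formula.subst_id]
  exact hsat φ.neg (List.mem_cons_self ..) (h _ (termModel_isModel hI) _ fun ψ hψ =>
    hsat ψ (List.mem_cons_of_mem _ hψ))

end ProbLogic

namespace ProbLogic


/-! ## The ordered field of fractions of an ordered semiring -/

section OrderedField

set_option linter.unusedSectionVars false

variable (N : Type) [CommSemiring N] [LinearOrder N] [IsStrictOrderedRing N] [ExistsAddOfLE N]

/-- Formal differences of elements of an ordered semiring. -/
def diffSetoid : Setoid (N × N) where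
  r x y := x.1 + y.2 = y.1 + x.2
  iseqv := by
    refine ⟨fun x => rfl, fun h => h.symm, fun {x y z} h h' => ?_⟩
    have : x.1 + z.2 + (y.1 + y.2) = z.1 + x.2 + (y.1 + y.2) := by
      calc x.1 + z.2 + (y.1 + y.2) = (x.1 + y.2) + (y.1 + z.2) := by ring
        _ = (y.1 + x.2) + (z.1 + y.2) := by rw [h, h']
        _ = _ := by ring
    exact add_right_cancel this

/-- First step from the natural numbers of a model to an ordered field: subtraction is adjoined
here, division below. -/
def DiffRing : Type := Quotient (diffSetoid N)

variable {N}

namespace DiffRing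

def mk (a b : N) : DiffRing N := Quotient.mk (diffSetoid N) (a, b)

theorem mk_eq_mk {a b c d : N} : mk a b = mk c d ↔ a + d = c + b :=
  Quotient.eq (r := diffSetoid N)

theorem ind {p : DiffRing N → Prop} (h : ∀ a b, p (mk a b)) (x : DiffRing N) : p x :=
  Quotient.ind (fun x => h x.1 x.2) x

instance : Zero (DiffRing N) := ⟨mk 0 0⟩
instance : One (DiffRing N) := ⟨mk 1 0⟩
instance : Neg (DiffRing N) := ⟨Quotient.map' (fun x => (x.2, x.1)) fun x y h => by
  change x.2 + y.1 = y.2 + x.1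
  have h : x.1 + y.2 = y.1 + x.2 := h
  rw [add_comm, ← h, add_comm]⟩
instance : Add (DiffRing N) := ⟨Quotient.map₂ (fun x y => (x.1 + y.1, x.2 + y.2))
  fun x x' h y y' h' => by
    change x.1 + y.1 + (x'.2 + y'.2) = x'.1 + y'.1 + (x.2 + y.2)
    have h : x.1 + x'.2 = x'.1 + x.2 := h
    have h' : y.1 + y'.2 = y'.1 + y.2 := h'
    rw [add_add_add_comm, h, h', add_add_add_comm]⟩
instance : Mul (DiffRing N) :=
  ⟨Quotient.map₂ (fun x y => (x.1 * y.1 + x.2 * y.2, x.1 * y.2 + x.2 * y.1))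
  fun x x' h y y' h' => by
    change x.1 * y.1 + x.2 * y.2 + (x'.1 * y'.2 + x'.2 * y'.1) =
      x'.1 * y'.1 + x'.2 * y'.2 + (x.1 * y.2 + x.2 * y.1)
    have h : x.1 + x'.2 = x'.1 + x.2 := h
    have h' : y.1 + y'.2 = y'.1 + y.2 := h'
    -- With this common summand both sides regroup into sums to which `h` and `h'` apply.
    refine add_right_cancel (b := x'.1 * y.2 + x'.2 * y.1 + x'.1 * y.1 + x'.2 * y.2) ?_
    calc _ = (x.1 + x'.2) * y.1 + (x'.1 + x.2) * y.2 + x'.1 * (y.1 + y'.2) + x'.2 * (y'.1 + y.2) := by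
          ring
      _ = (x'.1 + x.2) * y.1 + (x.1 + x'.2) * y.2 + x'.1 * (y'.1 + y.2) + x'.2 * (y.1 + y'.2) := by
          rw [h, h']
      _ = _ := by ring⟩

theorem add_mk (a b c d : N) : mk a b + mk c d = mk (a + c) (b + d) := rfl
theorem mul_mk (a b c d : N) : mk a b * mk c d = mk (a * c + b * d) (a * d + b * c) := rfl
theorem neg_mk (a b : N) : -mk a b = mk b a := rfl
theorem zero_def : (0 : DiffRing N) = mk 0 0 := rfl
theorem one_def : (1 : DiffRing N) = mk 1 0 := rfl

instance : CommRing (DiffRing N) where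
  add_assoc := ind fun a b => ind fun c d => ind fun e f => by simp only [add_mk, add_assoc]
  zero_add := ind fun a b => by simp only [zero_def, add_mk, zero_add]
  add_zero := ind fun a b => by simp only [zero_def, add_mk, add_zero]
  nsmul := nsmulRec
  zsmul := zsmulRec
  neg_add_cancel := ind fun a b => by
    rw [neg_mk, add_mk, zero_def, mk_eq_mk]; ring
  add_comm := ind fun a b => ind fun c d => by rw [add_mk, add_mk, mk_eq_mk]; ring
  left_distrib := ind fun a b => ind fun c d => ind fun e f => by
    simp only [add_mk, mul_mk, mk_eq_mk]; ring
  right_distrib := ind fun a b => ind fun c d => ind fun e f => by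
    simp only [add_mk, mul_mk, mk_eq_mk]; ring
  zero_mul := ind fun a b => by simp only [zero_def, mul_mk, mk_eq_mk]; ring
  mul_zero := ind fun a b => by simp only [zero_def, mul_mk, mk_eq_mk]; ring
  mul_assoc := ind fun a b => ind fun c d => ind fun e f => by
    simp only [mul_mk, mk_eq_mk]; ring
  one_mul := ind fun a b => by simp only [one_def, mul_mk, mk_eq_mk]; ring
  mul_one := ind fun a b => by simp only [one_def, mul_mk, mk_eq_mk]; ring
  mul_comm := ind fun a b => ind fun c d => by simp only [mul_mk, mk_eq_mk]; ring

/-- The nonnegative differences. -/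
def cone : RingCone (DiffRing N) where
  carrier := {x | ∃ a b : N, b ≤ a ∧ x = mk a b}
  zero_mem' := ⟨0, 0, le_rfl, rfl⟩
  one_mem' := ⟨1, 0, zero_le_one, rfl⟩
  add_mem' := by
    rintro _ _ ⟨a, b, h, rfl⟩ ⟨c, d, h', rfl⟩
    exact ⟨_, _, add_le_add h h', rfl⟩
  mul_mem' := by
    rintro _ _ ⟨a, b, h, rfl⟩ ⟨c, d, h', rfl⟩
    exact ⟨_, _, by simpa only [add_comm] using mul_add_mul_le_mul_add_mul h h', rfl⟩
  eq_zero_of_mem_of_neg_mem' := by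
    rintro _ ⟨a, b, h, rfl⟩ ⟨c, d, h', he⟩
    rw [neg_mk, mk_eq_mk] at he
    rw [zero_def, mk_eq_mk]
    have : a ≤ b := by
      by_contra hn
      exact (add_lt_add_of_le_of_lt h' (not_le.1 hn)).ne (by rw [add_comm, he])
    rw [le_antisymm this h, add_comm]

theorem mem_cone_or (x : DiffRing N) : x ∈ cone (N := N) ∨ -x ∈ cone (N := N) := by
  induction x using ind with
  | h a b => exact (le_total b a).imp (fun h => ⟨a, b, h, rfl⟩) (fun h => ⟨b, a, h, rfl⟩)

noncomputable instance : LinearOrder (DiffRing N) :=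
  haveI : HasMemOrNegMem (cone (N := N)) := ⟨mem_cone_or⟩
  letI := Classical.decPred (· ∈ cone (N := N))
  LinearOrder.mkOfAddGroupCone (cone (N := N))

instance : IsOrderedRing (DiffRing N) := IsOrderedRing.mkOfCone (cone (N := N))

theorem mk_nonneg_iff {a b : N} : 0 ≤ mk a b ↔ b ≤ a := by
  refine ⟨fun h => ?_, fun h => ?_⟩
  · have h : mk a b - 0 ∈ cone (N := N) := h
    rw [sub_zero] at h
    obtain ⟨c, d, h', he⟩ := h
    rw [mk_eq_mk] at he
    by_contra hn
    exact (add_lt_add_of_lt_of_le (not_le.1 hn) h').ne (he.trans (add_comm _ _))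
  · change mk a b - 0 ∈ cone (N := N)
    rw [sub_zero]
    exact ⟨a, b, h, rfl⟩

instance : Nontrivial (DiffRing N) := ⟨0, 1, fun h => by
  rw [zero_def, one_def, mk_eq_mk] at h
  simp at h⟩

theorem mk_pos_iff {a b : N} : 0 < mk a b ↔ b < a := by
  rw [← not_le, ← not_le, ← neg_nonneg, neg_mk, mk_nonneg_iff]

instance : IsStrictOrderedRing (DiffRing N) :=
  .of_mul_pos fun x y => by
    induction x using ind with
    | h a b =>
      induction y using ind with
      | h c d =>
        rw [mul_mk, mk_pos_iff, mk_pos_iff, mk_pos_iff]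
        exact fun h h' => by
          simpa only [add_comm] using mul_add_mul_lt_mul_add_mul h h'

variable (N) in
/-- The embedding of a semiring into its ring of differences. -/
def of : N →+* DiffRing N where
  toFun a := mk a 0
  map_zero' := rfl
  map_one' := rfl
  map_add' a b := by rw [add_mk, add_zero]
  map_mul' a b := by rw [mul_mk]; simp

theorem of_strictMono : StrictMono (of N) := fun a b h => by
  rw [← sub_pos, sub_eq_add_neg]
  change 0 < mk b 0 + -mk a 0
  rw [neg_mk, add_mk, mk_pos_iff]
  simpa using h

end DiffRing

/-! ### The order on the field of fractions of an ordered ring -/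

section Fractions

variable (R : Type) [CommRing R] [LinearOrder R] [IsStrictOrderedRing R]

/-- The nonnegative fractions. -/
noncomputable def fracCone : RingCone (FractionRing R) where
  carrier := {x | ∃ a b : R, 0 ≤ a ∧ 0 < b ∧ x * algebraMap R _ b = algebraMap R _ a}
  zero_mem' := ⟨0, 1, le_rfl, one_pos, by simp⟩
  one_mem' := ⟨1, 1, zero_le_one, one_pos, by simp⟩
  add_mem' := by
    rintro x y ⟨a, b, ha, hb, h⟩ ⟨c, d, hc, hd, h'⟩
    refine ⟨a * d + c * b, b * d, by positivity, by positivity, ?_⟩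
    simp only [map_mul, map_add]
    linear_combination algebraMap R (FractionRing R) d * h + algebraMap R (FractionRing R) b * h'
  mul_mem' := by
    rintro x y ⟨a, b, ha, hb, h⟩ ⟨c, d, hc, hd, h'⟩
    refine ⟨a * c, b * d, by positivity, by positivity, ?_⟩
    simp only [map_mul]
    rw [← h, ← h']; ring
  eq_zero_of_mem_of_neg_mem' := by
    rintro x ⟨a, b, ha, hb, h⟩ ⟨c, d, hc, hd, h'⟩
    -- Clearing denominators in `x + (-x) = 0` gives a vanishing sum of two nonnegative products.
    have : a * d + c * b = 0 := by
      apply IsFractionRing.injective R (FractionRing R)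
      simp only [map_mul, map_add, map_zero]
      rw [← h, ← h']; ring
    have h₀ : a * d = 0 := le_antisymm (by nlinarith [mul_nonneg hc hb.le]) (by positivity)
    rw [(mul_eq_zero.1 h₀).resolve_right hd.ne', map_zero, mul_eq_zero] at h
    refine h.resolve_right fun hb' => hb.ne' ?_
    exact IsFractionRing.injective R (FractionRing R) (hb'.trans (map_zero _).symm)

theorem mem_fracCone_or (x : FractionRing R) : x ∈ fracCone R ∨ -x ∈ fracCone R := by
  obtain ⟨a, b, hb, rfl⟩ := IsFractionRing.div_surjective (A := R) x
  have hb₀ : b ≠ 0 := nonZeroDivisors.ne_zero hb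
  have hb' : algebraMap R (FractionRing R) b ≠ 0 :=
    IsFractionRing.to_map_ne_zero_of_mem_nonZeroDivisors hb
  rcases lt_or_gt_of_ne hb₀ with hb₁ | hb₁ <;> rcases le_total 0 a with ha | ha
  · exact .inr ⟨a, -b, ha, by linarith, by rw [map_neg]; field_simp⟩
  · exact .inl ⟨-a, -b, by linarith, by linarith, by rw [map_neg, map_neg]; field_simp⟩
  · exact .inl ⟨a, b, ha, hb₁, by field_simp⟩
  · exact .inr ⟨-a, b, by linarith, hb₁, by rw [map_neg]; field_simp⟩

noncomputable instance fracLinearOrder : LinearOrder (FractionRing R) :=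
  haveI : HasMemOrNegMem (fracCone R) := ⟨mem_fracCone_or R⟩
  letI := Classical.decPred (· ∈ fracCone R)
  LinearOrder.mkOfAddGroupCone (fracCone R)

instance fracIsOrderedRing : IsOrderedRing (FractionRing R) := IsOrderedRing.mkOfCone (fracCone R)

instance fracIsStrictOrderedRing : IsStrictOrderedRing (FractionRing R) :=
  .of_mul_pos fun _ _ hx hy => lt_of_le_of_ne (mul_nonneg hx.le hy.le) (mul_pos_ne_zero hx hy)
where
  mul_pos_ne_zero {x y : FractionRing R} (hx : 0 < x) (hy : 0 < y) : 0 ≠ x * y :=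
    (mul_ne_zero hx.ne' hy.ne').symm

theorem algebraMap_fractionRing_strictMono : StrictMono (algebraMap R (FractionRing R)) := by
  intro a b h
  refine lt_of_le_of_ne ?_ fun h' => h.ne (IsFractionRing.injective R (FractionRing R) h')
  change _ - _ ∈ fracCone R
  exact ⟨b - a, 1, sub_nonneg.2 h.le, one_pos, by simp⟩

end Fractions

end OrderedField
end ProbLogic

namespace ProbLogic

open Ty Formula

namespace Struct

set_option linter.unusedSectionVars false

infixr:67 " ∷ " => Env.cons

variable {M : Struct}

/-! ## Evaluation -/

section Eval

variable {Γ : Ctx}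

@[simp] theorem eval_var_z {σ : Ty} (a : M.D σ) (e : M.Env Γ) : eval (a ∷ e) (.var .z) = a := rfl
@[simp] theorem eval_var_s {σ τ : Ty} (a : M.D σ) (e : M.Env Γ) (v : Var Γ τ) :
    eval (a ∷ e) (.var (.s v)) = eval e (.var v) := rfl
@[simp] theorem eval_app {ρ τ : Ty} (e : M.Env Γ) (f : Term Γ (ρ ⇾ τ)) (a : Term Γ ρ) :
    eval e (f ⬝ a) = M.app (eval e f) (eval e a) := rfl
@[simp] theorem eval_cst {τ : Ty} (e : M.Env Γ) (c : Const τ) : eval e (.cst c) = M.cst c := rfl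

@[simp] theorem sat_eq0 (e : M.Env Γ) (s t : Term Γ nat) :
    Sat e (eq0 s t) ↔ eval e s = eval e t := Iff.rfl
@[simp] theorem sat_and (e : M.Env Γ) (φ ψ : Formula Γ) :
    Sat e (φ ⋏ ψ) ↔ Sat e φ ∧ Sat e ψ := Iff.rfl
@[simp] theorem sat_or (e : M.Env Γ) (φ ψ : Formula Γ) :
    Sat e (φ ⋎ ψ) ↔ Sat e φ ∨ Sat e ψ := Iff.rfl
@[simp] theorem sat_imp (e : M.Env Γ) (φ ψ : Formula Γ) :
    Sat e (φ ⟹ ψ) ↔ (Sat e φ → Sat e ψ) := Iff.rfl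
@[simp] theorem sat_neg (e : M.Env Γ) (φ : Formula Γ) : Sat e φ.neg ↔ ¬ Sat e φ := Iff.rfl
@[simp] theorem sat_iff (e : M.Env Γ) (φ ψ : Formula Γ) :
    Sat e (φ ⟺ ψ) ↔ (Sat e φ ↔ Sat e ψ) := iff_def.symm
@[simp] theorem sat_all {σ : Ty} (e : M.Env Γ) (φ : Formula (σ :: Γ)) :
    Sat e (all σ φ) ↔ ∀ a : M.D σ, Sat (a ∷ e) φ := Iff.rfl
@[simp] theorem sat_ex {σ : Ty} (e : M.Env Γ) (φ : Formula (σ :: Γ)) :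
    Sat e (ex σ φ) ↔ ∃ a : M.D σ, Sat (a ∷ e) φ := Iff.rfl

end Eval

variable (M) in
def zero : M.D nat := M.cst .zero
def succ (x : M.D nat) : M.D nat := M.app (M.cst .succ) x

@[simp] theorem eval_zeroT {Γ : Ctx} (e : M.Env Γ) : eval e zeroT = M.zero := rfl
@[simp] theorem eval_succT {Γ : Ctx} (e : M.Env Γ) (t : Term Γ nat) :
    eval e (succT t) = succ (eval e t) := rfl

variable [M.IsModel]

theorem app_proj {ρ τ : Ty} (x : M.D ρ) (y : M.D τ) :
    M.app (M.app (M.cst (.proj ρ τ)) x) y = x :=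
  IsModel.eq (M := M) (Γ := [ρ, τ]) (.cst (.proj ρ τ) ⬝ v0 ⬝ v1) v0
    (fun _ _ => .ax (.inl (.proj _ _))) (x ∷ y ∷ Env.nil)

theorem app_dist {δ ρ τ : Ty} (x : M.D (δ ⇾ ρ ⇾ τ)) (y : M.D (δ ⇾ ρ)) (u : M.D δ) :
    M.app (M.app (M.app (M.cst (.dist δ ρ τ)) x) y) u = M.app (M.app x u) (M.app y u) :=
  IsModel.eq (M := M) (Γ := [δ ⇾ ρ ⇾ τ, δ ⇾ ρ, δ]) (.cst (.dist δ ρ τ) ⬝ v0 ⬝ v1 ⬝ v2)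
    (v0 ⬝ v2 ⬝ (v1 ⬝ v2)) (fun _ _ => .ax (.inl (.dist _ _ _))) (x ∷ y ∷ u ∷ Env.nil)

-- Combinatory completeness. In a model the combinator equations are identities at every type, so
-- beta reduction holds for values of every type.
@[simp] theorem app_eval_lam {Γ : Ctx} {σ : Ty} (e : M.Env Γ) (x : M.D σ) :
    {τ : Ty} → (t : Term (σ :: Γ) τ) → M.app (eval e t.lam) x = eval (x ∷ e) t
  | _, .var .z => by simp [Term.lam, app_dist, app_proj]
  | _, .var (.s v) => by simp [Term.lam, app_proj]
  | _, .cst c => by simp [Term.lam, app_proj]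
  | _, .app f a => by
    simp only [Term.lam, eval_app, eval_cst, app_dist]
    rw [app_eval_lam e x f, app_eval_lam e x a]

/-! ## Induction and recursion -/

theorem succ_ne_zero (x : M.D nat) : succ x ≠ M.zero :=
  IsModel.sat (M := M) (Γ := [nat]) (eq0 (succT v0) zeroT).neg
    (fun _ _ => .ax (.inl (.succ_ne_zero _))) (x ∷ Env.nil)

theorem succ_inj {x y : M.D nat} (h : succ x = succ y) : x = y :=
  IsModel.sat (M := M) (Γ := [nat, nat]) (eq0 (succT v0) (succT v1) ⟹ eq0 v0 v1)
    (fun _ _ => .ax (.inl (.succ_inj _ _))) (x ∷ y ∷ Env.nil) h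

/-- The type `0` objects of a model may be nonstandard. Each later induction inside a model
therefore has to present its hypothesis as a formula. -/
theorem induction {Γ : Ctx} (e : M.Env Γ) (φ : Formula (nat :: Γ)) (h₀ : Sat (M.zero ∷ e) φ)
    (hs : ∀ x, Sat (x ∷ e) φ → Sat (succ x ∷ e) φ) (x : M.D nat) : Sat (x ∷ e) φ := by
  have := IsModel.sat (M := M) (φ.inst zeroT ⟹ all nat
    (φ ⟹ φ.subst (Sub.cons (succT v0) (fun _ v => .var (.s v)))) ⟹ all nat φ) (fun Δ s => by
      have := FAxioms.induction (φ.subst (s.lift nat))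
      refine .ax (.inl ?_)
      convert this using 1
      have hc : (Sub.cons (succT v0) fun _ v => .var (.s v)).comp (s.lift nat) =
          (s.lift nat).comp (Sub.cons (succT v0) fun _ v => .var (.s v)) := by
        refine Sub.hext fun τ v => ?_
        cases v with
        | z => rfl
        | s v =>
          have := Term.subst_wk (σ := nat) (Sub.cons (succT v0) fun _ v => .var (.s v)) (s v)
          exact ((this.trans (Term.rename_eq_subst _ _).symm)).symm
      simp only [Formula.subst, Formula.inst_subst, Formula.subst_subst, hc]
      rfl) e
  simp only [sat_imp, sat_all, sat_inst, sat_subst] at this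
  refine this h₀ (fun x hx => ?_) x
  convert hs x hx using 1
  funext τ v
  cases v <;> rfl

theorem zero_or_succ (x : M.D nat) : x = M.zero ∨ ∃ y, x = succ y := by
  have := induction (M := M) Env.nil (eq0 v0 zeroT ⋎ ex nat (eq0 v1 (succT v0))) (by simp)
    (fun x _ => by simp) x
  simpa using this

def Sub.nil (Γ : Ctx) : Sub [] Γ := fun _ v => nomatch v

/-- Recursion of type `0`. -/
def recV (n a : M.D nat) (f : M.D (nat ⇾ nat ⇾ nat)) : M.D nat :=
  M.app (M.app (M.app (M.cst (.recur [nat] .z)) n) a) f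

theorem recV_zero (a : M.D nat) (f : M.D (nat ⇾ nat ⇾ nat)) : recV M.zero a f = a :=
  IsModel.eq (M := M) (Γ := [nat, nat ⇾ nat ⇾ nat])
    (.cst (.recur [nat] .z) ⬝ zeroT ⬝ v0 ⬝ v1) v0
    (fun _ s => .ax (.inl (.recur_zero (l := [nat]) .z (Sub.cons (s .z) (Sub.nil _))
      (Sub.cons (s (.s .z)) (Sub.nil _))))) (a ∷ f ∷ Env.nil)

theorem recV_succ (n a : M.D nat) (f : M.D (nat ⇾ nat ⇾ nat)) :
    recV (succ n) a f = M.app (M.app f (recV n a f)) n :=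
  IsModel.eq (M := M) (Γ := [nat, nat, nat ⇾ nat ⇾ nat])
    (.cst (.recur [nat] .z) ⬝ succT v0 ⬝ v1 ⬝ v2)
    (v2 ⬝ (.cst (.recur [nat] .z) ⬝ v0 ⬝ v1 ⬝ v2) ⬝ v0)
    (fun _ s => .ax (.inl (.recur_succ (l := [nat]) .z (s .z)
      (Sub.cons (s (.s .z)) (Sub.nil _)) (Sub.cons (s (.s (.s .z))) (Sub.nil _)))))
    (n ∷ a ∷ f ∷ Env.nil)

/-- Models need not be extensional: step functionals obtained by abstraction in different contexts
may be different elements with the same values. Recursion of type `0` depends only on these values,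
which makes the arithmetic operations independent of the context. -/
theorem recV_congr (n a : M.D nat) {f g : M.D (nat ⇾ nat ⇾ nat)}
    (h : ∀ x y, M.app (M.app f x) y = M.app (M.app g x) y) : recV n a f = recV n a g := by
  have := induction (M := M) (a ∷ f ∷ g ∷ Env.nil)
    (eq0 (.cst (.recur [nat] .z) ⬝ v0 ⬝ v1 ⬝ v2) (.cst (.recur [nat] .z) ⬝ v0 ⬝ v1 ⬝ v3))
    ((recV_zero a f).trans (recV_zero a g).symm) (fun x hx => by
      have hx : recV x a f = recV x a g := hx
      have : recV (succ x) a f = recV (succ x) a g := by rw [recV_succ, recV_succ, hx, h]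
      exact this) n
  exact this

theorem eval_natRec {Γ : Ctx} (e : M.Env Γ) (n a : Term Γ nat)
    (t : Term (nat :: nat :: Γ) nat) :
    eval e (natRec n a t) = recV (eval e n) (eval e a) (eval e t.lam.lam) := rfl

/-! ## Arithmetic -/

def predV (x : M.D nat) : M.D nat := eval (x ∷ Env.nil) (predT v0)
def addV (x y : M.D nat) : M.D nat := eval (x ∷ y ∷ Env.nil) (addT v0 v1)
def mulV (x y : M.D nat) : M.D nat := eval (x ∷ y ∷ Env.nil) (mulT v0 v1)
def monus (x y : M.D nat) : M.D nat := eval (x ∷ y ∷ Env.nil) (monusT v0 v1)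
def pow2 (x : M.D nat) : M.D nat := eval (x ∷ Env.nil) (pow2T v0)

section EvalArith

variable {Γ : Ctx} (e : M.Env Γ) (s t : Term Γ nat)

@[simp] theorem eval_predT : eval e (predT s) = predV (eval e s) := by
  simp only [predV, predT, eval_natRec, eval_var_z, eval_zeroT]
  exact recV_congr _ _ fun x y => by simp
@[simp] theorem eval_addT : eval e (addT s t) = addV (eval e s) (eval e t) := by
  simp only [addV, addT, eval_natRec, eval_var_z, eval_var_s]
  exact recV_congr _ _ fun x y => by simp
@[simp] theorem eval_mulT : eval e (mulT s t) = mulV (eval e s) (eval e t) := by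
  simp only [mulV, mulT, eval_natRec, eval_var_z, eval_var_s, eval_zeroT]
  exact recV_congr _ _ fun x y => by simp
@[simp] theorem eval_monusT : eval e (monusT s t) = monus (eval e s) (eval e t) := by
  simp only [monus, monusT, eval_natRec, eval_var_z, eval_var_s]
  exact recV_congr _ _ fun x y => by simp
@[simp] theorem eval_pow2T : eval e (pow2T s) = pow2 (eval e s) := by
  simp only [pow2, pow2T, eval_natRec, eval_var_z, oneT, eval_succT, eval_zeroT]
  exact recV_congr _ _ fun x y => by simp

end EvalArith

@[simp] theorem predV_zero : predV M.zero = M.zero := by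
  simp only [predV, predT, eval_natRec, eval_var_z, eval_zeroT, recV_zero]
@[simp] theorem predV_succ (x : M.D nat) : predV (succ x) = x := by
  simp only [predV, predT, eval_natRec, eval_var_z, eval_zeroT, recV_succ, app_eval_lam]
theorem addV_zero (x : M.D nat) : addV x M.zero = x := by
  simp only [addV, addT, eval_natRec, eval_var_z, eval_var_s, recV_zero]
theorem addV_succ (x y : M.D nat) : addV x (succ y) = succ (addV x y) := by
  have := eval_addT (x ∷ y ∷ Env.nil) v0 (succT v1)
  rw [addT, eval_natRec, eval_succT, recV_succ] at this
  simp at this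
  exact this.symm
theorem mulV_zero (x : M.D nat) : mulV x M.zero = M.zero := by
  simp only [mulV, mulT, eval_natRec, eval_var_z, eval_var_s, recV_zero, eval_zeroT]
theorem mulV_succ (x y : M.D nat) : mulV x (succ y) = addV (mulV x y) x := by
  have := eval_mulT (x ∷ y ∷ Env.nil) v0 (succT v1)
  rw [mulT, eval_natRec, eval_succT, recV_succ] at this
  simp at this
  exact this.symm
theorem monus_zero (x : M.D nat) : monus x M.zero = x := by
  simp only [monus, monusT, eval_natRec, eval_var_z, eval_var_s, recV_zero]
theorem monus_succ (x y : M.D nat) : monus x (succ y) = predV (monus x y) := by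
  have := eval_monusT (x ∷ y ∷ Env.nil) v0 (succT v1)
  rw [monusT, eval_natRec, eval_succT, recV_succ] at this
  simp at this
  exact this.symm
theorem pow2_zero : pow2 M.zero = succ M.zero := by
  simp only [pow2, pow2T, eval_natRec, eval_var_z, recV_zero, oneT, eval_succT, eval_zeroT]
theorem pow2_succ (x : M.D nat) : pow2 (succ x) = addV (pow2 x) (pow2 x) := by
  have := eval_pow2T (x ∷ Env.nil) (succT v0)
  rw [pow2T, eval_natRec, eval_succT, recV_succ] at this
  simp at this
  exact this.symm

theorem eval_condT {Γ : Ctx} (e : M.Env Γ) (c a b : Term Γ nat) [Decidable (eval e c = M.zero)] :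
    eval e (condT c a b) = if eval e c = M.zero then eval e a else eval e b := by
  rw [condT, eval_natRec]
  rcases zero_or_succ (eval e c) with h | ⟨y, h⟩
  · rw [if_pos h, h, recV_zero]
  · rw [if_neg (by rw [h]; exact succ_ne_zero y), h, recV_succ]
    simp

section Semiring

theorem zero_addV (x : M.D nat) : addV M.zero x = x := by
  have := induction (M := M) Env.nil (eq0 (addT zeroT v0) v0) (by simp [addV_zero])
    (fun x hx => by simpa [addV_succ] using congrArg succ hx) x
  simpa using this
theorem succ_addV (x y : M.D nat) : addV (succ x) y = succ (addV x y) := by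
  have := induction (M := M) (x ∷ Env.nil) (eq0 (addT (succT v1) v0) (succT (addT v1 v0)))
    (by simp [addV_zero]) (fun y hy => by simpa [addV_succ] using congrArg succ hy) y
  simpa using this
theorem addV_comm (x y : M.D nat) : addV x y = addV y x := by
  have := induction (M := M) (x ∷ Env.nil) (eq0 (addT v1 v0) (addT v0 v1))
    (by simp [addV_zero, zero_addV])
    (fun y hy => by simpa [addV_succ, succ_addV] using congrArg succ hy) y
  simpa using this
theorem addV_assoc (x y z : M.D nat) : addV (addV x y) z = addV x (addV y z) := by
  have := induction (M := M) (x ∷ y ∷ Env.nil)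
    (eq0 (addT (addT v1 v2) v0) (addT v1 (addT v2 v0))) (by simp [addV_zero])
    (fun y hy => by simpa [addV_succ] using congrArg succ hy) z
  simpa using this
theorem addV_right_cancel (x y z : M.D nat) (h : addV x z = addV y z) : x = y := by
  have := induction (M := M) (x ∷ y ∷ Env.nil)
    (eq0 (addT v1 v0) (addT v2 v0) ⟹ eq0 v1 v2) (by simp [addV_zero])
    (fun z hz => by
      simp only [sat_imp, sat_eq0, eval_addT, eval_var_z, eval_var_s, addV_succ] at hz ⊢
      exact fun h => hz (succ_inj h)) z
  simp only [sat_imp, sat_eq0, eval_addT, eval_var_z, eval_var_s] at this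
  exact this h
theorem zero_mulV (x : M.D nat) : mulV M.zero x = M.zero := by
  have := induction (M := M) Env.nil (eq0 (mulT zeroT v0) zeroT) (by simp [mulV_zero])
    (fun x hx => by
      simp only [sat_eq0, eval_mulT, eval_var_z, eval_zeroT] at hx ⊢
      rw [mulV_succ, hx, addV_zero]) x
  simpa using this
theorem succ_mulV (x y : M.D nat) : mulV (succ x) y = addV (mulV x y) y := by
  have := induction (M := M) (x ∷ Env.nil) (eq0 (mulT (succT v1) v0) (addT (mulT v1 v0) v0))
    (by simp [mulV_zero, addV_zero]) (fun y hy => by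
      simp only [sat_eq0, eval_mulT, eval_var_z, eval_var_s, eval_succT, eval_addT] at hy ⊢
      rw [mulV_succ, mulV_succ, hy, addV_succ, addV_succ, addV_assoc, addV_assoc,
        addV_comm y x]) y
  simpa using this
theorem mulV_comm (x y : M.D nat) : mulV x y = mulV y x := by
  have := induction (M := M) (x ∷ Env.nil) (eq0 (mulT v1 v0) (mulT v0 v1))
    (by simp [mulV_zero, zero_mulV]) (fun y hy => by
      simp only [sat_eq0, eval_mulT, eval_var_z, eval_var_s] at hy ⊢
      rw [mulV_succ, succ_mulV, hy]) y
  simpa using this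
theorem mulV_addV (x y z : M.D nat) : mulV x (addV y z) = addV (mulV x y) (mulV x z) := by
  have := induction (M := M) (x ∷ y ∷ Env.nil)
    (eq0 (mulT v1 (addT v2 v0)) (addT (mulT v1 v2) (mulT v1 v0)))
    (by simp [mulV_zero, addV_zero]) (fun z hz => by
      simp only [sat_eq0, eval_mulT, eval_var_z, eval_var_s, eval_addT] at hz ⊢
      rw [mulV_succ, addV_succ, mulV_succ, hz, addV_assoc]) z
  simpa using this
theorem mulV_assoc (x y z : M.D nat) : mulV (mulV x y) z = mulV x (mulV y z) := by
  have := induction (M := M) (x ∷ y ∷ Env.nil)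
    (eq0 (mulT (mulT v1 v2) v0) (mulT v1 (mulT v2 v0)))
    (by simp [mulV_zero]) (fun z hz => by
      simp only [sat_eq0, eval_mulT, eval_var_z, eval_var_s] at hz ⊢
      rw [mulV_succ, mulV_succ, mulV_addV, hz]) z
  simpa using this

instance : Zero (M.D nat) := ⟨M.zero⟩
instance : One (M.D nat) := ⟨succ M.zero⟩
instance : Add (M.D nat) := ⟨addV⟩
instance : Mul (M.D nat) := ⟨mulV⟩

instance : CommSemiring (M.D nat) where
  add_assoc := addV_assoc
  zero_add := zero_addV
  add_zero := addV_zero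
  add_comm := addV_comm
  nsmul := nsmulRec
  left_distrib := mulV_addV
  right_distrib x y z := by
    change mulV (addV x y) z = addV (mulV x z) (mulV y z)
    rw [mulV_comm, mulV_addV, mulV_comm, mulV_comm z y]
  zero_mul := zero_mulV
  mul_zero := mulV_zero
  mul_assoc := mulV_assoc
  one_mul x := by
    change mulV (succ M.zero) x = x
    rw [succ_mulV, zero_mulV, zero_addV]
  mul_one x := by
    change mulV x (succ M.zero) = x
    rw [mulV_succ, mulV_zero, zero_addV]
  mul_comm := mulV_comm

theorem zero_def : M.zero = 0 := rfl
theorem addV_def (x y : M.D nat) : addV x y = x + y := rfl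
theorem mulV_def (x y : M.D nat) : mulV x y = x * y := rfl
theorem succ_def (x : M.D nat) : succ x = x + 1 := by
  conv_lhs => rw [← addV_zero x, ← addV_succ]
  rfl

instance : IsRightCancelAdd (M.D nat) := ⟨fun z x y h => addV_right_cancel x y z h⟩
instance : IsCancelAdd (M.D nat) := AddCommMagma.IsRightCancelAdd.toIsCancelAdd _

theorem zero_or_add_one (x : M.D nat) : x = 0 ∨ ∃ y, x = y + 1 := by
  simpa only [succ_def, zero_def] using zero_or_succ x

theorem add_one_ne_zero (x : M.D nat) : x + 1 ≠ 0 := by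
  rw [← succ_def]; exact succ_ne_zero x

theorem eq_zero_of_add (x y : M.D nat) (h : x + y = 0) : x = 0 := by
  rcases zero_or_add_one x with h' | ⟨z, rfl⟩
  · exact h'
  · rw [add_right_comm] at h
    exact (add_one_ne_zero _ h).elim

/-- This is the totality of the order of the model, defined below by the existence of a difference.
-/
theorem exists_add_or (x y : M.D nat) : (∃ z, x + z = y) ∨ ∃ z, y + z = x := by
  have := induction (M := M) (x ∷ Env.nil)
    (ex nat (eq0 (addT v2 v0) v1) ⋎ ex nat (eq0 (addT v1 v0) v2))
    (by simp [addV_def, zero_def]) (fun y hy => by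
      simp only [sat_or, sat_ex, sat_eq0, eval_addT, eval_var_z, eval_var_s, addV_def,
        succ_def] at hy ⊢
      rcases hy with ⟨z, hz⟩ | ⟨z, hz⟩
      · exact .inl ⟨z + 1, by rw [← hz, add_assoc]⟩
      · rcases zero_or_add_one z with rfl | ⟨w, rfl⟩
        · exact .inl ⟨1, by rw [← hz, add_zero]⟩
        · exact .inr ⟨w, by rw [← hz]; ring⟩) y
  simpa only [sat_or, sat_ex, sat_eq0, eval_addT, eval_var_z, eval_var_s, addV_def] using this

noncomputable instance : LinearOrder (M.D nat) where
  le x y := ∃ z, x + z = y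
  le_refl x := ⟨0, add_zero x⟩
  le_trans := by
    rintro x y z ⟨a, rfl⟩ ⟨b, rfl⟩
    exact ⟨a + b, (add_assoc _ _ _).symm⟩
  le_antisymm := by
    rintro x y ⟨a, rfl⟩ ⟨b, h⟩
    rw [add_assoc] at h
    rw [eq_zero_of_add a b (add_eq_left.1 h), add_zero]
  le_total := exists_add_or
  toDecidableLE := Classical.decRel _

theorem le_def {x y : M.D nat} : x ≤ y ↔ ∃ z, x + z = y := Iff.rfl

instance : ExistsAddOfLE (M.D nat) := ⟨fun h => by
  obtain ⟨z, h⟩ := h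
  exact ⟨z, h.symm⟩⟩

theorem zero_le' (x : M.D nat) : 0 ≤ x := ⟨x, zero_add x⟩

instance : Nontrivial (M.D nat) := ⟨0, 1, fun h => add_one_ne_zero (0 : M.D nat) (by
  rw [zero_add]; exact h.symm)⟩

theorem lt_iff {x y : M.D nat} : x < y ↔ ∃ z, x + z + 1 = y := by
  constructor
  · intro h
    obtain ⟨z, hz⟩ := h.le
    rcases zero_or_add_one z with rfl | ⟨w, rfl⟩
    · exact (h.ne (by rw [← hz, add_zero])).elim
    · exact ⟨w, by rw [← hz, add_assoc]⟩
  · rintro ⟨z, rfl⟩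
    refine lt_of_le_of_ne ⟨z + 1, (add_assoc _ _ _).symm⟩ fun h => ?_
    rw [add_assoc] at h
    exact add_one_ne_zero z (left_eq_add.1 h)

instance : IsOrderedRing (M.D nat) where
  add_le_add_left := by
    rintro x y ⟨z, rfl⟩ w
    exact ⟨z, by ring⟩
  zero_le_one := zero_le' 1
  mul_le_mul_of_nonneg_left := by
    rintro w _ x y ⟨z, rfl⟩
    exact ⟨w * z, by ring⟩
  mul_le_mul_of_nonneg_right := by
    rintro w _ x y ⟨z, rfl⟩
    exact ⟨z * w, by ring⟩

instance : IsStrictOrderedRing (M.D nat) where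
  le_of_add_le_add_left := by
    rintro x y z ⟨w, h⟩
    exact ⟨w, add_left_cancel (a := x) (by rw [← add_assoc, h])⟩
  exists_pair_ne := ⟨0, 1, zero_ne_one⟩
  mul_lt_mul_of_pos_left := by
    intro w hw x y h
    obtain ⟨v, rfl⟩ := lt_iff.1 hw
    obtain ⟨z, rfl⟩ := lt_iff.1 h
    exact lt_iff.2 ⟨v * z + v + z, by ring⟩
  mul_lt_mul_of_pos_right := by
    intro w hw x y h
    obtain ⟨v, rfl⟩ := lt_iff.1 hw
    obtain ⟨z, rfl⟩ := lt_iff.1 h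
    exact lt_iff.2 ⟨v * z + v + z, by ring⟩

theorem add_one_le_iff' {x y : M.D nat} : x + 1 ≤ y ↔ x < y := by
  rw [lt_iff, le_def]
  exact ⟨fun ⟨z, h⟩ => ⟨z, by rw [← h]; ring⟩, fun ⟨z, h⟩ => ⟨z, by rw [← h]; ring⟩⟩

end Semiring

end Struct
end ProbLogic

namespace ProbLogic

open Ty Formula

namespace Struct

set_option linter.unusedSectionVars false

variable {M : Struct} [M.IsModel]

/-! ## Order arithmetic -/

theorem eval_oneT {Γ : Ctx} (e : M.Env Γ) : eval e oneT = 1 := rfl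

theorem predV_add_one (x : M.D nat) : predV (x + 1) = x := by rw [← succ_def, predV_succ]
theorem monus_zero' (x : M.D nat) : monus x 0 = x := monus_zero x
theorem monus_add_one (x y : M.D nat) : monus x (y + 1) = predV (monus x y) := by
  rw [← succ_def, monus_succ]

theorem monus_add_one_add_one (x y : M.D nat) : monus (x + 1) (y + 1) = monus x y := by
  have := induction (M := M) (x ∷ Env.nil) (eq0 (monusT (succT v1) (succT v0)) (monusT v1 v0))
    (by
      simp only [sat_eq0, eval_monusT, eval_succT, eval_var_z, eval_var_s, succ_def, zero_def]
      rw [monus_add_one, monus_zero', predV_add_one, monus_zero']) (fun y hy => by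
      simp only [sat_eq0, eval_monusT, eval_succT, eval_var_z, eval_var_s, succ_def] at hy ⊢
      rw [monus_add_one, hy, monus_add_one]) y
  simpa only [sat_eq0, eval_monusT, eval_succT, eval_var_z, eval_var_s, succ_def] using this

theorem add_monus (x z : M.D nat) : monus (x + z) z = x := by
  have := induction (M := M) (x ∷ Env.nil) (eq0 (monusT (addT v1 v0) v0) v1)
    (by simp [zero_def, addV_def, monus_zero']) (fun y hy => by
      simp only [sat_eq0, eval_monusT, eval_addT, eval_var_z, eval_var_s, succ_def,
        addV_def] at hy ⊢
      rw [← add_assoc, monus_add_one_add_one, hy]) z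
  simpa only [sat_eq0, eval_monusT, eval_addT, eval_var_z, eval_var_s, addV_def] using this

theorem zero_monus (z : M.D nat) : monus 0 z = 0 := by
  have := induction (M := M) Env.nil (eq0 (monusT zeroT v0) zeroT)
    (by simp [zero_def, monus_zero']) (fun y hy => by
      simp only [sat_eq0, eval_monusT, eval_zeroT, eval_var_z, succ_def, zero_def] at hy ⊢
      rw [monus_add_one, hy]; exact predV_zero) z
  simpa only [sat_eq0, eval_monusT, eval_zeroT, eval_var_z, zero_def] using this

theorem monus_add (x z : M.D nat) : monus x (x + z) = 0 := by
  have := induction (M := M) (z ∷ Env.nil) (eq0 (monusT v0 (addT v0 v1)) zeroT)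
    (by simp [zero_def, addV_def, zero_monus]) (fun y hy => by
      simp only [sat_eq0, eval_monusT, eval_addT, eval_var_z, eval_var_s, succ_def,
        addV_def, eval_zeroT] at hy ⊢
      rw [add_right_comm, monus_add_one_add_one, hy]) x
  simpa only [sat_eq0, eval_monusT, eval_addT, eval_var_z, eval_var_s, addV_def, eval_zeroT,
    zero_def] using this

theorem monus_eq_zero_iff {x y : M.D nat} : monus x y = 0 ↔ x ≤ y := by
  constructor
  · intro h
    rcases le_total x y with h' | ⟨z, rfl⟩
    · exact h'
    · rw [add_comm, add_monus] at h
      rw [h, add_zero]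
  · rintro ⟨z, rfl⟩
    exact monus_add x z

@[simp] theorem sat_le0 {Γ : Ctx} (e : M.Env Γ) (s t : Term Γ nat) :
    Sat e (le0 s t) ↔ eval e s ≤ eval e t := by
  rw [le0, sat_eq0, eval_monusT, eval_zeroT, zero_def, monus_eq_zero_iff]

theorem eval_ltT_eq_zero {Γ : Ctx} (e : M.Env Γ) (s t : Term Γ nat) :
    eval e (ltT s t) = 0 ↔ eval e s < eval e t := by
  rw [ltT, eval_monusT, eval_monusT, monus_eq_zero_iff, eval_oneT]
  conv_lhs => rw [← zero_add (1 : M.D nat), add_one_le_iff']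
  rw [← not_le (a := eval e t), ← monus_eq_zero_iff (y := eval e s)]
  exact ⟨fun h => h.ne', fun h => lt_of_le_of_ne (zero_le' _) (Ne.symm h)⟩

variable (M) in
/-- The field of fractions of the natural numbers of a model. -/
def K : Type := FractionRing (DiffRing (M.D nat))

noncomputable instance : Field M.K := inferInstanceAs (Field (FractionRing (DiffRing (M.D nat))))
noncomputable instance : LinearOrder M.K :=
  inferInstanceAs (LinearOrder (FractionRing (DiffRing (M.D nat))))
instance : IsStrictOrderedRing M.K :=
  inferInstanceAs (IsStrictOrderedRing (FractionRing (DiffRing (M.D nat))))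

/-- The embedding of the natural numbers of a model into the fractions. -/
noncomputable def cast : M.D nat →+* M.K :=
  (algebraMap (DiffRing (M.D nat)) (FractionRing (DiffRing (M.D nat)))).comp (DiffRing.of (M.D nat))

theorem cast_strictMono : StrictMono (cast (M := M)) :=
  (algebraMap_fractionRing_strictMono _).comp DiffRing.of_strictMono

theorem cast_nonneg (x : M.D nat) : 0 ≤ cast x := by
  rw [← map_zero cast]
  exact cast_strictMono.monotone (zero_le' x)

theorem cast_le {x y : M.D nat} : cast x ≤ cast y ↔ x ≤ y := cast_strictMono.le_iff_le
theorem cast_lt {x y : M.D nat} : cast x < cast y ↔ x < y := cast_strictMono.lt_iff_lt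

theorem cast_monus (x y : M.D nat) : cast (monus x y) = max (cast x - cast y) 0 := by
  rcases le_total x y with h | h
  · rw [monus_eq_zero_iff.2 h, map_zero, max_eq_right (sub_nonpos.2 (cast_le.2 h))]
  · have h' := cast_le.2 h
    obtain ⟨z, rfl⟩ := h
    rw [add_comm, add_monus, max_eq_left (by rwa [add_comm, sub_nonneg]), map_add,
      add_sub_cancel_right]

theorem cast_predV {x : M.D nat} (h : x ≠ 0) : cast (predV x) + 1 = cast x := by
  obtain ⟨y, rfl⟩ := (zero_or_add_one x).resolve_left h
  rw [predV_add_one, map_add, map_one]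

theorem pow2_zero' : pow2 (0 : M.D nat) = 1 := pow2_zero
theorem pow2_add_one (x : M.D nat) : pow2 (x + 1) = pow2 x + pow2 x := by
  rw [← succ_def, pow2_succ, addV_def]

theorem lt_pow2 (x : M.D nat) : x < pow2 x := by
  have := induction (M := M) Env.nil (le0 (succT v0) (pow2T v0))
    (by simp [zero_def, succ_def, pow2_zero']) (fun y hy => by
      simp only [sat_le0, eval_pow2T, eval_succT, eval_var_z, succ_def] at hy ⊢
      rw [pow2_add_one]
      exact add_le_add hy (le_trans (by rw [add_comm]; exact ⟨y, rfl⟩) hy)) x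
  simpa only [sat_le0, eval_pow2T, eval_succT, eval_var_z, succ_def, add_one_le_iff'] using this

theorem pow2_pos (x : M.D nat) : 0 < pow2 x := (zero_le' x).trans_lt (lt_pow2 x)

/-- The fraction `2⁻ⁿ`. -/
noncomputable def eps (n : M.D nat) : M.K := (cast (pow2 n))⁻¹

theorem cast_pow2_pos (n : M.D nat) : 0 < cast (pow2 n) := by
  rw [← map_zero cast]; exact cast_strictMono (pow2_pos n)
theorem eps_pos (n : M.D nat) : 0 < eps n := inv_pos.2 (cast_pow2_pos n)
theorem eps_add_one (n : M.D nat) : eps (n + 1) = eps n / 2 := by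
  rw [eps, eps, pow2_add_one, map_add, ← two_mul, mul_inv, div_eq_inv_mul]

/-! ## Pairing -/

def triV (x : M.D nat) : M.D nat :=
  eval (x ∷ Env.nil) (natRec v0 zeroT (addT v1 (succT v0)))

theorem eval_triT {Γ : Ctx} (e : M.Env Γ) (t : Term Γ nat) :
    eval e (natRec t zeroT (addT v1 (succT v0))) = triV (eval e t) := by
  simp only [triV, eval_natRec, eval_var_z, eval_zeroT]
  exact recV_congr _ _ fun x y => by simp

theorem triV_zero : triV (0 : M.D nat) = 0 := recV_zero _ _
theorem triV_add_one (x : M.D nat) : triV (x + 1) = triV x + (x + 1) := by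
  have := eval_triT (x ∷ Env.nil) (succT v0)
  rw [eval_natRec, eval_succT, recV_succ] at this
  simp only [app_eval_lam, eval_addT, eval_succT, eval_var_z, eval_var_s, succ_def] at this
  exact this.symm

def pairV (a b : M.D nat) : M.D nat := triV (a + b) + a

theorem eval_pairT {Γ : Ctx} (e : M.Env Γ) (s t : Term Γ nat) :
    eval e (pairT s t) = pairV (eval e s) (eval e t) := by
  rw [pairT, eval_addT, eval_triT, eval_addT]; rfl

def recP (i : Var [nat, nat] nat) (n : M.D nat) (F G : M.D (nat ⇾ nat ⇾ nat ⇾ nat)) : M.D nat :=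
  M.app (M.app (M.app (M.app (M.app (M.cst (.recur [nat, nat] i)) n) 0) 0) F) G

theorem recP_zero (i : Var [nat, nat] nat) (F G : M.D (nat ⇾ nat ⇾ nat ⇾ nat)) :
    recP i 0 F G = 0 := by
  have hi : ∀ {Γ : Ctx}, (unpairStart i : Term Γ nat) = zeroT := by
    intro Γ
    cases i with
    | z => rfl
    | s i => cases i with
      | z => rfl
      | s i => cases i
  exact IsModel.eq (M := M) (Γ := [nat ⇾ nat ⇾ nat ⇾ nat, nat ⇾ nat ⇾ nat ⇾ nat])
    (.cst (.recur [nat, nat] i) ⬝ zeroT ⬝ zeroT ⬝ zeroT ⬝ v0 ⬝ v1) zeroT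
    (fun _ s => by
      have := FAxioms.recur_zero (l := [nat, nat]) i unpairStart
        (Sub.cons (s .z) (Sub.cons (s (.s .z)) (Sub.nil _)))
      rw [hi] at this
      exact .ax (.inl this)) (F ∷ G ∷ Env.nil)

theorem recP_fst_succ (n : M.D nat) (F G : M.D (nat ⇾ nat ⇾ nat ⇾ nat)) :
    recP .z (n + 1) F G =
      M.app (M.app (M.app F (recP .z n F G)) (recP (.s .z) n F G)) n := by
  rw [← succ_def]
  exact IsModel.eq (M := M) (Γ := [nat, nat ⇾ nat ⇾ nat ⇾ nat, nat ⇾ nat ⇾ nat ⇾ nat])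
    (.cst (.recur [nat, nat] .z) ⬝ succT v0 ⬝ zeroT ⬝ zeroT ⬝ v1 ⬝ v2)
    (v1 ⬝ (.cst (.recur [nat, nat] .z) ⬝ v0 ⬝ zeroT ⬝ zeroT ⬝ v1 ⬝ v2) ⬝
      (.cst (.recur [nat, nat] (.s .z)) ⬝ v0 ⬝ zeroT ⬝ zeroT ⬝ v1 ⬝ v2) ⬝ v0)
    (fun _ s => .ax (.inl (.recur_succ (l := [nat, nat]) .z (s .z) unpairStart
        (Sub.cons (s (.s .z)) (Sub.cons (s (.s (.s .z))) (Sub.nil _))))))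
    (n ∷ F ∷ G ∷ Env.nil)

theorem recP_snd_succ (n : M.D nat) (F G : M.D (nat ⇾ nat ⇾ nat ⇾ nat)) :
    recP (.s .z) (n + 1) F G =
      M.app (M.app (M.app G (recP .z n F G)) (recP (.s .z) n F G)) n := by
  rw [← succ_def]
  exact IsModel.eq (M := M) (Γ := [nat, nat ⇾ nat ⇾ nat ⇾ nat, nat ⇾ nat ⇾ nat ⇾ nat])
    (.cst (.recur [nat, nat] (.s .z)) ⬝ succT v0 ⬝ zeroT ⬝ zeroT ⬝ v1 ⬝ v2)
    (v2 ⬝ (.cst (.recur [nat, nat] .z) ⬝ v0 ⬝ zeroT ⬝ zeroT ⬝ v1 ⬝ v2) ⬝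
      (.cst (.recur [nat, nat] (.s .z)) ⬝ v0 ⬝ zeroT ⬝ zeroT ⬝ v1 ⬝ v2) ⬝ v0)
    (fun _ s => .ax (.inl (.recur_succ (l := [nat, nat]) (.s .z) (s .z) unpairStart
        (Sub.cons (s (.s .z)) (Sub.cons (s (.s (.s .z))) (Sub.nil _))))))
    (n ∷ F ∷ G ∷ Env.nil)

/-- The analogue of `recV_congr` for pairs; both components must be carried through one induction,
since each step uses both. -/
theorem recP_congr (n : M.D nat) {F G F' G' : M.D (nat ⇾ nat ⇾ nat ⇾ nat)}
    (hF : ∀ x y z, M.app (M.app (M.app F x) y) z = M.app (M.app (M.app F' x) y) z)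
    (hG : ∀ x y z, M.app (M.app (M.app G x) y) z = M.app (M.app (M.app G' x) y) z) :
    recP .z n F G = recP .z n F' G' ∧ recP (.s .z) n F G = recP (.s .z) n F' G' := by
  have := induction (M := M) (F ∷ G ∷ F' ∷ G' ∷ Env.nil)
    (eq0 (.cst (.recur [nat, nat] .z) ⬝ v0 ⬝ zeroT ⬝ zeroT ⬝ v1 ⬝ v2)
      (.cst (.recur [nat, nat] .z) ⬝ v0 ⬝ zeroT ⬝ zeroT ⬝ v3 ⬝ v4) ⋏
    eq0 (.cst (.recur [nat, nat] (.s .z)) ⬝ v0 ⬝ zeroT ⬝ zeroT ⬝ v1 ⬝ v2)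
      (.cst (.recur [nat, nat] (.s .z)) ⬝ v0 ⬝ zeroT ⬝ zeroT ⬝ v3 ⬝ v4))
    ⟨(recP_zero .z F G).trans (recP_zero .z F' G').symm,
      (recP_zero (.s .z) F G).trans (recP_zero (.s .z) F' G').symm⟩ (fun x hx => by
      have hx : recP .z x F G = recP .z x F' G' ∧ recP (.s .z) x F G = recP (.s .z) x F' G' := hx
      have : recP .z (succ x) F G = recP .z (succ x) F' G' ∧
          recP (.s .z) (succ x) F G = recP (.s .z) (succ x) F' G' := by
        rw [succ_def, recP_fst_succ, recP_fst_succ, recP_snd_succ, recP_snd_succ, hx.1, hx.2, hF,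
          hG]
        exact ⟨rfl, rfl⟩
      exact this) n
  exact this

open Classical in
theorem app_unpairSteps_fst {Γ : Ctx} (e : M.Env Γ) (a b n : M.D nat) :
    M.app (M.app (M.app (eval e (unpairSteps .z)) a) b) n = if b = 0 then 0 else a + 1 := by
  refine (congrArg (fun x => M.app (M.app x _) n) (app_eval_lam _ _ _)).trans ?_
  refine (congrArg (fun x => M.app x n) (app_eval_lam _ _ _)).trans ?_
  refine (app_eval_lam _ _ _).trans ?_
  rw [eval_condT]
  simp only [eval_var_z, eval_var_s, eval_zeroT, eval_succT, zero_def, succ_def]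

open Classical in
theorem app_unpairSteps_snd {Γ : Ctx} (e : M.Env Γ) (a b n : M.D nat) :
    M.app (M.app (M.app (eval e (unpairSteps (.s .z))) a) b) n =
      if b = 0 then a + 1 else predV b := by
  refine (congrArg (fun x => M.app (M.app x _) n) (app_eval_lam _ _ _)).trans ?_
  refine (congrArg (fun x => M.app x n) (app_eval_lam _ _ _)).trans ?_
  refine (app_eval_lam _ _ _).trans ?_
  rw [eval_condT]
  simp only [eval_var_z, eval_var_s, eval_predT, eval_succT, zero_def, succ_def]

def fstV (n : M.D nat) : M.D nat :=
  recP .z n (eval Env.nil (unpairSteps .z)) (eval Env.nil (unpairSteps (.s .z)))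
def sndV (n : M.D nat) : M.D nat :=
  recP (.s .z) n (eval Env.nil (unpairSteps .z)) (eval Env.nil (unpairSteps (.s .z)))

@[simp] theorem eval_fstT {Γ : Ctx} (e : M.Env Γ) (t : Term Γ nat) :
    eval e (fstT t) = fstV (eval e t) :=
  (recP_congr _ (fun x y z => (app_unpairSteps_fst _ x y z).trans (app_unpairSteps_fst _ x y z).symm)
    (fun x y z => (app_unpairSteps_snd _ x y z).trans (app_unpairSteps_snd _ x y z).symm)).1
@[simp] theorem eval_sndT {Γ : Ctx} (e : M.Env Γ) (t : Term Γ nat) :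
    eval e (sndT t) = sndV (eval e t) :=
  (recP_congr _ (fun x y z => (app_unpairSteps_fst _ x y z).trans (app_unpairSteps_fst _ x y z).symm)
    (fun x y z => (app_unpairSteps_snd _ x y z).trans (app_unpairSteps_snd _ x y z).symm)).2

theorem fstV_zero : fstV (0 : M.D nat) = 0 := recP_zero _ _ _
theorem sndV_zero : sndV (0 : M.D nat) = 0 := recP_zero _ _ _

open Classical in
theorem fstV_add_one (n : M.D nat) :
    fstV (n + 1) = if sndV n = 0 then 0 else fstV n + 1 := by
  rw [fstV, recP_fst_succ, app_unpairSteps_fst]; rfl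

open Classical in
theorem sndV_add_one (n : M.D nat) :
    sndV (n + 1) = if sndV n = 0 then fstV n + 1 else predV (sndV n) := by
  rw [sndV, recP_snd_succ, app_unpairSteps_snd]; rfl

/-- The enumeration runs along the diagonal of sum `s`: starting from `(0, s)`, each of the first
`s` steps moves one unit from the second component to the first. -/
theorem unpair_tri_add (s a : M.D nat) (h : a ≤ s) (hs : fstV (triV s) = 0 ∧ sndV (triV s) = s) :
    fstV (triV s + a) = a ∧ sndV (triV s + a) + a = s := by
  have := induction (M := M) (triV s ∷ s ∷ Env.nil) (le0 v0 v2 ⟹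
    eq0 (fstT (addT v1 v0)) v0 ⋏ eq0 (addT (sndT (addT v1 v0)) v0) v2)
    (by simp [zero_def, addV_def, hs]) (fun x hx => by
      simp only [sat_imp, sat_le0, sat_and, sat_eq0, eval_fstT, eval_sndT, eval_addT, eval_var_z,
        eval_var_s, succ_def, addV_def] at hx ⊢
      intro hl
      have hl' := add_one_le_iff'.1 hl
      obtain ⟨h₁, h₂⟩ := hx hl'.le
      have h₃ : sndV (triV s + x) ≠ 0 := fun h0 => by
        rw [h0, zero_add] at h₂
        exact hl'.ne h₂
      rw [← add_assoc, fstV_add_one, sndV_add_one, if_neg h₃, if_neg h₃, h₁]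
      refine ⟨rfl, ?_⟩
      obtain ⟨y, hy⟩ := (zero_or_add_one _).resolve_left h₃
      rw [hy] at h₂ ⊢
      rw [predV_add_one, ← h₂]; ring) a
  simp only [sat_imp, sat_le0, sat_and, sat_eq0, eval_fstT, eval_sndT, eval_addT, eval_var_z,
        eval_var_s, addV_def] at this
  exact this h

/-- The diagonal of sum `x` ends at `(x, 0)` after `x` steps, and one further step reaches `(0, x +
1)`. -/
theorem unpair_tri (s : M.D nat) : fstV (triV s) = 0 ∧ sndV (triV s) = s := by
  have := induction (M := M) Env.nil
    (eq0 (fstT (natRec v0 zeroT (addT v1 (succT v0)))) zeroT ⋏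
      eq0 (sndT (natRec v0 zeroT (addT v1 (succT v0)))) v0)
    (by simp [eval_triT, zero_def, triV_zero, fstV_zero, sndV_zero]) (fun x hx => by
      simp only [sat_and, sat_eq0, eval_fstT, eval_sndT, eval_triT, eval_var_z, eval_zeroT,
        zero_def, succ_def] at hx ⊢
      obtain ⟨h₁, h₂⟩ := unpair_tri_add x x le_rfl hx
      have h₃ : sndV (triV x + x) = 0 := add_eq_right.1 h₂
      rw [triV_add_one, ← add_assoc, fstV_add_one, sndV_add_one, if_pos h₃, if_pos h₃, h₁]
      exact ⟨rfl, rfl⟩) s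
  simpa only [sat_and, sat_eq0, eval_fstT, eval_sndT, eval_triT, eval_var_z, eval_zeroT,
        zero_def] using this

theorem fstV_pairV (a b : M.D nat) : fstV (pairV a b) = a :=
  (unpair_tri_add (a + b) a ⟨b, rfl⟩ (unpair_tri _)).1

theorem sndV_pairV (a b : M.D nat) : sndV (pairV a b) = b := by
  have := (unpair_tri_add (a + b) a ⟨b, rfl⟩ (unpair_tri _)).2
  rw [add_comm a b] at this
  exact add_right_cancel (by rw [← this, pairV, add_comm b a])

/-! ## Rational numbers -/

/-- The fraction coded by a number. -/
noncomputable def qval (q : M.D nat) : M.K :=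
  (cast (fstV (fstV q)) - cast (sndV (fstV q))) / (cast (sndV q) + 1)

theorem den_pos (q : M.D nat) : 0 < cast (sndV q) + 1 :=
  add_pos_of_nonneg_of_pos (cast_nonneg _) one_pos

section Rationals

variable {Γ : Ctx} (e : M.Env Γ)

theorem qval_qCode (a b d : Term Γ nat) : qval (eval e (qCode a b d)) =
    (cast (eval e a) - cast (eval e b)) / (cast (eval e d) + 1) := by
  rw [qCode, eval_pairT, eval_pairT, qval, fstV_pairV, sndV_pairV, fstV_pairV, sndV_pairV]

theorem cast_eval_addT (s t : Term Γ nat) :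
    cast (eval e (addT s t)) = cast (eval e s) + cast (eval e t) := by
  rw [eval_addT, addV_def, map_add]
theorem cast_eval_mulT (s t : Term Γ nat) :
    cast (eval e (mulT s t)) = cast (eval e s) * cast (eval e t) := by
  rw [eval_mulT, mulV_def, map_mul]
theorem cast_eval_succT (t : Term Γ nat) : cast (eval e (succT t)) = cast (eval e t) + 1 := by
  rw [eval_succT, succ_def, map_add, map_one]
theorem cast_eval_zeroT : cast (eval e (zeroT : Term Γ nat)) = 0 := map_zero cast
theorem cast_eval_oneT : cast (eval e (oneT : Term Γ nat)) = 1 := map_one cast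

@[simp] theorem qval_qOne : qval (eval e (qOne : Term Γ nat)) = 1 := by
  rw [qOne, qval_qCode, cast_eval_zeroT, cast_eval_oneT]; simp
@[simp] theorem qval_qZero : qval (eval e (qZero : Term Γ nat)) = 0 := by
  rw [qZero, qval_qCode, cast_eval_zeroT]; simp
@[simp] theorem qval_qPow (n : Term Γ nat) : qval (eval e (qPow n)) = eps (eval e n) := by
  rw [qPow, qval_qCode, cast_eval_zeroT, cast_eval_oneT, eval_predT, eval_pow2T,
    cast_predV (pow2_pos _).ne', sub_zero, one_div]; rfl
@[simp] theorem qval_qNeg (q : Term Γ nat) : qval (eval e (qNeg q)) = -qval (eval e q) := by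
  rw [qNeg, qval_qCode, qNegPart, qPos, qval]
  simp only [eval_fstT, eval_sndT]
  ring
@[simp] theorem qval_qAdd (p q : Term Γ nat) :
    qval (eval e (qAdd p q)) = qval (eval e p) + qval (eval e q) := by
  have hp := den_pos (eval e p)
  have hq := den_pos (eval e q)
  -- A code stores the denominator minus one, and the truncated predecessor is exact only on a
  -- nonzero product.
  have h : eval e (mulT (qDen p) (qDen q)) ≠ 0 := by
    intro h
    have := congrArg cast h
    rw [cast_eval_mulT, qDen, qDen, cast_eval_succT, cast_eval_succT, map_zero, eval_sndT,
      eval_sndT] at this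
    exact (mul_pos hp hq).ne' this
  rw [qAdd, qval_qCode, eval_predT, cast_predV h]
  simp only [cast_eval_addT, cast_eval_mulT, cast_eval_succT, qPos, qNegPart, qDen, eval_fstT,
    eval_sndT, qval]
  have hp' := hp.ne'
  have hq' := hq.ne'
  field_simp
  ring
@[simp] theorem qval_qSub (p q : Term Γ nat) :
    qval (eval e (qSub p q)) = qval (eval e p) - qval (eval e q) := by
  rw [qSub, qval_qAdd, qval_qNeg, sub_eq_add_neg]
@[simp] theorem qval_qAbs (q : Term Γ nat) : qval (eval e (qAbs q)) = |qval (eval e q)| := by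
  rw [qAbs, qval_qCode, cast_eval_zeroT, cast_eval_addT, eval_monusT, eval_monusT, cast_monus,
    cast_monus, qval, abs_div, abs_of_pos (den_pos (eval e q)), sub_zero, eval_sndT]
  congr 1
  simp only [qPos, qNegPart, eval_fstT, eval_sndT]
  rcases le_total (cast (fstV (fstV (eval e q)))) (cast (sndV (fstV (eval e q)))) with h | h
  · rw [max_eq_right (sub_nonpos.2 h), max_eq_left (sub_nonneg.2 h), abs_of_nonpos (sub_nonpos.2 h)]
    ring
  · rw [max_eq_right (sub_nonpos.2 h), max_eq_left (sub_nonneg.2 h), abs_of_nonneg (sub_nonneg.2 h)]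
    ring

theorem eval_qLtT_eq_zero (p q : Term Γ nat) :
    eval e (qLtT p q) = 0 ↔ qval (eval e p) < qval (eval e q) := by
  rw [qLtT, eval_ltT_eq_zero, ← cast_lt, qval, qval, div_lt_div_iff₀ (den_pos _) (den_pos _)]
  simp only [cast_eval_addT, cast_eval_mulT, cast_eval_succT, qPos, qNegPart, qDen, eval_fstT,
    eval_sndT]
  rw [← sub_pos, ← sub_pos (b := _ * _)]
  ring_nf

@[simp] theorem sat_qLt (p q : Term Γ nat) :
    Sat e (qLt p q) ↔ qval (eval e p) < qval (eval e q) := eval_qLtT_eq_zero e p q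
@[simp] theorem sat_qLe (p q : Term Γ nat) :
    Sat e (qLe p q) ↔ qval (eval e p) ≤ qval (eval e q) := by
  rw [qLe, sat_neg, sat_qLt, not_lt]

end Rationals

end Struct
end ProbLogic

namespace ProbLogic

open Ty Formula

namespace Struct

set_option linter.unusedSectionVars false

variable {M : Struct} [M.IsModel]

/-! ## Real numbers -/

-- The exact value is needed, not only its vanishing, because `badT` sums these characteristic
-- values.
open Classical in
theorem eval_qLtT {Γ : Ctx} (e : M.Env Γ) (p q : Term Γ nat) :
    eval e (qLtT p q) = if qval (eval e p) < qval (eval e q) then 0 else 1 := by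
  split_ifs with h
  · exact (eval_qLtT_eq_zero e p q).2 h
  · rw [← eval_qLtT_eq_zero] at h
    rw [qLtT, ltT, eval_monusT, eval_oneT] at h ⊢
    rcases zero_or_add_one (eval e (monusT (addT (mulT (qPos q) (qDen p))
      (mulT (qNegPart p) (qDen q))) (addT (mulT (qPos p) (qDen q))
      (mulT (qNegPart q) (qDen p))))) with h' | ⟨y, h'⟩
    · rw [h', monus_zero']
    · rw [h'] at h
      refine absurd ?_ h
      have := monus_add_one_add_one 0 y
      rwa [zero_add, zero_monus] at this

def badV (f : M.D (nat ⇾ nat)) (n : M.D nat) : M.D nat := eval (n ∷ f ∷ Env.nil) (badT v1 v0)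
def hatV (f : M.D (nat ⇾ nat)) (n : M.D nat) : M.D nat := eval (n ∷ f ∷ Env.nil) (hat v1 v0)

section Hat

variable {Γ : Ctx} (e : M.Env Γ) (f : Term Γ (nat ⇾ nat)) (n : Term Γ nat)

theorem eval_badT : eval e (badT f n) = badV (eval e f) (eval e n) := by
  simp only [badV, badT, eval_natRec, eval_var_z, eval_zeroT]
  exact recV_congr _ _ fun x y => by simp [eval_qLtT]

theorem eval_hat : eval e (hat f n) = hatV (eval e f) (eval e n) := by
  classical
  simp only [hatV, hat, eval_natRec, eval_var_z, eval_var_s, eval_app, eval_zeroT]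
  exact recV_congr _ _ fun x y => by simp [eval_condT, eval_badT]

end Hat

theorem badV_zero (f : M.D (nat ⇾ nat)) : badV f 0 = 0 := recV_zero _ _

open Classical in
theorem badV_add_one (f : M.D (nat ⇾ nat)) (n : M.D nat) : badV f (n + 1) = badV f n +
    if |qval (M.app f n) - qval (M.app f (n + 1))| < eps (n + 1) then 0 else 1 := by
  have h := eval_badT (n ∷ f ∷ Env.nil) v1 (succT v0)
  rw [badT, eval_natRec, eval_succT, recV_succ] at h
  simp only [app_eval_lam, eval_addT, eval_qLtT, qval_qAbs, qval_qSub, qval_qPow, eval_app,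
    eval_wk, eval_succT, eval_var_z, eval_var_s, succ_def, addV_def] at h
  exact h.symm

theorem hatV_zero (f : M.D (nat ⇾ nat)) : hatV f 0 = M.app f 0 := recV_zero _ _

open Classical in
theorem hatV_add_one (f : M.D (nat ⇾ nat)) (n : M.D nat) :
    hatV f (n + 1) = if badV f (n + 1) = 0 then M.app f (n + 1) else hatV f n := by
  have h := eval_hat (n ∷ f ∷ Env.nil) v1 (succT v0)
  rw [hat, eval_natRec, eval_succT, recV_succ] at h
  simp only [app_eval_lam, eval_condT, eval_badT, eval_app,
    eval_wk, eval_succT, eval_var_z, eval_var_s, succ_def, zero_def] at h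
  exact h.symm

theorem hatV_eq_of_badV {f : M.D (nat ⇾ nat)} {n : M.D nat} (h : badV f n = 0) :
    hatV f n = M.app f n := by
  rcases zero_or_add_one n with rfl | ⟨y, rfl⟩
  · exact hatV_zero f
  · rw [hatV_add_one, if_pos h]

/-- Without a violation up to `n + 1`, both values agree with `f`, whose last step was checked;
after a violation the sequence is constant. -/
theorem hatV_step (f : M.D (nat ⇾ nat)) (n : M.D nat) :
    |qval (hatV f n) - qval (hatV f (n + 1))| < eps (n + 1) := by
  classical
  rw [hatV_add_one]
  split_ifs with h
  · have h' := h
    rw [badV_add_one] at h'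
    rw [hatV_eq_of_badV (eq_zero_of_add _ _ h')]
    rw [add_comm] at h'
    by_contra hn
    rw [if_neg hn] at h'
    exact one_ne_zero (eq_zero_of_add _ _ h')
  · rw [sub_self, abs_zero]
    exact eps_pos _

theorem hatV_of_const {f : M.D (nat ⇾ nat)} {c : M.D nat} (h : ∀ n, M.app f n = c) (n : M.D nat) :
    hatV f n = c := by
  classical
  have := induction (M := M) (f ∷ c ∷ Env.nil) (eq0 (hat v1 v0) v2)
    (by simp [eval_hat, zero_def, hatV_zero, h]) (fun x hx => by
      simp only [sat_eq0, eval_hat, eval_var_z, eval_var_s, succ_def] at hx ⊢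
      rw [hatV_add_one, h, hx, ite_self]) n
  simpa only [sat_eq0, eval_hat, eval_var_z, eval_var_s] using this

theorem hatV_of_fast {f : M.D (nat ⇾ nat)}
    (h : ∀ n, |qval (M.app f n) - qval (M.app f (n + 1))| < eps (n + 1)) (n : M.D nat) :
    hatV f n = M.app f n := by
  classical
  refine hatV_eq_of_badV ?_
  have := induction (M := M) (f ∷ Env.nil) (eq0 (badT v1 v0) zeroT)
    (by simp [eval_badT, zero_def, badV_zero]) (fun x hx => by
      simp only [sat_eq0, eval_badT, eval_var_z, eval_var_s, succ_def, eval_zeroT, zero_def]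
        at hx ⊢
      rw [badV_add_one, if_pos (h x), hx, add_zero]) n
  simpa only [sat_eq0, eval_badT, eval_var_z, eval_var_s, eval_zeroT, zero_def] using this

/-- The steps sum to `eps n - eps m`; keeping the negative term is what lets the induction on `m -
n` go through. -/
theorem abs_hatV_sub_le (f : M.D (nat ⇾ nat)) {n m : M.D nat} (h : n ≤ m) :
    |qval (hatV f n) - qval (hatV f m)| ≤ eps n - eps m := by
  obtain ⟨d, rfl⟩ := h
  have := induction (M := M) (n ∷ f ∷ Env.nil)
    (qLe (qAbs (qSub (hat v2 v1) (hat v2 (addT v1 v0)))) (qSub (qPow v1) (qPow (addT v1 v0))))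
    (by simp [eval_hat, zero_def, addV_def]) (fun x hx => by
      simp only [sat_qLe, qval_qAbs, qval_qSub, qval_qPow, eval_hat, eval_var_z, eval_var_s,
        succ_def, eval_addT, addV_def] at hx ⊢
      rw [← add_assoc]
      have h₁ := abs_lt.1 (hatV_step f (n + x))
      have h₂ := abs_le.1 hx
      rw [eps_add_one] at h₁ ⊢
      rw [abs_le]
      constructor <;> linarith [h₁.1, h₁.2, h₂.1, h₂.2]) d
  simpa only [sat_qLe, qval_qAbs, qval_qSub, qval_qPow, eval_hat, eval_var_z, eval_var_s,
        eval_addT, addV_def] using this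

section Reals

variable {Γ : Ctx} (e : M.Env Γ)

@[simp] theorem sat_ltR (x y : Term Γ (nat ⇾ nat)) : Sat e (ltR x y) ↔
    ∃ n, eps n ≤ qval (hatV (eval e y) (n + 1)) - qval (hatV (eval e x) (n + 1)) := by
  simp [ltR, eval_hat, succ_def]

theorem sat_leR (x y : Term Γ (nat ⇾ nat)) : Sat e (leR x y) ↔
    ∀ n, qval (hatV (eval e x) (n + 1)) - qval (hatV (eval e y) (n + 1)) < eps n := by
  simp only [leR, sat_neg, sat_ltR, not_exists, not_le]

theorem sat_eqR (x y : Term Γ (nat ⇾ nat)) : Sat e (eqR x y) ↔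
    ∀ n, |qval (hatV (eval e x) (n + 1)) - qval (hatV (eval e y) (n + 1))| < eps n := by
  simp [eqR, eval_hat, succ_def]

@[simp] theorem hatV_ratR (q : Term Γ nat) (n : M.D nat) :
    hatV (eval e (ratR q)) n = eval e q :=
  hatV_of_const (fun _ => by rw [ratR, app_eval_lam, eval_wk]) n

/-- Each summand, read at shifted index, moves by less than `eps (n + 2)` in a step, so the sum
moves by less than `eps (n + 1)` and the correction `hat` leaves it unchanged. -/
theorem qval_hatV_addR (x y : Term Γ (nat ⇾ nat)) (n : M.D nat) :
    qval (hatV (eval e (addR x y)) n) =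
      qval (hatV (eval e x) (n + 1)) + qval (hatV (eval e y) (n + 1)) := by
  have h : ∀ n, qval (M.app (eval e (addR x y)) n) =
      qval (hatV (eval e x) (n + 1)) + qval (hatV (eval e y) (n + 1)) := fun n => by
    rw [addR, app_eval_lam, qval_qAdd, eval_hat, eval_hat, eval_wk, eval_wk, eval_succT,
      eval_var_z, succ_def]
  rw [hatV_of_fast, h]
  intro n
  have h₁ := abs_lt.1 (hatV_step (eval e x) (n + 1))
  have h₂ := abs_lt.1 (hatV_step (eval e y) (n + 1))
  rw [eps_add_one (n + 1)] at h₁ h₂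
  rw [h, h, abs_lt]
  constructor <;> linarith [h₁.1, h₁.2, h₂.1, h₂.2]

end Reals

/-! ## Events and probabilities -/

def Mem (w : M.D omega) (A : M.D event) : Prop := M.app (M.app (M.cst .mem) w) A = 0

/-- The `n`-th rational approximation to the probability of an event. -/
noncomputable def prb (A : M.D event) (n : M.D nat) : M.K := qval (hatV (M.app (M.cst .prob) A) n)

def unionV (A B : M.D event) : M.D event := M.app (M.app (M.cst .union) A) B
def complV (A : M.D event) : M.D event := M.app (M.cst .compl) A
def interV (A B : M.D event) : M.D event := complV (unionV (complV A) (complV B))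

@[simp] theorem sat_memF {Γ : Ctx} (e : M.Env Γ) (w : Term Γ omega) (A : Term Γ event) :
    Sat e (memF w A) ↔ Mem (eval e w) (eval e A) := Iff.rfl

theorem qval_hat_probT {Γ : Ctx} (e : M.Env Γ) (A : Term Γ event) (n : Term Γ nat) :
    qval (eval e (hat (probT A) n)) = prb (eval e A) (eval e n) := by
  rw [eval_hat]; rfl

theorem mem_unionV {w : M.D omega} {A B : M.D event} :
    Mem w (unionV A B) ↔ Mem w A ∨ Mem w B := by
  have := IsModel.sat (M := M) (Γ := [omega, event, event])
    (memF v0 (unionT v1 v2) ⟺ (memF v0 v1 ⋎ memF v0 v2))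
    (fun _ _ => .ax (.inl (.mem_union _ _ _))) (w ∷ A ∷ B ∷ Env.nil)
  rw [sat_iff] at this
  exact this

theorem mem_complV {w : M.D omega} {A : M.D event} : Mem w (complV A) ↔ ¬ Mem w A := by
  have := IsModel.sat (M := M) (Γ := [omega, event]) (memF v0 (complT v1) ⟺ (memF v0 v1).neg)
    (fun _ _ => .ax (.inl (.mem_compl _ _))) (w ∷ A ∷ Env.nil)
  rw [sat_iff] at this
  exact this

theorem mem_interV {w : M.D omega} {A B : M.D event} :
    Mem w (interV A B) ↔ Mem w A ∧ Mem w B := by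
  rw [interV, mem_complV, mem_unionV, mem_complV, mem_complV, not_or, not_not, not_not]

end Struct

/-- The axioms on the probability content, as generalized formulas. -/
def probAxioms (Γ : Ctx) : List (Formula Γ) :=
  [all event (leR (ratR qZero) (probT v0)),
    all event (all event (subsetF v1 v0 ⟹ leR (probT v1) (probT v0))),
    eqR (probT fullT) (ratR qOne),
    all event (all event (eqR (addR (probT (unionT v1 v0)) (probT (interT v1 v0)))
      (addR (probT v1) (probT v0))))]

/-- These axioms reach the models as assumptions of the derivation. Obtaining them from
`IsModel.sat` would mean pushing substitutions through all the terms that define real arithmetic. -/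
theorem deriv_probAxioms {Γ : Ctx} (Δ : List (Formula Γ)) (φ : Formula Γ)
    (h : φ ∈ probAxioms Γ) : Deriv FPUB Δ φ := by
  simp only [probAxioms, List.mem_cons, List.not_mem_nil, or_false] at h
  rcases h with rfl | rfl | rfl | rfl
  · exact .all_intro (.ax (.inl (.prob_nonneg _)))
  · exact .all_intro (.all_intro (.ax (.inl (.prob_mono _ _))))
  · exact .ax (.inl .prob_full)
  · exact .all_intro (.all_intro (.ax (.inl (.prob_union_inter _ _))))

/-- Models in which the axioms on the probability content hold. -/
class Struct.IsProbModel (M : Struct) : Prop extends M.IsModel where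
  exists_sat : ∃ (Γ : Ctx) (e : M.Env Γ), ∀ φ ∈ probAxioms Γ, Struct.Sat e φ

namespace Struct

/-! ### Approximate laws of the probability content -/

section Content

variable {M : Struct} [M.IsProbModel]

theorem prb_nonneg (A : M.D event) (n : M.D nat) : -eps n < prb A (n + 1) := by
  obtain ⟨Γ, e, he⟩ := IsProbModel.exists_sat (M := M)
  have := he _ (List.mem_cons_self ..) A
  rw [sat_leR] at this
  have := this n
  rw [hatV_ratR, qval_qZero] at this
  have h : 0 - prb A (n + 1) < eps n := this
  linarith

theorem prb_mono {A B : M.D event} (h : ∀ w, Mem w A → Mem w B) (n : M.D nat) :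
    prb A (n + 1) < prb B (n + 1) + eps n := by
  obtain ⟨Γ, e, he⟩ := IsProbModel.exists_sat (M := M)
  have := he _ (List.mem_cons_of_mem _ (List.mem_cons_self ..)) A B
  rw [sat_imp, sat_leR] at this
  have h' : prb A (n + 1) - prb B (n + 1) < eps n := this h n
  linarith

/-- One `eps n` comes from the probability of the full event, the other from monotonicity. -/
theorem prb_lt (A : M.D event) (n : M.D nat) : prb A (n + 1) < 1 + 2 * eps n := by
  obtain ⟨Γ, e, he⟩ := IsProbModel.exists_sat (M := M)
  have := he (eqR (probT fullT) (ratR qOne)) (by simp [probAxioms])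
  rw [sat_eqR] at this
  have := this n
  rw [hatV_ratR, qval_qOne] at this
  have h : |prb (complV (M.cst .empty)) (n + 1) - 1| < eps n := this
  have he := IsModel.sat (M := M) (Γ := [omega]) (memF v0 emptyT).neg
    (fun _ _ => .ax (.inl (.mem_empty _)))
  have h' := prb_mono (A := A) (B := complV (M.cst .empty))
    (fun w _ => mem_complV.2 (he (w ∷ Env.nil))) n
  linarith [(abs_lt.1 h).2]

/-- The comparison of reals and the addition of reals each shift the index by one. -/
theorem prb_union_inter (A B : M.D event) (n : M.D nat) :
    |prb (unionV A B) (n + 1 + 1) + prb (interV A B) (n + 1 + 1) -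
      (prb A (n + 1 + 1) + prb B (n + 1 + 1))| < eps n := by
  obtain ⟨Γ, e, he⟩ := IsProbModel.exists_sat (M := M)
  have := he (all event (all event (eqR (addR (probT (unionT v1 v0)) (probT (interT v1 v0)))
      (addR (probT v1) (probT v0))))) (by simp [probAxioms]) A B
  rw [sat_eqR] at this
  have := this n
  rw [qval_hatV_addR, qval_hatV_addR] at this
  exact this

end Content

variable {M : Struct} [M.IsModel]

theorem abs_prb_sub_le (A : M.D event) {n m : M.D nat} (h : n ≤ m) :
    |prb A n - prb A m| ≤ eps n :=
  (abs_hatV_sub_le _ h).trans (by linarith [eps_pos m])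

/-! ## Dependent choice and uniform boundedness -/

/-- The choice sequence has no prescribed value at `0`. -/
theorem dc {Γ : Ctx} (e : M.Env Γ) (φ : Formula (event :: event :: nat :: Γ))
    (h : ∀ n y, ∃ z, Sat (z ∷ y ∷ n ∷ e) φ) :
    ∃ f : M.D (nat ⇾ event), ∀ n, Sat (M.app f (n + 1) ∷ M.app f n ∷ n ∷ e) φ := by
  have := IsModel.sat (M := M) (all nat (all event (ex event φ)) ⟹
    ex (nat ⇾ event) (all nat (φ.subst (Sub.cons (v1 ⬝ succT v0)
      (Sub.cons (v1 ⬝ v0) (Sub.cons v0 (fun _ v => .var (.s (.s v))))))))) (fun Δ s => by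
      have := FAxioms.dc [event] (φ.subst (((s.lift nat).lift event).lift event))
      refine .ax (.inl ?_)
      convert this using 1
      simp only [Formula.subst, Formula.subst_subst, dcMatrix]
      refine congrArg (Formula.imp _) (congrArg (Formula.ex _) (congrArg (Formula.all _)
        (congrArg (fun s => Formula.subst s φ) (Sub.hext fun τ v => ?_))))
      cases v with
      | z => rfl
      | s v => cases v with
        | z => rfl
        | s v => cases v with
          | z => rfl
          | s v =>
            simp only [Sub.comp, Sub.lift, Sub.cons, Term.subst, Term.subst_wk]
            rw [Term.wk, Term.rename_eq_subst, Term.wk, Term.rename_eq_subst, Term.subst_subst]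
            rfl) e
  simp only [sat_imp, sat_all, sat_ex, sat_subst] at this
  obtain ⟨f, hf⟩ := this h
  refine ⟨f, fun n => ?_⟩
  rw [← succ_def]
  convert hf n using 1
  funext τ v
  cases v with
  | z => rfl
  | s v => cases v with
    | z => rfl
    | s v => cases v with
      | z => rfl
      | s v => rfl

end Struct

/-- The renaming that inserts variables behind the two innermost ones. -/
def Ren.insert₃ (Γ : Ctx) (α β a b c : Ty) : Ren (α :: β :: Γ) (α :: β :: a :: b :: c :: Γ)
  | _, .z => .z
  | _, .s .z => .s .z
  | _, .s (.s v) => .s (.s (.s (.s (.s v))))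

def Ren.insert₄ (Γ : Ctx) (α β a b c d : Ty) :
    Ren (α :: β :: Γ) (α :: β :: a :: b :: c :: d :: Γ)
  | _, .z => .z
  | _, .s .z => .s .z
  | _, .s (.s v) => .s (.s (.s (.s (.s (.s v)))))

/-- The instance of uniform boundedness for formulas that only depend on the bounded variable and
one variable of the abstract type. -/
def ubFormula {Γ : Ctx} (V : Ty) (φ : Formula (nat :: V :: Γ)) : Formula Γ :=
  all (nat ⇾ nat) (all nat (all nat (all V (ex nat (φ.subst fun _ v => .var
      (Ren.insert₃ Γ nat V nat nat (nat ⇾ nat) v))))) ⟹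
    ex (nat ⇾ nat) (all nat (all nat (all V (ex nat (le0 v0 (v4 ⬝ v3) ⋏ φ.subst fun _ v => .var
      (Ren.insert₄ Γ nat V nat nat (nat ⇾ nat) (nat ⇾ nat) v)))))))

/-- The schema is used with `x` of type `0` and the single variable `z` of type `V`. As the matrix
ignores `y`, `k` and `x`, the truncation of `x` disappears. -/
theorem ubAxioms_ubFormula {Γ : Ctx} (V : Ty) (φ : Formula (nat :: V :: Γ))
    (hφ : IsExistential φ) : UBAxioms V (ubFormula V φ) := by
  have := UBAxioms.ub (V := V) [] [[]] (φ.subst fun _ v => .var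
      (Ren.insert₃ Γ nat V nat nat (nat ⇾ nat) v)) (hφ.subst _)
  have h : ubMatrix V [] [[]] (φ.subst fun _ v => .var
      (Ren.insert₃ Γ nat V nat nat (nat ⇾ nat) v)) = (φ.subst fun _ v => .var
      (Ren.insert₃ Γ nat V nat nat (nat ⇾ nat) v)) := by
    refine (Formula.subst_subst _ _ _).trans ?_
    refine congrArg (fun s => Formula.subst s φ) (Sub.hext fun τ v => ?_)
    cases v with
    | z => rfl
    | s v => cases v with
      | z => rfl
      | s v => rfl
  rw [h] at this
  refine Eq.mp (congrArg (UBAxioms V (Γ := Γ)) ?_) this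
  refine congrArg (Formula.all _) (congrArg (Formula.imp _) (congrArg (Formula.ex _)
    (congrArg (Formula.all _) (congrArg (Formula.all _) (congrArg (Formula.all _)
    (congrArg (Formula.ex _) (congrArg (Formula.and _) ?_)))))))
  refine (Formula.rename_eq_subst _ _).trans ((Formula.subst_subst _ _ _).trans
    (congrArg (fun s => Formula.subst s φ) (Sub.hext fun τ v => ?_)))
  cases v with
  | z => rfl
  | s v => cases v with
    | z => rfl
    | s v => rfl

/-- `IsModel.sat` asks for all substitution instances; this makes them instances of the same schema.
-/
theorem ubFormula_subst {Γ Δ : Ctx} (V : Ty) (φ : Formula (nat :: V :: Γ)) (s : Sub Γ Δ) :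
    (ubFormula V φ).subst s = ubFormula V (φ.subst ((s.lift V).lift nat)) := by
  simp only [ubFormula, Formula.subst, Formula.subst_subst]
  refine congrArg (Formula.all _) (congrArg₂ Formula.imp (congrArg (Formula.all _)
    (congrArg (Formula.all _) (congrArg (Formula.all _) (congrArg (Formula.ex _)
    (congrArg (fun s => Formula.subst s φ) (Sub.hext fun τ v => ?_))))))
    (congrArg (Formula.ex _) (congrArg (Formula.all _) (congrArg (Formula.all _)
    (congrArg (Formula.all _) (congrArg (Formula.ex _) (congrArg (Formula.and _)
    (congrArg (fun s => Formula.subst s φ) (Sub.hext fun τ v => ?_)))))))))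
  · cases v with
    | z => rfl
    | s v => cases v with
      | z => rfl
      | s v =>
        simp only [Sub.comp, Sub.lift, Sub.cons, Term.subst, Ren.insert₃, Term.wk,
          Term.rename_eq_subst, Term.subst_subst, Ren.wk]
  · cases v with
    | z => rfl
    | s v => cases v with
      | z => rfl
      | s v =>
        simp only [Sub.comp, Sub.lift, Sub.cons, Term.subst, Ren.insert₄, Term.wk,
          Term.rename_eq_subst, Term.subst_subst, Ren.wk]

namespace Struct

variable {M : Struct} [M.IsModel]

theorem uniform_bound {Γ : Ctx} (e : M.Env Γ) {V : Ty} (hV : V = omega ∨ V = event)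
    (φ : Formula (nat :: V :: Γ)) (hφ : IsExistential φ) (h : ∀ z, ∃ w, Sat (w ∷ z ∷ e) φ) :
    ∃ N : M.D nat, ∀ z, ∃ w ≤ N, Sat (w ∷ z ∷ e) φ := by
  have := IsModel.sat (M := M) (ubFormula V φ) (fun Δ s => by
    rw [ubFormula_subst]
    have := ubAxioms_ubFormula V _ (hφ.subst ((s.lift V).lift nat))
    rcases hV with rfl | rfl
    · exact .ax (.inr (.inl this))
    · exact .ax (.inr (.inr this))) e
  simp only [ubFormula, sat_all, sat_imp, sat_ex, sat_and, sat_subst, sat_le0] at this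
  -- The value of `y` is irrelevant; any object of type `1` serves.
  obtain ⟨χ, hχ⟩ := this (M.cst .succ) (fun _ _ z => by
    obtain ⟨w, hw⟩ := h z
    refine ⟨w, ?_⟩
    convert hw using 1
    funext τ v
    cases v with
    | z => rfl
    | s v => cases v with
      | z => rfl
      | s v => rfl)
  refine ⟨M.app χ 0, fun z => ?_⟩
  obtain ⟨w, hw, hs⟩ := hχ 0 0 z
  refine ⟨w, hw, ?_⟩
  convert hs using 1
  funext τ v
  cases v with
  | z => rfl
  | s v => cases v with
    | z => rfl
    | s v => rfl

end Struct
end ProbLogic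

/-! ### The main argument: covering the limit by one event -/

namespace ProbLogic

open Ty Formula

namespace Struct

set_option linter.unusedSectionVars false

section Bounds

variable {M : Struct} [M.IsModel]

theorem eps_le_one (n : M.D nat) : eps n ≤ 1 := by
  refine inv_le_one_of_one_le₀ ?_
  rw [← map_one cast, cast_le]
  have := add_one_le_iff'.2 (pow2_pos n)
  rwa [zero_add] at this

theorem qval_qCode_pow {Γ : Ctx} (e : M.Env Γ) (a n : Term Γ nat) :
    qval (eval e (qCode a zeroT (predT (pow2T n)))) = cast (eval e a) * eps (eval e n) := by
  rw [qval_qCode, cast_eval_zeroT, eval_predT, eval_pow2T, cast_predV (pow2_pos _).ne', sub_zero]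
  rfl

/-- A strict inequality witnessed at one precision is turned into an approximate one at every
precision. At finer precision the margin `eps l` absorbs the change; at coarser precision the change
is below `eps l'`. -/
theorem prb_le_of_eps_le {A : M.D event} {q : M.K} {l : M.D nat}
    (h : eps l ≤ q - prb A (l + 1)) (l' : M.D nat) : prb A (l' + 1) ≤ q + eps l' := by
  have h₀ := eps_pos l
  have h₁ := eps_pos l'
  rcases le_total l l' with hl | hl
  · have := abs_le.1 (abs_prb_sub_le A (add_le_add_left hl 1))
    rw [eps_add_one] at this
    linarith [this.1]
  · have := abs_le.1 (abs_prb_sub_le A (add_le_add_left hl 1))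
    rw [eps_add_one] at this
    linarith [this.2]

end Bounds

variable {M : Struct} [M.IsProbModel]

/-- A sequence of events has a member whose probability is almost minimal. -/
theorem exists_prb_le (g : M.D (nat ⇾ event)) (l : M.D nat) :
    ∃ j, ∀ k, prb (M.app g j) (l + 1) ≤ prb (M.app g k) (l + 1) + eps (l + 1) := by
  by_contra! h
  -- If there were no almost minimal member, every value could be lowered by `eps (l + 1)`. By
  -- induction on `L`, no member has value at most `L * eps (l + 1) - 1`; for `L = 0` this is
  -- near-nonnegativity.
  have key := induction (M := M) (g ∷ l ∷ Env.nil)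
    (ex nat (qLe (hat (probT (v2 ⬝ v0)) (succT v3))
      (qSub (qCode v1 zeroT (predT (pow2T (succT v3)))) qOne))).neg
    (by
      simp only [sat_neg, sat_ex, sat_qLe, qval_hat_probT, qval_qSub, qval_qCode_pow, qval_qOne,
        eval_app, eval_var_z, eval_var_s, eval_succT, succ_def, zero_def, map_zero, zero_mul]
      rintro ⟨j, hj⟩
      linarith [prb_nonneg (M.app g j) l, eps_le_one l])
    (fun L hL => by
      simp only [sat_neg, sat_ex, sat_qLe, qval_hat_probT, qval_qSub, qval_qCode_pow, qval_qOne,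
        eval_app, eval_var_z, eval_var_s, eval_succT, succ_def, map_add, map_one] at hL ⊢
      rintro ⟨j, hj⟩
      obtain ⟨k, hk⟩ := h j
      -- This choice of `L` makes the excluded bound equal to 3, although every value is below `1 +
      -- 2 * eps l ≤ 3`.
      exact hL ⟨k, by linarith⟩) (pow2 (l + 1) * (1 + 1 + 1 + 1))
  simp only [sat_neg, sat_ex, sat_qLe, qval_hat_probT, qval_qSub, qval_qCode_pow, qval_qOne,
    eval_app, eval_var_z, eval_var_s, eval_succT, succ_def, map_add, map_one, map_mul] at key
  refine key ⟨0, ?_⟩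
  have h₁ : cast (pow2 (l + 1)) * eps (l + 1) = 1 := mul_inv_cancel₀ (cast_pow2_pos _).ne'
  have h₂ : cast (pow2 (l + 1)) * (1 + 1 + 1 + 1) * eps (l + 1) = 4 := by
    linear_combination 4 * h₁
  linarith [prb_lt (M.app g 0) l, eps_le_one l]

section Main

variable {E : M.D (nat ⇾ nat ⇾ event)} {m : M.D nat}

/-- If the closed event `⋂ₖ E n k` is contained in an event of probability less than
`1 - 2⁻ᵐ`, then so is one of the events `E n k`. -/
theorem exists_prb_le_of_cover {n : M.D nat} {A : M.D event}
    (hanti : ∀ {k k' : M.D nat} {w : M.D omega}, k ≤ k' → Mem w (M.app (M.app E n) k') →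
      Mem w (M.app (M.app E n) k))
    (hA : ∃ l, eps l ≤ 1 - eps m - prb A (l + 1))
    (hc : ∀ w, ¬ Mem w A → ∃ k, ¬ Mem w (M.app (M.app E n) k)) :
    ∃ k, ∀ l, prb (M.app (M.app E n) k) (l + 1) ≤ 1 - eps m + 2 * eps l := by
  -- Compactness: for each sample point some `k` shows that it is in `A` or outside `E n k`, and
  -- such `k` are bounded uniformly by `N`. By antitonicity `E n N` lies in `A`.
  obtain ⟨N, hN⟩ := uniform_bound (M := M) (V := omega) (n ∷ E ∷ A ∷ Env.nil) (.inl rfl)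
    (memF v1 v4 ⋎ (memF v1 (v3 ⬝ v2 ⬝ v0)).neg) (.qf ⟨trivial, trivial, trivial⟩) (fun w => by
      simp only [sat_or, sat_neg, sat_memF, eval_app, eval_var_z, eval_var_s]
      by_cases h : Mem w A
      · exact ⟨0, .inl h⟩
      · exact (hc w h).imp fun k hk => .inr hk)
  simp only [sat_or, sat_neg, sat_memF, eval_app, eval_var_z, eval_var_s] at hN
  obtain ⟨l, hl⟩ := hA
  refine ⟨N, fun l' => ?_⟩
  have h₁ := prb_le_of_eps_le hl l'
  have h₂ := prb_mono (A := M.app (M.app E n) N) (B := A) (fun w hw => by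
    obtain ⟨k, hk, h⟩ := hN w
    exact h.resolve_right fun h => h (hanti hk hw)) l'
  linarith

/-- The sixth successor. -/
abbrev succ6 {Γ : Ctx} (t : Term Γ nat) : Term Γ nat :=
  succT (succT (succT (succT (succT (succT t)))))

/-- The event `f (n + 1)` is the union of the chosen `E i j` for `i ≤ n`. The clause `n ≠ 0`
discards the unspecified `f 0`. The precision grows with `n` so that the accumulated errors stay
summable. -/
theorem exists_event_sequence (E : M.D (nat ⇾ nat ⇾ event)) (m : M.D nat) :
    ∃ f : M.D (nat ⇾ event), ∀ n, ∃ j,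
      (∀ k, prb (M.app (M.app E n) j) (n + m + 1 + 1 + 1 + 1 + 1 + 1) ≤
        prb (M.app (M.app E n) k) (n + m + 1 + 1 + 1 + 1 + 1 + 1) +
          eps (n + m + 1 + 1 + 1 + 1 + 1 + 1)) ∧
      ∀ w, Mem w (M.app f (n + 1)) ↔
        Mem w (M.app (M.app E n) j) ∨ (n ≠ 0 ∧ Mem w (M.app f n)) := by
  have := dc (M := M) (E ∷ m ∷ Env.nil)
    (ex nat (all nat (qLe
        (hat (probT (.var (.s (.s (.s (.s (.s .z))))) ⬝ v4 ⬝ v1))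
          (succ6 (addT v4 (.var (.s (.s (.s (.s (.s (.s .z))))))))))
        (qAdd (hat (probT (.var (.s (.s (.s (.s (.s .z))))) ⬝ v4 ⬝ v0))
            (succ6 (addT v4 (.var (.s (.s (.s (.s (.s (.s .z))))))))))
          (qPow (succ6 (addT v4 (.var (.s (.s (.s (.s (.s (.s .z)))))))))))) ⋏
      all omega (memF v0 v2 ⟺ (memF v0 (.var (.s (.s (.s (.s (.s .z))))) ⬝ v4 ⬝ v1) ⋎
        ((eq0 v4 zeroT).neg ⋏ memF v0 v3)))))
    (fun n y => by
      obtain ⟨j, hj⟩ := exists_prb_le (M.app E n) (n + m + 1 + 1 + 1 + 1 + 1)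
      simp only [sat_ex, sat_and, sat_all, sat_or, sat_neg, sat_iff, sat_eq0, sat_memF, sat_qLe,
        qval_qAdd, qval_qPow, qval_hat_probT, eval_app, eval_succT, succ6, eval_addT, succ_def, addV_def,
        eval_var_z, eval_var_s, eval_zeroT, zero_def]
      by_cases hn : n = 0
      · exact ⟨M.app (M.app E n) j, j, hj, fun w => by simp [hn]⟩
      · exact ⟨unionV (M.app (M.app E n) j) y, j, hj, fun w => by simp [hn, mem_unionV]⟩)
  simpa only [sat_ex, sat_and, sat_all, sat_or, sat_neg, sat_iff, sat_eq0, sat_memF, sat_qLe,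
    qval_qAdd, qval_qPow, qval_hat_probT, eval_app, eval_succT, succ6, eval_addT, succ_def, addV_def,
    eval_var_z, eval_var_s, eval_zeroT, zero_def] using this

/-- By inclusion-exclusion, adding `D` to `C` costs at most the probability of `D` minus that of
`Q`, since `Q` lies in both. The slack shrinks from `eps (s + 2)` to `eps (s + 3)`, which pays for
the approximation errors. -/
theorem prb_union_step {C C' D Q : M.D event} {s : M.D nat} {b T : M.K}
    (hC' : ∀ w, Mem w C' → Mem w D ∨ Mem w C) (hQD : ∀ w, Mem w Q → Mem w D)
    (hQC : ∀ w, Mem w Q → Mem w C)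
    (h : prb C (s + 1 + 1 + 1 + 1 + 1 + 1) + eps (s + 1 + 1) ≤
      prb Q (s + 1 + 1 + 1 + 1 + 1 + 1) + T)
    (hD : prb D (s + 1 + 1 + 1 + 1 + 1 + 1 + 1) ≤ b + eps (s + 1 + 1 + 1 + 1 + 1 + 1 + 1)) :
    prb C' (s + 1 + 1 + 1 + 1 + 1 + 1 + 1) + eps (s + 1 + 1 + 1) ≤ b + T := by
  have hle : s + 1 + 1 + 1 + 1 + 1 + 1 ≤ s + 1 + 1 + 1 + 1 + 1 + 1 + 1 := ⟨1, rfl⟩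
  have h₁ := prb_mono (A := C') (B := unionV D C) (fun w hw => mem_unionV.2 (hC' w hw))
    (s + 1 + 1 + 1 + 1 + 1 + 1)
  have h₂ := (abs_lt.1 (prb_union_inter D C (s + 1 + 1 + 1 + 1 + 1))).2
  have h₃ := (abs_le.1 (abs_prb_sub_le C hle)).1
  have h₄ := (abs_le.1 (abs_prb_sub_le Q hle)).2
  have h₅ := prb_mono (A := Q) (B := interV D C)
    (fun w hw => mem_interV.2 ⟨hQD w hw, hQC w hw⟩) (s + 1 + 1 + 1 + 1 + 1 + 1)
  have h₆ := eps_pos s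
  -- The six errors sum to `13/128` of `eps s`, below the available `16/128`.
  simp only [eps_add_one] at *
  linarith

/-- If the increasing union of the closed events `⋂ₖ E n k` is not almost sure in the limit, then
it is contained in an event of probability less than `1`. -/
theorem exists_cover
    (hmono : ∀ {n n' k : M.D nat} {w : M.D omega}, n ≤ n' → Mem w (M.app (M.app E n) k) →
      Mem w (M.app (M.app E n') k))
    (hanti : ∀ {n k k' : M.D nat} {w : M.D omega}, k ≤ k' → Mem w (M.app (M.app E n) k') →
      Mem w (M.app (M.app E n) k))
    (h : ∀ n, ∃ A, (∃ l, eps l ≤ 1 - eps m - prb A (l + 1)) ∧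
      ∀ w, ¬ Mem w A → ∃ k, ¬ Mem w (M.app (M.app E n) k)) :
    ∃ A, (∃ l, eps l ≤ 1 - prb A (l + 1)) ∧
      ∀ w, (∃ n, ∀ k, Mem w (M.app (M.app E n) k)) → Mem w A := by
  have hbound : ∀ n, ∃ k, ∀ l, prb (M.app (M.app E n) k) (l + 1) ≤ 1 - eps m + 2 * eps l := by
    intro n
    obtain ⟨A, hA, hc⟩ := h n
    exact exists_prb_le_of_cover hanti hA hc
  obtain ⟨f, hf⟩ := exists_event_sequence E m
  have hstep : ∀ n w, Mem w (M.app f (n + 1)) → Mem w (M.app f (n + 1 + 1)) := by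
    intro n w hw
    obtain ⟨j, _, hj⟩ := hf (n + 1)
    exact (hj w).2 (.inr ⟨add_one_ne_zero n, hw⟩)
  have hchain : ∀ {n n'} {w}, n ≤ n' → Mem w (M.app f (n + 1)) → Mem w (M.app f (n' + 1)) := by
    rintro n _ w ⟨d, rfl⟩ hw
    have := induction (M := M) (w ∷ n ∷ f ∷ Env.nil) (memF v1 (v3 ⬝ succT (addT v2 v0)))
      (by simpa only [sat_memF, eval_app, eval_succT, eval_addT, succ_def, addV_def, eval_var_z,
        eval_var_s, zero_def, add_zero] using hw)
      (fun x hx => by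
        simp only [sat_memF, eval_app, eval_succT, eval_addT, succ_def, addV_def, eval_var_z,
          eval_var_s, ← add_assoc] at hx ⊢
        exact hstep _ _ hx) d
    simpa only [sat_memF, eval_app, eval_succT, eval_addT, succ_def, addV_def, eval_var_z,
      eval_var_s] using this
  -- The invariant: the union up to `n` exceeds no `E n k` by more than `eps (m + 1)`. The slack on
  -- the left, halved at each step, is the budget for the errors still to come.
  have hinv : ∀ n k, prb (M.app f (n + 1)) (n + m + 1 + 1 + 1 + 1 + 1 + 1) + eps (n + m + 1 + 1) ≤
      prb (M.app (M.app E n) k) (n + m + 1 + 1 + 1 + 1 + 1 + 1) + eps (m + 1) := by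
    intro n
    have := induction (M := M) (f ∷ E ∷ m ∷ Env.nil)
      (all nat (qLe (qAdd (hat (probT (v2 ⬝ succT v1))
          (succT (succT (succT (succT (succT (succT (addT v1 v4))))))))
          (qPow (succT (succT (addT v1 v4)))))
        (qAdd (hat (probT (v3 ⬝ v1 ⬝ v0))
          (succT (succT (succT (succT (succT (succT (addT v1 v4))))))))
          (qPow (succT v4)))))
      (by
        simp only [sat_all, sat_qLe, qval_qAdd, qval_qPow, qval_hat_probT, eval_app, eval_succT,
          eval_addT, succ_def, addV_def, eval_var_z, eval_var_s, zero_def]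
        intro k
        obtain ⟨j, h₁, h₂⟩ := hf 0
        have h₃ := h₁ k
        have h₄ := prb_mono (A := M.app f (0 + 1)) (B := M.app (M.app E 0) j) (fun w hw => by
          simpa using (h₂ w).1 hw) (0 + m + 1 + 1 + 1 + 1 + 1)
        have h₅ := eps_pos m
        simp only [zero_add] at h₃ h₄ ⊢
        simp only [eps_add_one] at h₃ h₄ ⊢
        linarith)
      (fun n hn => by
        simp only [sat_all, sat_qLe, qval_qAdd, qval_qPow, qval_hat_probT, eval_app, eval_succT,
          eval_addT, succ_def, addV_def, eval_var_z, eval_var_s] at hn ⊢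
        intro k
        rw [add_right_comm n 1 m]
        obtain ⟨i, _, hi⟩ := hf n
        obtain ⟨j, h₁, h₂⟩ := hf (n + 1)
        rw [add_right_comm n 1 m] at h₁
        -- The index `i + j` dominates both choices: `E n (i + j)` lies in `E n i`, hence in the old
        -- union, and in `E n j`, hence in `E (n + 1) j`. The induction hypothesis is used at this
        -- index.
        refine prb_union_step (Q := M.app (M.app E n) (i + j)) (fun w hw => ?_) (fun w hw => ?_)
          (fun w hw => ?_) (hn _) (h₁ k)
        · exact ((h₂ w).1 hw).imp_right And.right
        · exact hanti (k := j) ⟨i, add_comm j i⟩ (hmono ⟨1, rfl⟩ hw)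
        · exact (hi w).2 (.inl (hanti (k := i) ⟨j, rfl⟩ hw))) n
    simpa only [sat_all, sat_qLe, qval_qAdd, qval_qPow, qval_hat_probT, eval_app, eval_succT,
      eval_addT, succ_def, addV_def, eval_var_z, eval_var_s] using this
  -- The bound is read off at a precision independent of `n`, so that it becomes a condition on
  -- events alone.
  have hsmall : ∀ n, prb (M.app f (n + 1)) (m + 1 + 1 + 1 + 1 + 1 + 1) ≤ 1 - eps (m + 1 + 1) := by
    intro n
    obtain ⟨k, hk⟩ := hbound n
    have h₁ := hk (n + m + 1 + 1 + 1 + 1 + 1)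
    have h₂ := hinv n k
    have h₃ := (abs_le.1 (abs_prb_sub_le (M.app f (n + 1))
      (n := m + 1 + 1 + 1 + 1 + 1 + 1) (m := n + m + 1 + 1 + 1 + 1 + 1 + 1)
      ⟨n, by ring⟩)).2
    have h₄ := eps_pos m
    have h₅ := eps_pos (n + m)
    simp only [eps_add_one] at *
    linarith
  by_contra! hn
  -- A premise `ℙ(A) < 1` hides an existential quantifier and would not fit into an existential
  -- matrix. The comparison at precision `m + 6` is quantifier-free and implies it.
  obtain ⟨N, hN⟩ := uniform_bound (M := M) (V := event) (f ∷ m ∷ Env.nil) (.inr rfl)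
    (ex omega ((memF v0 (v3 ⬝ succT v1) ⋏ (memF v0 v2).neg) ⋎
      (qLe (hat (probT v2) (succT (succT (succT (succT (succT (succT v4)))))))
        (qSub qOne (qPow (succT (succT v4))))).neg))
    (.ex ⟨[], omega, .inr (.inl rfl), by simp, rfl⟩
      (.qf ⟨⟨trivial, trivial, trivial⟩, ⟨trivial, trivial⟩, trivial⟩)) (fun A => by
      simp only [sat_ex, sat_and, sat_or, sat_neg, sat_memF, sat_qLe, qval_qSub, qval_qOne,
        qval_qPow, qval_hat_probT, eval_app, eval_succT, succ_def, eval_var_z, eval_var_s]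
      by_cases hA : prb A (m + 1 + 1 + 1 + 1 + 1 + 1) ≤ 1 - eps (m + 1 + 1)
      · obtain ⟨w, ⟨n, hw⟩, hw'⟩ := hn A ⟨m + 1 + 1 + 1 + 1 + 1, by
          have := eps_pos m
          simp only [eps_add_one] at *
          linarith⟩
        -- A point lying in all `E n k` lies in the chosen `E n j`, hence in `f (n + 1)`.
        obtain ⟨j, _, hj⟩ := hf n
        exact ⟨n, w, .inl ⟨(hj w).2 (.inl (hw j)), hw'⟩⟩
      -- The sample point is a dummy here, supplied by the constant of type `Ω`.
      · exact ⟨0, M.cst .point, .inr hA⟩)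
  simp only [sat_ex, sat_and, sat_or, sat_neg, sat_memF, sat_qLe, qval_qSub, qval_qOne,
    qval_qPow, qval_hat_probT, eval_app, eval_succT, succ_def, eval_var_z, eval_var_s] at hN
  -- The bound is applied to the union up to `N`, which contains all earlier unions and satisfies
  -- the probability condition.
  obtain ⟨n, hle, w, ⟨hw, hw'⟩ | hp⟩ := hN (M.app f (N + 1))
  · exact hw' (hchain hle hw)
  · exact hp (hsmall N)

end Main

end Struct
end ProbLogic

/-! ### Meaning of the statements in a model, and the equivalence -/

namespace ProbLogic

open Ty Formula

namespace Struct

variable {M : Struct}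

theorem sat_matrixAt {Γ Δ : Ctx} (φ : Formula (MatrixCtx Γ)) (r : Ren Γ Δ) (x n k : Term Δ nat)
    (w : Term Δ omega) (e : M.Env Δ) : Sat e (matrixAt φ r x n k w) ↔
      Sat (eval e w ∷ eval e k ∷ eval e n ∷ eval e x ∷ fun _ v => e (r v)) φ := by
  rw [matrixAt, sat_subst]
  refine iff_of_eq (congrArg (fun e => Sat e φ) ?_)
  funext τ v
  rcases v with _ | _ | _ | _ | v <;> rfl

/-- The set of sample points at which an instance of the matrix `φ` holds. -/
def MatrixSat {Γ : Ctx} (φ : Formula (MatrixCtx Γ)) (e : M.Env Γ) (x n k : M.D nat)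
    (w : M.D omega) : Prop :=
  Sat (w ∷ k ∷ n ∷ x ∷ e) φ

variable [M.IsModel]

theorem sat_probGe {Γ : Ctx} (φ : Formula (omega :: Γ)) (x : Term Γ (nat ⇾ nat)) (e : M.Env Γ) :
    Sat e (probGe φ x) ↔
      ∀ A, (∃ l, eps l ≤ qval (hatV (eval e x) (l + 1)) - prb A (l + 1)) →
        ∃ w, ¬ Mem w A ∧ Sat (w ∷ e) φ := by
  simp only [probGe, sat_all, sat_imp, sat_ltR, sat_ex, sat_and, sat_memF, sat_rename, eval_wk]
  refine forall_congr' fun A => imp_congr Iff.rfl (exists_congr fun w => and_congr ?_ ?_)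
  · exact mem_complV
  · refine iff_of_eq (congrArg (fun e => Sat e φ) ?_)
    funext τ v
    cases v <;> rfl

section Conditions

variable {Γ : Ctx} {φ : Formula (MatrixCtx Γ)} {P : Term Γ (nat ⇾ nat ⇾ nat ⇾ event)} {e : M.Env Γ}

theorem sat_measurableF : Sat e (measurableF φ P) ↔
    ∀ x n k w, Mem w (M.app (M.app (M.app (eval e P) x) n) k) ↔ MatrixSat φ e x n k w := by
  simp only [measurableF, sat_all, sat_iff, sat_memF, sat_matrixAt, eval_app, eval_wk, eval_var_z,
    eval_var_s]
  rfl

theorem sat_monotoneF : Sat e (monotoneF φ) ↔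
    ∀ x w k n n', n ≤ n' ∧ MatrixSat φ e x n k w → MatrixSat φ e x n' k w := by
  simp only [monotoneF, sat_all, sat_imp, sat_and, sat_le0, sat_matrixAt, eval_var_z, eval_var_s]
  rfl

theorem sat_antitoneF : Sat e (antitoneF φ) ↔
    ∀ x w n k k', k ≤ k' ∧ MatrixSat φ e x n k' w → MatrixSat φ e x n k w := by
  simp only [antitoneF, sat_all, sat_imp, sat_and, sat_le0, sat_matrixAt, eval_var_z, eval_var_s]
  rfl

theorem sat_pointwiseF : Sat e (pointwiseF φ) ↔
    ∀ x A, (∃ l, eps l ≤ 1 - prb A (l + 1)) →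
      ∃ w, ¬ Mem w A ∧ ∃ n, ∀ k, MatrixSat φ e x n k w := by
  simp only [pointwiseF, sat_all, sat_probGe, hatV_ratR, qval_qOne, sat_ex, sat_matrixAt,
    eval_var_z, eval_var_s]
  rfl

theorem sat_uniformF : Sat e (uniformF φ) ↔
    ∀ m x, ∃ n, ∀ A, (∃ l, eps l ≤ 1 - eps m - prb A (l + 1)) →
      ∃ w, ¬ Mem w A ∧ ∀ k, MatrixSat φ e x n k w := by
  simp only [uniformF, sat_all, sat_probGe, hatV_ratR, qval_qSub, qval_qPow, qval_qOne, sat_ex,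
    sat_matrixAt, eval_var_z, eval_var_s]
  rfl

end Conditions

theorem exists_eps_le_sub {A : M.D event} {l : M.D nat} (h : eps l ≤ 1 - prb A (l + 1)) :
    ∃ l', eps l' ≤ 1 - eps (l + 1 + 1) - prb A (l' + 1) := by
  refine ⟨l + 1 + 1, ?_⟩
  have h₁ := (abs_le.1 (abs_hatV_sub_le (M.app (M.cst .prob) A)
    (n := l + 1) (m := l + 1 + 1 + 1) ⟨1 + 1, by ring⟩)).1
  change -(eps (l + 1) - eps (l + 1 + 1 + 1)) ≤ prb A (l + 1) - prb A (l + 1 + 1 + 1) at h₁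
  have h₂ := eps_pos l
  simp only [eps_add_one] at *
  linarith

theorem sat_pointwiseF_iff_uniformF {M : Struct} [M.IsProbModel] {Γ : Ctx} {e : M.Env Γ}
    {φ : Formula (MatrixCtx Γ)} {P : Term Γ (nat ⇾ nat ⇾ nat ⇾ event)}
    (hmeas : Sat e (measurableF φ P)) (hmono : Sat e (monotoneF φ))
    (hanti : Sat e (antitoneF φ)) : Sat e (pointwiseF φ) ↔ Sat e (uniformF φ) := by
  rw [sat_measurableF] at hmeas
  rw [sat_monotoneF] at hmono
  rw [sat_antitoneF] at hanti
  rw [sat_pointwiseF, sat_uniformF]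
  constructor
  · intro h m x
    -- The negation supplies, for each `n`, an event of probability below `1 - 2⁻ᵐ` outside of which
    -- every point leaves some `E n k`.
    by_contra! hn
    obtain ⟨A, hA, hc⟩ := exists_cover (E := M.app (eval e P) x) (m := m)
      (fun hle hw => (hmeas _ _ _ _).2 (hmono _ _ _ _ _ ⟨hle, (hmeas _ _ _ _).1 hw⟩))
      (fun hle hw => (hmeas _ _ _ _).2 (hanti _ _ _ _ _ ⟨hle, (hmeas _ _ _ _).1 hw⟩))
      (fun n => by simpa only [hmeas] using hn n)
    obtain ⟨w, hw, n, hk⟩ := h x A hA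
    exact hw (hc w ⟨n, fun k => (hmeas _ _ _ _).2 (hk k)⟩)
  · rintro h x A ⟨l, hl⟩
    -- A margin of `eps l` below 1 leaves room for `eps (l + 2)` and for the change of precision.
    obtain ⟨n, hn⟩ := h (l + 1 + 1) x
    obtain ⟨w, hw, hk⟩ := hn A (exists_eps_le_sub hl)
    exact ⟨w, hw, n, hk⟩

end Struct

/-- It lets the semantic argument work from a list of derived formulas in place of the original
assumptions. -/
theorem Deriv.cut {T : Theory} {Γ : Ctx} {Δ : List (Formula Γ)} {φ : Formula Γ} :
    ∀ L : List (Formula Γ), (∀ ψ ∈ L, Deriv T Δ ψ) → Deriv T L φ → Deriv T Δ φ := by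
  intro L
  induction L generalizing φ with
  | nil => exact fun _ h => h.weaken
  | cons ψ L ih =>
    intro hL h
    exact .imp_elim (ih (fun χ hχ => hL χ (List.mem_cons_of_mem _ hχ)) (.imp_intro h))
      (hL ψ (List.mem_cons_self ..))

end ProbLogic

theorem mainTheorem12 {Γ : ProbLogic.Ctx} (Δ : List (ProbLogic.Formula Γ))
    (φ : ProbLogic.Formula (ProbLogic.MatrixCtx Γ)) (hφ : φ.QF)
    (P : ProbLogic.Term Γ (.fn .nat (.fn .nat (.fn .nat .event))))
    (hmeas : ProbLogic.Deriv ProbLogic.FPUB Δ (ProbLogic.measurableF φ P))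
    (hmono : ProbLogic.Deriv ProbLogic.FPUB Δ (ProbLogic.monotoneF φ))
    (hanti : ProbLogic.Deriv ProbLogic.FPUB Δ (ProbLogic.antitoneF φ)) :
    ProbLogic.Deriv ProbLogic.FPUB Δ
      (ProbLogic.Formula.iff (ProbLogic.pointwiseF φ) (ProbLogic.uniformF φ)) := by
  -- The three conditions and the content axioms suffice as assumptions for the model-theoretic
  -- part; all of them are derivable from `Δ`.
  refine ProbLogic.Deriv.cut (ProbLogic.measurableF φ P :: ProbLogic.monotoneF φ ::
    ProbLogic.antitoneF φ :: ProbLogic.probAxioms Γ) ?_ ?_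
  · intro ψ hψ
    simp only [List.mem_cons] at hψ
    rcases hψ with rfl | rfl | rfl | hψ
    · exact hmeas
    · exact hmono
    · exact hanti
    · exact ProbLogic.deriv_probAxioms Δ ψ hψ
  · refine ProbLogic.completeness _ _ fun M hM e he => ?_
    simp only [List.forall_mem_cons] at he
    obtain ⟨h₁, h₂, h₃, h₄⟩ := he
    have : M.IsProbModel := { exists_sat := ⟨Γ, e, h₄⟩ }
    exact (ProbLogic.Struct.sat_iff _ _ _).2
      (ProbLogic.Struct.sat_pointwiseF_iff_uniformF h₁ h₂ h₃)
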